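/- Let $\ell$ be an odd prime and let $Q$ be a nondegenerate quadratic form on an $\mathbf F_\ell$-vector space $V$ of dimension $N$, with polar form $B(x,y)=Q(x+y)-Q(x)-Q(y)$. Let $O(N,\mathbf F_\ell)=O(V,Q)$ be its orthogonal group and $\Omega(N,\mathbf F_\ell)$ the derived group of $O(N,\mathbf F_\ell)$. The spinor norm $\mathrm N_{\rm Spin}(g)\in\{\pm1\}$ of a product $g$ of reflections in nonsingular vectors $v_1,\dots,v_k$ is $1$ if $Q(v_1)\cdots Q(v_k)$ is a square in $\mathbf F_\ell$ and $-1$ otherwise. For $N$ even put $\mathrm{disc}(Q)=(-1)^{N/2}\det(B(b_i,b_j))$ for a basis $(b_i)$ of $V$ (well defined modulo nonzero squares), and call $Q$ split if $V$ has a totally singular subspace of dimension $N/2$, nonsplit otherwise. The reduced characteristic polynomial of $g\in O(N,\mathbf F_\ell)$ is $$\det(1-Tg)_{\rm red}=\begin{cases}\det(1-Tg)/(1-\det(g)T)&\text{if } N \text{ is odd},\\ \det(1-Tg)/(1-T^2)&\text{if } N\text{ is even and }\det g=-1,\\ \det(1-Tg)&\text{otherwise.}\end{cases}$$ For $\varepsilon^{(1)},\varepsilon^{(2)}\in\{\pm1\}$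 let $N_{\rm red}=N-1$ if $N$ is odd, $N_{\rm red}=N$ if $N$ is even and $\varepsilon^{(1)}=1$, and $N_{\rm red}=N-2$ if $N$ is even and $\varepsilon^{(1)}=-1$. Let $M_{m,\ell}$ be the set of polynomials $1+b_1T+\cdots+b_mT^m\in\mathbf F_\ell[T]$ with $b_m^2=1$ and $b_{m-i}=b_mb_i$ for $0\le i\le m/2$. Say that $f\in M_{N_{\rm red},\ell}$ satisfies $(\ast)$ if $f(-1)\ne0$ is a square exactly when $\varepsilon^{(2)}=1$, and $\mathrm{disc}(f)=\mathrm{disc}(Q)$ modulo nonzero squares. When $f(x)=x^{N_{\rm red}/2}h(x+x^{-1})$ for a polynomial $h\in\mathbf F_\ell[x]$, call $h$ the polynomial associated with $f$. For $1\le i\le4$ let $$\Theta_\ell^{(i)}=\{g\in O(N,\mathbf F_\ell):\ \det g=\varepsilon^{(1)},\ \mathrm N_{\rm Spin}(g)=\varepsilon^{(2)},\ \det(1-Tg)_{\rm red}\in\tilde\Theta_\ell^{(i)}\},$$ where $\tilde\Theta_\ell^{(i)}\subset M_{N_{\rm red},\ell}$ is the following set. 1. $\tilde\Theta_\ell^{(1)}$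 consists of the $f\in M_{N_{\rm red},\ell}$ which are: irreducible, if $N$ is odd or $\varepsilon^{(1)}=-1$; irreducible with $(\ast)$, if $N$ is even, $\varepsilon^{(1)}=1$ and $Q$ is nonsplit; a product of two distinct monic irreducible polynomials of degree $N_{\rm red}/2$, if $N$ is even, $\varepsilon^{(1)}=1$, $Q$ is split and $\ell\equiv1\pmod 4$; a product of an irreducible monic quadratic polynomial and an irreducible polynomial of degree $N_{\rm red}-2$, if $N$ is even, $\varepsilon^{(1)}=1$, $Q$ is split and $\ell\equiv3\pmod 4$. 2. $\tilde\Theta_\ell^{(2)}$ consists of the $f\in M_{N_{\rm red},\ell}$ which are the product of a monic quadratic polynomial (not necessarily irreducible) and of distinct monic irreducible polynomials of odd degree. 3. $\tilde\Theta_\ell^{(3)}$ consists of the $f\in M_{N_{\rm red},\ell}$ which have an associated polynomial $h$ that is separable with at least one irreducible factor of prime degree $>N_{\rm red}/4$. 4. $\tilde\Theta_\ell^{(4)}$ consists of the $f\in M_{N_{\rm red},\ell}$ which have an associated polynomial $h$ that is separable with one irreducible quadratic factor and no other irreducible factor of even degree. In 2, 3 and 4 the polynomial $f$ is moreover required to satisfy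 $(\ast)$ when $N$ is even and $\varepsilon^{(1)}=1$. **Lemma.** For every $N\ge5$ there is $\ell_0(N)$, depending only on $N$, such that for every prime $\ell\ge\ell_0(N)$, every nondegenerate $Q$ of dimension $N$ over $\mathbf F_\ell$ and all $\varepsilon^{(1)},\varepsilon^{(2)}\in\{\pm1\}$, $$\frac{|\Theta_\ell^{(1)}|}{|\Omega(N,\mathbf F_\ell)|}\ge\frac1{4N^2},\qquad \frac{|\Theta_\ell^{(2)}|}{|\Omega(N,\mathbf F_\ell)|}\ge\frac1{5N},\qquad \frac{|\Theta_\ell^{(3)}|}{|\Omega(N,\mathbf F_\ell)|}\ge\frac7{3N},$$ $$\frac{|\Theta_\ell^{(4)}|}{|\Omega(N,\mathbf F_\ell)|}\ge\frac1{9N(N-6)}\ \text{ if }N_{\rm red}\ge10,\qquad \frac{|\Theta_\ell^{(4)}|}{|\Omega(N,\mathbf F_\ell)|}\ge\frac1{N^2}\ \text{ otherwise.}$$ -/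

import Mathlib

open Polynomial

namespace OrthSieve

noncomputable section

/-! ### Orthogonal groups, their derived groups and the spinor norm -/

section Orthogonal

variable {K V : Type*} [Field K] [AddCommGroup V] [Module K V]

/-- The orthogonal group of the quadratic space `(V, Q)`. -/
def orthogonalGroup (Q : QuadraticForm K V) : Subgroup (V ≃ₗ[K] V) where
  carrier := {g | ∀ v, Q (g v) = Q v}
  mul_mem' := by
    intro a b ha hb v
    exact (ha (b v)).trans (hb v)
  one_mem' := fun _ => rfl
  inv_mem' := by
    intro a ha v
    have h := ha (a⁻¹ v)
    have e : a (a⁻¹ v) = v := LinearEquiv.apply_symm_apply a v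
    rw [e] at h
    exact h.symm

/-- `Ω(Q)`, the derived group of the orthogonal group. -/
def omegaGroup (Q : QuadraticForm K V) : Subgroup (orthogonalGroup Q) :=
  commutator (orthogonalGroup Q)

/-- The linear endomorphism of `V` underlying an isometry. -/
def toEnd {Q : QuadraticForm K V} (g : orthogonalGroup Q) : Module.End K V :=
  ((g : V ≃ₗ[K] V) : V →ₗ[K] V)

/-- The reflection `x ↦ x - (B(v, x) / Q(v)) v` in a vector `v` with `Q v ≠ 0`, where
`B(x, y) = Q(x + y) - Q(x) - Q(y)` is the polar form of `Q`. -/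
def reflectionAt (Q : QuadraticForm K V) (v : V) : Module.End K V :=
  LinearMap.id - (Q v)⁻¹ • (QuadraticMap.polarBilin Q v).smulRight v

open Classical in
/-- The spinor norm with values in `{1, -1}`, over a finite field of odd characteristic (where
`Kˣ` modulo squares is identified with `{1, -1}`): if `g` is the product of the reflections in
`v₁, …, vₖ`, it is `1` when `Q(v₁) ⋯ Q(vₖ)` is a square and `-1` when it is not. The square
class of this product does not depend on the factorization of `g`. -/
def spinorNorm (Q : QuadraticForm K V) (g : orthogonalGroup Q) : ℤˣ :=
  if ∃ l : List V, (∀ v ∈ l, Q v ≠ 0) ∧ toEnd g = (l.map (reflectionAt Q)).prod ∧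
      IsSquare (l.map Q).prod
  then 1 else -1

/-- A quadratic space of even dimension is split if it has a totally singular subspace of half
its dimension. -/
def IsSplit (Q : QuadraticForm K V) : Prop :=
  ∃ W : Submodule K V, 2 * Module.finrank K W = Module.finrank K V ∧ ∀ w ∈ W, Q w = 0

variable [FiniteDimensional K V]

/-- The (signed) discriminant `(-1)^(N(N-1)/2) det (B(bᵢ, bⱼ))` of a quadratic space of
dimension `N`, for a basis `b`. It is only used up to nonzero squares, and for even `N`; it then
depends neither on the basis nor on whether the Gram matrix is that of the polar form or that
of its half. -/
def quadDisc (Q : QuadraticForm K V) : K :=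
  (-1) ^ (Module.finrank K V * (Module.finrank K V - 1) / 2) *
    (Matrix.of fun i j =>
      QuadraticMap.polar Q (Module.finBasis K V i) (Module.finBasis K V j)).det

/-- The reversed characteristic polynomial `det (1 - T g) = T ^ N * charpoly(g)(1 / T)` of an
invertible `g`. -/
def revCharpoly (g : Module.End K V) : K[X] := (LinearMap.charpoly g).reverse

open Classical in
/-- The reduced (reversed) characteristic polynomial `det (1 - T g)_red` of an isometry: the
factor that every isometry of that determinant has in its characteristic polynomial is removed.
The divisions are exact. -/
def redCharpoly (g : Module.End K V) : K[X] :=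
  if Odd (Module.finrank K V) then revCharpoly g / (1 - C (LinearMap.det g) * X)
  else if LinearMap.det g = -1 then revCharpoly g / (1 - X ^ 2)
  else revCharpoly g

end Orthogonal

/-! ### Sets of polynomials -/

/-- The degree of the reduced characteristic polynomial of an isometry of determinant `ε₁` in
dimension `N`. -/
def Nred (N : ℕ) (ε₁ : ℤˣ) : ℕ :=
  if Odd N then N - 1 else if ε₁ = 1 then N else N - 2

/-- The set `M_{m,ℓ}` of the polynomials `1 + b₁ T + ⋯ + b_m T ^ m` with `b_m ^ 2 = 1` and
`b_{m-i} = b_m b_i` for `0 ≤ i ≤ m / 2`. -/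
def selfRecip (K : Type*) [Field K] (m : ℕ) : Set K[X] :=
  {f | f.natDegree ≤ m ∧ f.coeff 0 = 1 ∧ f.coeff m ^ 2 = 1 ∧
    ∀ i ≤ m / 2, f.coeff (m - i) = f.coeff m * f.coeff i}

/-- `h` is the polynomial associated with `f` of degree `2 n`: `f(x) = x ^ n h(x + x⁻¹)`. -/
def IsTraceOf {K : Type*} [Field K] (n : ℕ) (f h : K[X]) : Prop :=
  toLaurent f = LaurentPolynomial.T (n : ℤ) *
    aeval (LaurentPolynomial.T 1 + LaurentPolynomial.T (-1) : LaurentPolynomial K) h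

section Theta

variable {ℓ : ℕ} [Fact ℓ.Prime] {V : Type*} [AddCommGroup V] [Module (ZMod ℓ) V]
  [FiniteDimensional (ZMod ℓ) V]

/-- `f(-1)` lies in the square class `ε₂`, and `disc f = disc Q` modulo nonzero squares. -/
def ValueDisc (Q : QuadraticForm (ZMod ℓ) V) (ε₂ : ℤˣ) (f : (ZMod ℓ)[X]) : Prop :=
  quadraticChar (ZMod ℓ) (f.eval (-1)) = (ε₂ : ℤ) ∧
    quadraticChar (ZMod ℓ) f.discr = quadraticChar (ZMod ℓ) (quadDisc Q)

/-- The condition `ValueDisc`, imposed where `f` is the characteristic polynomial of an element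
of the special orthogonal group in even dimension. -/
def Compatible (Q : QuadraticForm (ZMod ℓ) V) (ε₁ ε₂ : ℤˣ) (f : (ZMod ℓ)[X]) : Prop :=
  Even (Module.finrank (ZMod ℓ) V) → ε₁ = 1 → ValueDisc Q ε₂ f

/-- The polynomials of the first family. -/
def thetaPoly1 (Q : QuadraticForm (ZMod ℓ) V) (ε₁ ε₂ : ℤˣ) : Set (ZMod ℓ)[X] :=
  {f | f ∈ selfRecip (ZMod ℓ) (Nred (Module.finrank (ZMod ℓ) V) ε₁) ∧
    (Odd (Module.finrank (ZMod ℓ) V) ∨ ε₁ = -1 → Irreducible f) ∧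
    (Even (Module.finrank (ZMod ℓ) V) ∧ ε₁ = 1 →
      (¬ IsSplit Q → Irreducible f ∧ ValueDisc Q ε₂ f) ∧
      (IsSplit Q → ℓ % 4 = 1 → ∃ p q : (ZMod ℓ)[X],
        p.Monic ∧ Irreducible p ∧ q.Monic ∧ Irreducible q ∧ p ≠ q ∧
        2 * p.natDegree = Nred (Module.finrank (ZMod ℓ) V) ε₁ ∧
        2 * q.natDegree = Nred (Module.finrank (ZMod ℓ) V) ε₁ ∧ f = p * q) ∧
      (IsSplit Q → ℓ % 4 = 3 → ∃ p q : (ZMod ℓ)[X],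
        p.Monic ∧ Irreducible p ∧ p.natDegree = 2 ∧ Irreducible q ∧
        q.natDegree = Nred (Module.finrank (ZMod ℓ) V) ε₁ - 2 ∧ f = p * q))}

/-- The polynomials of the second family: the product of a monic quadratic polynomial and of
distinct monic irreducible polynomials of odd degree. -/
def thetaPoly2 (Q : QuadraticForm (ZMod ℓ) V) (ε₁ ε₂ : ℤˣ) : Set (ZMod ℓ)[X] :=
  {f | f ∈ selfRecip (ZMod ℓ) (Nred (Module.finrank (ZMod ℓ) V) ε₁) ∧ Compatible Q ε₁ ε₂ f ∧
    ∃ (p : (ZMod ℓ)[X]) (S : Finset (ZMod ℓ)[X]), p.Monic ∧ p.natDegree = 2 ∧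
      (∀ r ∈ S, r.Monic ∧ Irreducible r ∧ Odd r.natDegree) ∧ f = p * ∏ r ∈ S, r}

/-- The polynomials of the third family: `h` is separable, with an irreducible factor of prime
degree greater than a quarter of the degree of `f`. -/
def thetaPoly3 (Q : QuadraticForm (ZMod ℓ) V) (ε₁ ε₂ : ℤˣ) : Set (ZMod ℓ)[X] :=
  {f | f ∈ selfRecip (ZMod ℓ) (Nred (Module.finrank (ZMod ℓ) V) ε₁) ∧ Compatible Q ε₁ ε₂ f ∧
    ∃ h : (ZMod ℓ)[X], IsTraceOf (Nred (Module.finrank (ZMod ℓ) V) ε₁ / 2) f h ∧ h.Separable ∧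
      ∃ r : (ZMod ℓ)[X], Irreducible r ∧ r ∣ h ∧ r.natDegree.Prime ∧
        Nred (Module.finrank (ZMod ℓ) V) ε₁ < 4 * r.natDegree}

/-- The polynomials of the fourth family: `h` is separable, with one irreducible quadratic factor
and no other irreducible factor of even degree. -/
def thetaPoly4 (Q : QuadraticForm (ZMod ℓ) V) (ε₁ ε₂ : ℤˣ) : Set (ZMod ℓ)[X] :=
  {f | f ∈ selfRecip (ZMod ℓ) (Nred (Module.finrank (ZMod ℓ) V) ε₁) ∧ Compatible Q ε₁ ε₂ f ∧
    ∃ h : (ZMod ℓ)[X], IsTraceOf (Nred (Module.finrank (ZMod ℓ) V) ε₁ / 2) f h ∧ h.Separable ∧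
      ∃ r : (ZMod ℓ)[X], r.Monic ∧ Irreducible r ∧ r ∣ h ∧ r.natDegree = 2 ∧
        ∀ s : (ZMod ℓ)[X], s.Monic → Irreducible s → s ∣ h → Even s.natDegree → s = r}

/-- The sieving set of the isometries with determinant `ε₁`, spinor norm `ε₂` and reduced
characteristic polynomial in `P`. -/
def sievingSet (Q : QuadraticForm (ZMod ℓ) V) (ε₁ ε₂ : ℤˣ) (P : Set (ZMod ℓ)[X]) :
    Set (orthogonalGroup Q) :=
  {g | LinearMap.det (toEnd g) = ((ε₁ : ℤ) : ZMod ℓ) ∧ spinorNorm Q g = ε₂ ∧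
    redCharpoly (toEnd g) ∈ P}

/-- The proportion `|Θ| / |Ω(Q)|`. -/
def density (Q : QuadraticForm (ZMod ℓ) V) (Θ : Set (orthogonalGroup Q)) : ℝ :=
  (Nat.card Θ : ℝ) / (Nat.card (omegaGroup Q) : ℝ)

end Theta

end

end OrthSieve

namespace OrthSieve

noncomputable section

/-! ### Antisymmetric determinants -/

/-! Only lower bounds are needed, so it suffices to count isometries whose reduced characteristic
polynomial is f = x^n h(x + 1/x), with n = N_red/2, h monic of degree n, and h(2), h(-2) nonzero.
Put j = N - N_red; the full characteristic polynomial is f times j distinct factors X ∓ 1.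

One polynomial h. Let L = F_ℓ[x]/(h) and let α be the class of x. Multiplication by y on L[y]/(y² -
αy + 1) has characteristic polynomial f and preserves every form τ(u(a² + αab + b²)), with u a unit
of L and τ a nondegenerate functional. Up to squares the Gram determinant is f(1)f(-1), whatever u
is. After adding a suitable diagonal form of rank j, all these forms are isometric to Q, because
forms over F_ℓ are classified by dimension and discriminant (`equivalent_of_discChar_eq`). Counting
the pairs (isometry onto Q, unit u) and dividing by the relevant commutant, of size at most ℓ^(2n)
2^j, gives at least |O| |Lˣ| / (ℓ^(2n) 2^j) isometries with this polynomial
(`card_mul_card_units_le`), and |Lˣ| ≥ ℓ^n (1 - n/ℓ). Zassenhaus' formula reads their spinor norm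
from f(-1) and, if -1 is an eigenvalue, from one diagonal coefficient. Determinant and spinor norm
show that Ω has index at least 4, so a set A of polynomials h accounts for a density of at least
(4/2^j)(|A|/ℓ^n)(1 - n/ℓ) (`le_density`).

Square classes. The conditions imposed by Q and the two signs involve h only through its class, the
pair of quadratic characters of h(2) and h(-2): indeed f(1) = h(2), f(-1) = ±h(-2), and disc f is
h(2)h(-2) times a square (`discr_recip`). There are 2^j admissible classes (`exists_goodClasses`),
which compensates the factor 2^j above. For h irreducible, the product of the two characters decides
whether f is irreducible or a product of two irreducible factors of degree n
(`natDegree_of_irreducible_dvd_recip`).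

Counting h. A Jacobi sum shows that each class contains at least about ℓ^d/(4d) irreducible
polynomials of degree d (`exists_irreducible_hasClass`). Multiplying a family by irreducible
polynomials of the complementary class yields families of any prescribed class
(`Abundant.mul_irreducible`). The four bounds come from choosing the factors: an irreducible h, or a
product of two factors with irreducible transforms; a linear factor times factors of odd degree
whose transforms split; a factor of prime degree p > n/2, where Erdős' proof of Bertrand's postulate
is adapted to give two such primes; an irreducible quadratic times factors of odd degree. -/

theorem isSquare_det_fin_of_antisymm {K : Type*} [Field K] (h2 : (2 : K) ≠ 0) (n : ℕ) :
    ∀ A : Matrix (Fin n) (Fin n) K, A.transpose = -A → IsSquare A.det := by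
  induction n using Nat.twoStepInduction with
  | zero => intro A _; simp
  | one =>
    intro A hA
    have h := congrFun (congrFun hA 0) 0
    simp only [Matrix.transpose_apply, Matrix.neg_apply] at h
    have h0 : A 0 0 = 0 := by
      have : 2 * A 0 0 = 0 := by linear_combination h
      simpa [h2] using this
    simp [h0]
  | more n ih _ =>
    intro A hA
    have hA' : ∀ i j, A j i = -A i j := fun i j => congrFun (congrFun hA i) j
    have hdiag : ∀ i, A i i = 0 := fun i => by
      have : 2 * A i i = 0 := by linear_combination hA' i i
      simpa [h2] using this
    by_cases h0 : A = 0
    · subst h0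
      rw [Matrix.det_zero]
      exact IsSquare.zero
    obtain ⟨i, j, hij⟩ : ∃ i j, A i j ≠ 0 := by
      by_contra! h
      exact h0 (by ext i j; exact h i j)
    have hne : i ≠ j := fun h => hij (h ▸ hdiag i)
    -- Pivoting: a nonzero entry is moved to the leading 2 × 2 block, whose determinant is then `A i
    -- j ^ 2`. The Schur complement of that block is again antisymmetric, of size n.
    let e0 : Fin 2 ⊕ Fin n ≃ Fin (n + 2) := finSumFinEquiv.trans (finCongr (Nat.add_comm 2 n))
    let e1 := e0.trans (Equiv.swap (e0 (Sum.inl 0)) i)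
    have he1 : e1 (Sum.inl 0) = i := by simp [e1]
    let e := e1.trans (Equiv.swap (e1 (Sum.inl 1)) j)
    have hei : e (Sum.inl 0) = i := by
      have : i ≠ e1 (Sum.inl 1) := by
        rw [← he1]
        exact fun h => by simpa using e1.injective h
      simp only [e, Equiv.trans_apply, he1]
      exact Equiv.swap_apply_of_ne_of_ne this hne
    have hej : e (Sum.inl 1) = j := by simp [e]
    set M := A.submatrix e e with hM
    have hdet : M.det = A.det := Matrix.det_submatrix_equiv_self e A
    have hMt : ∀ x y, M y x = -M x y := fun x y => hA' _ _
    have h11 : M.toBlocks₁₁.det = A i j ^ 2 := by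
      rw [Matrix.det_fin_two]
      simp only [Matrix.toBlocks₁₁, Matrix.of_apply, hM, Matrix.submatrix_apply, hei, hej]
      rw [hdiag, hA' i j]
      ring
    have hu : IsUnit M.toBlocks₁₁.det := by
      rw [h11]
      exact (isUnit_iff_ne_zero.2 (pow_ne_zero 2 hij))
    let _ := Matrix.invertibleOfIsUnitDet _ hu
    rw [← hdet, ← Matrix.fromBlocks_toBlocks M, Matrix.det_fromBlocks₁₁, h11]
    refine (even_two.isSquare_pow _).mul (ih _ ?_)
    have t11 : M.toBlocks₁₁.transpose = -M.toBlocks₁₁ := by ext x y; exact hMt _ _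
    have t12 : M.toBlocks₁₂.transpose = -M.toBlocks₂₁ := by ext x y; exact hMt _ _
    have t21 : M.toBlocks₂₁.transpose = -M.toBlocks₁₂ := by ext x y; exact hMt _ _
    have t22 : M.toBlocks₂₂.transpose = -M.toBlocks₂₂ := by ext x y; exact hMt _ _
    have tinv : (⅟M.toBlocks₁₁).transpose = -⅟M.toBlocks₁₁ := by
      rw [Matrix.invOf_eq_nonsing_inv, Matrix.transpose_nonsing_inv, t11]
      refine Matrix.inv_eq_left_inv ?_
      rw [neg_mul_neg, Matrix.nonsing_inv_mul _ hu]
    rw [Matrix.transpose_sub, Matrix.transpose_mul, Matrix.transpose_mul, t12, t21, tinv, t22]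
    simp only [Matrix.mul_neg, Matrix.neg_mul, neg_neg, Matrix.mul_assoc]
    abel

theorem isSquare_det_of_antisymm {K ι : Type*} [Field K] [Fintype ι] [DecidableEq ι]
    (h2 : (2 : K) ≠ 0) (A : Matrix ι ι K) (hA : A.transpose = -A) : IsSquare A.det := by
  rw [← Matrix.det_submatrix_equiv_self (Fintype.equivFin ι).symm A]
  refine isSquare_det_fin_of_antisymm h2 _ _ ?_
  rw [Matrix.transpose_submatrix, hA]
  rfl

/-! ### Reflections -/

section Reflections

variable {K V : Type*} [Field K] [AddCommGroup V] [Module K V] (Q : QuadraticForm K V)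

theorem polar_self_eq (v : V) : QuadraticMap.polar Q v v = 2 * Q v := by
  rw [QuadraticMap.polar_self]; simp

theorem reflectionAt_apply (v x : V) :
    reflectionAt Q v x = x - ((Q v)⁻¹ * QuadraticMap.polar Q v x) • v := by
  simp [reflectionAt, smul_smul]

theorem reflectionAt_preserves {v : V} (hv : Q v ≠ 0) (x : V) : Q (reflectionAt Q v x) = Q x := by
  rw [reflectionAt_apply, sub_eq_add_neg, ← neg_smul, QuadraticMap.map_add Q,
    QuadraticMap.map_smul, QuadraticMap.polar_smul_right, QuadraticMap.polar_comm Q x v]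
  simp only [smul_eq_mul]
  field_simp
  ring

theorem reflectionAt_mul_self {v : V} (hv : Q v ≠ 0) : reflectionAt Q v * reflectionAt Q v = 1 := by
  ext x
  rw [Module.End.mul_apply, reflectionAt_apply, reflectionAt_apply, QuadraticMap.polar_sub_right,
    QuadraticMap.polar_smul_right, polar_self_eq, Module.End.one_apply, sub_sub, ← add_smul]
  have : (Q v)⁻¹ * QuadraticMap.polar Q v x + (Q v)⁻¹ * (QuadraticMap.polar Q v x -
      ((Q v)⁻¹ * QuadraticMap.polar Q v x) • (2 * Q v)) = 0 := by
    simp only [smul_eq_mul]; field_simp; ring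
  rw [this, zero_smul, sub_zero]

/-- The reflection in a nonsingular vector, as an element of the orthogonal group. -/
def reflectionElt (v : V) (hv : Q v ≠ 0) : orthogonalGroup Q :=
  ⟨LinearEquiv.ofInvolutive (reflectionAt Q v)
    (fun x => LinearMap.congr_fun (reflectionAt_mul_self Q hv) x), reflectionAt_preserves Q hv⟩

theorem toEnd_reflectionElt (v : V) (hv : Q v ≠ 0) :
    toEnd (reflectionElt Q v hv) = reflectionAt Q v := rfl

variable {Q}

@[simp] theorem toEnd_mul (g h : orthogonalGroup Q) : toEnd (g * h) = toEnd g * toEnd h := rfl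

theorem toEnd_injective : Function.Injective (toEnd (Q := Q)) := fun _ _ e =>
  Subtype.ext (LinearEquiv.toLinearMap_injective e)

theorem toEnd_preserves (g : orthogonalGroup Q) (v : V) : Q (toEnd g v) = Q v := g.2 v

theorem polar_toEnd (g : orthogonalGroup Q) (x y : V) :
    QuadraticMap.polar Q (toEnd g x) (toEnd g y) = QuadraticMap.polar Q x y := by
  simp only [QuadraticMap.polar, ← map_add, toEnd_preserves]

variable (Q) in
theorem det_reflectionAt [FiniteDimensional K V] {v : V} (hv : Q v ≠ 0) :
    LinearMap.det (reflectionAt Q v) = -1 := by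
  have : reflectionAt Q v =
      LinearMap.transvection (-((Q v)⁻¹ • QuadraticMap.polarBilin Q v)) v := by
    ext x
    rw [reflectionAt_apply, LinearMap.transvection.apply]
    simp [sub_eq_add_neg]
  rw [this, LinearMap.transvection.det]
  simp only [LinearMap.neg_apply, LinearMap.smul_apply, QuadraticMap.polarBilin_apply_apply,
    polar_self_eq, smul_eq_mul]
  field_simp
  ring

theorem det_prod_reflectionAt [FiniteDimensional K V] (l : List V) (hl : ∀ v ∈ l, Q v ≠ 0) :
    LinearMap.det (l.map (reflectionAt Q)).prod = (-1) ^ l.length := by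
  induction l with
  | nil => simp
  | cons v l ih =>
    rw [List.map_cons, List.prod_cons, map_mul, ih fun w hw => hl w (List.mem_cons_of_mem _ hw),
      det_reflectionAt Q (hl v List.mem_cons_self), List.length_cons, pow_succ']

/-- A product of reflections in `v₁, …, vₖ` is `1 - U S⁻¹ Uᵀ B`, where `S` is triangular with
diagonal `Q vᵢ` and `S + Sᵀ` is the Gram matrix of the `vᵢ`. -/
theorem exists_triangular_of_reflections (l : List V) (hl : ∀ v ∈ l, Q v ≠ 0) :
    ∃ (m : ℕ) (U : Fin m → V) (S S' : Matrix (Fin m) (Fin m) K), m = l.length ∧ S * S' = 1 ∧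
      S.det = (l.map Q).prod ∧ (∀ i j, S i j + S j i = QuadraticMap.polar Q (U i) (U j)) ∧
      ∀ x, (l.map (reflectionAt Q)).prod x =
        x - ∑ i, (∑ j, S' i j * QuadraticMap.polar Q (U j) x) • U i := by
  -- Arbitrary finite index types let the induction add a reflection as a block `Unit ⊕ ι`.
  suffices h : ∃ (ι : Type) (_ : Fintype ι) (_ : DecidableEq ι) (U : ι → V) (S S' : Matrix ι ι K),
      Fintype.card ι = l.length ∧ S * S' = 1 ∧
      S.det = (l.map Q).prod ∧ (∀ i j, S i j + S j i = QuadraticMap.polar Q (U i) (U j)) ∧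
      ∀ x, (l.map (reflectionAt Q)).prod x =
        x - ∑ i, (∑ j, S' i j * QuadraticMap.polar Q (U j) x) • U i by
    obtain ⟨ι, _, _, U, S, S', hc, h1, h2, h3, h4⟩ := h
    let e := (Fintype.equivFin ι).symm
    refine ⟨_, U ∘ e, S.submatrix e e, S'.submatrix e e, hc, ?_, ?_, fun i j => h3 _ _, ?_⟩
    · rw [Matrix.submatrix_mul_equiv, h1, Matrix.submatrix_one_equiv]
    · rw [Matrix.det_submatrix_equiv_self, h2]
    · intro x
      rw [h4, ← e.sum_comp]
      congr 1
      refine Finset.sum_congr rfl fun i _ => ?_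
      rw [← e.sum_comp]
      rfl
  induction l with
  | nil => exact ⟨Fin 0, inferInstance, inferInstance, Fin.elim0, 1, 1, by simp⟩
  | cons v l ih =>
    obtain ⟨ι, _, _, U, S, S', hc, h1, h2, h3, h4⟩ := ih fun w hw => hl w (List.mem_cons_of_mem _ hw)
    have hv : Q v ≠ 0 := hl v List.mem_cons_self
    -- A new reflection on the left enlarges S to the block matrix [Q v, R; 0, S], where R holds the
    -- polar values of v with the previous vectors.
    let R : Matrix Unit ι K := Matrix.of fun _ j => QuadraticMap.polar Q v (U j)
    refine ⟨Unit ⊕ ι, inferInstance, inferInstance, Sum.elim (fun _ => v) U,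
      Matrix.fromBlocks (Matrix.of fun _ _ => Q v) R 0 S,
      Matrix.fromBlocks (Matrix.of fun _ _ => (Q v)⁻¹) (-((Q v)⁻¹ • (R * S'))) 0 S', ?_, ?_, ?_,
      ?_, ?_⟩
    · simp [hc, add_comm]
    · rw [Matrix.fromBlocks_multiply, h1, ← Matrix.fromBlocks_one]
      congr 1
      · ext; simp [Matrix.mul_apply, hv]
      · ext i j
        simp [Matrix.mul_apply (M := Matrix.of _), hv]
      · simp
      · simp
    · rw [Matrix.det_fromBlocks_zero₂₁, h2]
      simp
    · rintro (i | i) (j | j)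
      · simp [two_mul]
      · simp [R]
      · simp [R, QuadraticMap.polar_comm Q (U i)]
      · simp [h3]
    · intro x
      rw [List.map_cons, List.prod_cons, Module.End.mul_apply, reflectionAt_apply, h4]
      simp only [Fintype.sum_sum_type, Sum.elim_inl, Sum.elim_inr, Matrix.fromBlocks_apply₁₁,
        Matrix.fromBlocks_apply₁₂, Matrix.fromBlocks_apply₂₁, Matrix.fromBlocks_apply₂₂,
        Matrix.of_apply, Finset.univ_unique, Finset.sum_singleton, Matrix.zero_apply, zero_mul,
        zero_add]
      have key : QuadraticMap.polar Q v (∑ i, (∑ j, S' i j * QuadraticMap.polar Q (U j) x) • U i) =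
          ∑ j, (R * S') () j * QuadraticMap.polar Q (U j) x := by
        rw [← QuadraticMap.polarBilin_apply_apply, map_sum]
        simp only [map_smul, QuadraticMap.polarBilin_apply_apply, smul_eq_mul, Matrix.mul_apply,
          Finset.sum_mul]
        rw [Finset.sum_comm]
        refine Finset.sum_congr rfl fun j _ => Finset.sum_congr rfl fun i _ => ?_
        simp only [R, Matrix.of_apply]
        ring
      rw [QuadraticMap.polar_sub_right, key]
      have : ∑ j, (-((Q v)⁻¹ • (R * S'))) () j * QuadraticMap.polar Q (U j) x =
          -((Q v)⁻¹ * ∑ j, (R * S') () j * QuadraticMap.polar Q (U j) x) := by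
        simp [Finset.mul_sum, mul_assoc]
      rw [this, mul_sub]
      module

/-- A form of Zassenhaus' formula for the spinor norm. -/
theorem isSquare_det_one_add_mul_prod [FiniteDimensional K V] (h2 : (2 : K) ≠ 0) (l : List V)
    (hl : ∀ v ∈ l, Q v ≠ 0) (heven : Even l.length) :
    IsSquare (2 ^ Module.finrank K V * LinearMap.det (1 + (l.map (reflectionAt Q)).prod) *
      (l.map Q).prod) := by
  obtain ⟨m, U, S, S', hm, h1, hS, hG, hx⟩ := exists_triangular_of_reflections l hl
  set g := (l.map (reflectionAt Q)).prod
  let b := Module.finBasis K V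
  let A : Matrix (Fin (Module.finrank K V)) (Fin m) K := Matrix.of fun i j => b.repr (U j) i
  let W : Matrix (Fin m) (Fin (Module.finrank K V)) K :=
    Matrix.of fun i j => ∑ k, S' i k * QuadraticMap.polar Q (U k) (b j)
  have hmat : LinearMap.toMatrix b b (1 + g) = (2 : K) • (1 - A * ((2 : K)⁻¹ • W)) := by
    ext i j
    rw [LinearMap.toMatrix_apply]
    simp only [LinearMap.add_apply, Module.End.one_apply, hx, map_add, map_sub, map_sum, map_smul,
      Finsupp.add_apply, Finsupp.sub_apply, Finsupp.coe_finsetSum, Finset.sum_apply,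
      Finsupp.smul_apply, smul_eq_mul, Matrix.smul_apply, Matrix.sub_apply, Matrix.mul_smul]
    rw [Matrix.mul_apply, mul_sub, mul_inv_cancel_left₀ h2]
    have : (b.repr (b j)) i = (1 : Matrix _ _ K) i j := by
      rw [Module.Basis.repr_self, Matrix.one_apply, Finsupp.single_apply]
      simp [eq_comm]
    rw [this]
    simp only [A, W, Matrix.of_apply, mul_comm (b.repr _ _)]
    ring
  have hWA : W * A = S' * (S + S.transpose) := by
    have : W * A = S' * Matrix.of fun i j => QuadraticMap.polar Q (U i) (U j) := by
      ext i j
      simp only [Matrix.mul_apply, W, A, Matrix.of_apply, Finset.sum_mul]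
      rw [Finset.sum_comm]
      refine Finset.sum_congr rfl fun k _ => ?_
      conv_rhs => rw [← b.sum_repr (U j), ← QuadraticMap.polarBilin_apply_apply, map_sum]
      rw [Finset.mul_sum]
      refine Finset.sum_congr rfl fun t _ => ?_
      simp only [map_smul, QuadraticMap.polarBilin_apply_apply, smul_eq_mul]
      ring
    rw [this]
    congr 1
    ext i j
    simp [hG]
  have hS' : S' * S = 1 := mul_eq_one_comm.mp h1
  have hdd : S'.det * S.det = 1 := by rw [← Matrix.det_mul, hS', Matrix.det_one]
  -- Since g = 1 - AW, the identity det(1 - XY) = det(1 - YX) moves the computation to size m, where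
  -- 1 - WA/2 = S⁻¹(S - Sᵀ)/2 and S - Sᵀ is antisymmetric.
  have hdet : LinearMap.det (1 + g) * 2 ^ m =
      2 ^ Module.finrank K V * (S'.det * (S - S.transpose).det) := by
    rw [← LinearMap.det_toMatrix b, hmat, Matrix.det_smul, Matrix.det_one_sub_mul_comm,
      Matrix.smul_mul, hWA]
    have : (1 - (2 : K)⁻¹ • (S' * (S + S.transpose))) =
        (2 : K)⁻¹ • (S' * (S - S.transpose)) := by
      rw [mul_add, mul_sub, hS']
      ext i j
      simp only [Matrix.sub_apply, Matrix.smul_apply, Matrix.add_apply, smul_eq_mul]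
      field_simp
      ring
    rw [this, Matrix.det_smul, Matrix.det_mul]
    simp only [Fintype.card_fin, inv_pow]
    field_simp
  obtain ⟨r, hr⟩ := isSquare_det_of_antisymm h2 (S - S.transpose) (by simp)
  obtain ⟨k, hk⟩ := heven
  -- The even number of reflections makes 2^m the square of 2^k.
  refine ⟨2 ^ Module.finrank K V * r / 2 ^ k, ?_⟩
  have h2k : (2 : K) ^ m = 2 ^ k * 2 ^ k := by rw [hm, hk, pow_add]
  rw [← hS]
  have h3 : LinearMap.det (1 + g) * S.det * (2 ^ k * 2 ^ k) =
      2 ^ Module.finrank K V * (r * r) := by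
    rw [← h2k, ← hr]
    linear_combination S.det * hdet + 2 ^ Module.finrank K V * (S - S.transpose).det * hdd
  field_simp
  linear_combination h3

end Reflections

/-! ### Generation of the orthogonal group by reflections -/

section CartanDieudonne

variable {K V : Type*} [Field K] [AddCommGroup V] [Module K V]
  {Q : QuadraticForm K V}

theorem polarBilin_isSymm (Q : QuadraticForm K V) : LinearMap.IsSymm (QuadraticMap.polarBilin Q) :=
  ⟨fun x y => by simpa using QuadraticMap.polar_comm Q x y⟩

theorem exists_orthogonal_basis_ne_zero [FiniteDimensional K V] (h2 : (2 : K) ≠ 0)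
    (hQ : (QuadraticMap.polarBilin Q).Nondegenerate) :
    ∃ b : Module.Basis (Fin (Module.finrank K V)) K V,
      (∀ i j, i ≠ j → QuadraticMap.polar Q (b i) (b j) = 0) ∧ ∀ i, Q (b i) ≠ 0 := by
  have := invertibleOfNonzero h2
  obtain ⟨b, hb⟩ := LinearMap.BilinForm.exists_orthogonal_basis (polarBilin_isSymm Q)
  refine ⟨b, fun i j hij => by simpa using hb hij, fun i hi => ?_⟩
  refine hb.not_isOrtho_basis_self_of_separatingLeft hQ.1 i ?_
  change QuadraticMap.polarBilin Q (b i) (b i) = 0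
  rw [QuadraticMap.polarBilin_apply_apply, polar_self_eq, hi, mul_zero]

/-- A product of at most two reflections carries `w` to `v` and fixes whatever is orthogonal
to both. -/
theorem exists_reflections_apply_eq (h2 : (2 : K) ≠ 0) {v w : V} (hv : Q v ≠ 0) (hw : Q w = Q v) :
    ∃ l : List V, (∀ x ∈ l, Q x ≠ 0) ∧ (l.map (reflectionAt Q)).prod w = v ∧
      ∀ x, QuadraticMap.polar Q v x = 0 → QuadraticMap.polar Q w x = 0 →
        (l.map (reflectionAt Q)).prod x = x := by
  have hadd : Q (w + v) = 2 * Q v + QuadraticMap.polar Q w v := by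
    rw [QuadraticMap.map_add Q, hw]; ring
  have hsub : Q (w - v) = 2 * Q v - QuadraticMap.polar Q w v := by
    rw [sub_eq_add_neg, QuadraticMap.map_add Q, hw, QuadraticMap.map_neg,
      QuadraticMap.polar_neg_right]; ring
  -- Q(w + v) + Q(w - v) = 4 Q(v) is nonzero, so w - v or w + v is nonsingular. Reflection in w - v
  -- sends w to v; reflection in w + v sends w to -v, which the reflection in v corrects.
  by_cases hs : Q (w - v) = 0
  · have ha : Q (w + v) ≠ 0 := by
      intro h
      have : 2 * 2 * Q v = 0 := by linear_combination h + hs - hadd - hsub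
      simp [h2, hv] at this
    have hp : QuadraticMap.polar Q w v = 2 * Q v := by linear_combination hsub - hs
    refine ⟨[v, w + v], by simp [hv, ha], ?_, fun x hx hx' => ?_⟩
    · have h1 : reflectionAt Q (w + v) w = -v := by
        rw [reflectionAt_apply, QuadraticMap.polar_add_left, polar_self_eq,
          QuadraticMap.polar_comm Q v w, hw, hp]
        have : (Q (w + v))⁻¹ * (2 * Q v + 2 * Q v) = 1 := by
          rw [hadd, hp] at ha ⊢
          exact inv_mul_cancel₀ ha
        rw [this]
        module
      simp only [List.map_cons, List.map_nil, List.prod_cons, List.prod_nil, mul_one,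
        Module.End.mul_apply, h1, map_neg, reflectionAt_apply, polar_self_eq]
      rw [mul_left_comm, inv_mul_cancel₀ hv]
      module
    · simp only [List.map_cons, List.map_nil, List.prod_cons, List.prod_nil, mul_one,
        Module.End.mul_apply, reflectionAt_apply, QuadraticMap.polar_add_left, hx, hx']
      simp [hx]
  · refine ⟨[w - v], by simp [hs], ?_, fun x hx hx' => ?_⟩
    · simp only [List.map_cons, List.map_nil, List.prod_cons, List.prod_nil, mul_one]
      rw [reflectionAt_apply, QuadraticMap.polar_sub_left, polar_self_eq,
          QuadraticMap.polar_comm Q v w, hw]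
      have : (Q (w - v))⁻¹ * (2 * Q v - QuadraticMap.polar Q w v) = 1 := by
        rw [hsub] at hs ⊢
        exact inv_mul_cancel₀ hs
      rw [this]
      module
    · simp [reflectionAt_apply, QuadraticMap.polar_sub_left, hx, hx']

theorem prod_reflections_preserves (l : List V) (hl : ∀ v ∈ l, Q v ≠ 0) :
    ∃ g : orthogonalGroup Q, toEnd g = (l.map (reflectionAt Q)).prod := by
  induction l with
  | nil => exact ⟨1, rfl⟩
  | cons v l ih =>
    obtain ⟨g, hg⟩ := ih fun w hw => hl w (List.mem_cons_of_mem _ hw)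
    exact ⟨reflectionElt Q v (hl v List.mem_cons_self) * g, by
      rw [toEnd_mul, hg, toEnd_reflectionElt, List.map_cons, List.prod_cons]⟩

theorem prod_reflections_reverse (l : List V) (hl : ∀ v ∈ l, Q v ≠ 0) :
    (l.reverse.map (reflectionAt Q)).prod * (l.map (reflectionAt Q)).prod = 1 := by
  induction l with
  | nil => simp
  | cons v l ih =>
    have h := reflectionAt_mul_self Q (hl v List.mem_cons_self)
    rw [List.reverse_cons, List.map_append, List.prod_append, List.map_cons, List.prod_cons]
    simp only [List.map_cons, List.map_nil, List.prod_cons, List.prod_nil, mul_one]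
    rw [mul_assoc, ← mul_assoc (reflectionAt Q v), h, one_mul,
      ih fun w hw => hl w (List.mem_cons_of_mem _ hw)]

/-- The orthogonal group is generated by reflections. -/
theorem exists_reflections [FiniteDimensional K V] (h2 : (2 : K) ≠ 0) (hQ : (QuadraticMap.polarBilin Q).Nondegenerate)
    (g : orthogonalGroup Q) :
    ∃ l : List V, (∀ v ∈ l, Q v ≠ 0) ∧ toEnd g = (l.map (reflectionAt Q)).prod := by
  obtain ⟨b, hb, hb0⟩ := exists_orthogonal_basis_ne_zero h2 hQ
  -- The vectors of an orthogonal basis are brought back to their places one at a time. The vectors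
  -- already fixed are orthogonal to `b i` and to its current image, so the new reflections do not
  -- move them.
  have key : ∀ k : ℕ, ∃ l : List V, (∀ v ∈ l, Q v ≠ 0) ∧
      ∀ i : Fin (Module.finrank K V), (i : ℕ) < k →
        (l.map (reflectionAt Q)).prod (toEnd g (b i)) = b i := by
    intro k
    induction k with
    | zero => exact ⟨[], by simp, by simp⟩
    | succ k ih =>
      obtain ⟨l, hl, hfix⟩ := ih
      by_cases hk : k < Module.finrank K V
      · obtain ⟨r, hr⟩ := prod_reflections_preserves l hl
        let i : Fin (Module.finrank K V) := ⟨k, hk⟩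
        obtain ⟨l', hl', h1, h3⟩ := exists_reflections_apply_eq h2 (Q := Q) (v := b i)
          (w := toEnd (r * g) (b i)) (hb0 i) (toEnd_preserves _ _)
        refine ⟨l' ++ l, ?_, fun j hj => ?_⟩
        · intro v hv
          rcases List.mem_append.1 hv with hv | hv
          exacts [hl' v hv, hl v hv]
        · rw [List.map_append, List.prod_append, Module.End.mul_apply, ← hr,
            ← Module.End.mul_apply (toEnd r), ← toEnd_mul]
          rcases Nat.lt_succ_iff_lt_or_eq.1 hj with hj | hj
          · have hjf : toEnd (r * g) (b j) = b j := by
              rw [toEnd_mul, Module.End.mul_apply, hr, hfix j hj]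
            have hij : i ≠ j := fun h => by simp [← h, i] at hj
            rw [hjf]
            refine h3 _ (hb _ _ hij) ?_
            rw [← hjf, polar_toEnd, hb _ _ hij]
          · have : j = i := Fin.ext hj
            rw [this, h1]
      · exact ⟨l, hl, fun i _ => hfix i (by omega)⟩
  obtain ⟨l, hl, hfix⟩ := key (Module.finrank K V)
  refine ⟨l.reverse, fun v hv => hl v (by simpa using hv), ?_⟩
  have h1 : (l.map (reflectionAt Q)).prod * toEnd g = 1 :=
    b.ext fun i => by simpa using hfix i i.2
  calc toEnd g = (l.reverse.map (reflectionAt Q)).prod * (l.map (reflectionAt Q)).prod * toEnd g := by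
        rw [prod_reflections_reverse l hl, one_mul]
    _ = _ := by rw [mul_assoc, h1, mul_one]

end CartanDieudonne

/-! ### The spinor norm as a homomorphism, and the index of Ω -/

section Spinor

variable {ℓ : ℕ} [Fact ℓ.Prime] {V : Type*} [AddCommGroup V] [Module (ZMod ℓ) V]
  [FiniteDimensional (ZMod ℓ) V] {Q : QuadraticForm (ZMod ℓ) V}

theorem two_ne_zero_of_ne_two (hℓ : ℓ ≠ 2) : (2 : ZMod ℓ) ≠ 0 :=
  Ring.two_ne_zero (by rwa [ZMod.ringChar_zmod_n])

omit [FiniteDimensional (ZMod ℓ) V] in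
theorem list_prod_map_ne_zero {l : List V} (hl : ∀ v ∈ l, Q v ≠ 0) : (l.map Q).prod ≠ 0 := by
  refine List.prod_ne_zero fun h => ?_
  obtain ⟨v, hv, h0⟩ := List.mem_map.1 h
  exact hl v hv h0

theorem neg_one_pow_eq_one_iff (hℓ : ℓ ≠ 2) (n : ℕ) : (-1 : ZMod ℓ) ^ n = 1 ↔ Even n := by
  rcases Nat.even_or_odd n with h | h
  · simp [h]
  · have : (-1 : ZMod ℓ) ≠ 1 := Ring.neg_one_ne_one_of_char_ne_two (by rwa [ZMod.ringChar_zmod_n])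
    simp [h.neg_one_pow, this, h]

/-- Zassenhaus' formula for an isometry without eigenvalue `-1`. -/
theorem quadraticChar_prod_eq (hℓ : ℓ ≠ 2) {l : List V} (hl : ∀ v ∈ l, Q v ≠ 0)
    (h1 : LinearMap.det (l.map (reflectionAt Q)).prod = 1)
    (h0 : LinearMap.det (1 + (l.map (reflectionAt Q)).prod) ≠ 0) :
    quadraticChar (ZMod ℓ) (l.map Q).prod = quadraticChar (ZMod ℓ)
      (2 ^ Module.finrank (ZMod ℓ) V * LinearMap.det (1 + (l.map (reflectionAt Q)).prod)) := by
  have h2 := two_ne_zero_of_ne_two hℓ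
  rw [det_prod_reflectionAt l hl, neg_one_pow_eq_one_iff hℓ] at h1
  have hsq := isSquare_det_one_add_mul_prod h2 l hl h1
  have hne := list_prod_map_ne_zero hl
  have hne' := mul_ne_zero (pow_ne_zero (Module.finrank (ZMod ℓ) V) h2) h0
  rw [← quadraticChar_one_iff_isSquare (mul_ne_zero hne' hne), map_mul] at hsq
  rcases quadraticChar_dichotomy hne with h | h <;> rcases quadraticChar_dichotomy hne' with h' | h'
    <;> rw [h, h'] at hsq <;> simp_all

/-- Independence of the factorization: one list reversed, followed by the other, gives the identity,
for which Zassenhaus' formula yields the square 2^N det(1 + 1) = (2^N)². -/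
theorem quadraticChar_prod_eq_of_prod_eq (hℓ : ℓ ≠ 2) {l l' : List V} (hl : ∀ v ∈ l, Q v ≠ 0)
    (hl' : ∀ v ∈ l', Q v ≠ 0)
    (h : (l.map (reflectionAt Q)).prod = (l'.map (reflectionAt Q)).prod) :
    quadraticChar (ZMod ℓ) (l.map Q).prod = quadraticChar (ZMod ℓ) (l'.map Q).prod := by
  have h2 := two_ne_zero_of_ne_two hℓ
  have hr : ∀ v ∈ l.reverse ++ l', Q v ≠ 0 := by
    intro v hv
    rcases List.mem_append.1 hv with hv | hv
    exacts [hl v (by simpa using hv), hl' v hv]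
  have hone : ((l.reverse ++ l').map (reflectionAt Q)).prod = 1 := by
    rw [List.map_append, List.prod_append, ← h, prod_reflections_reverse l hl]
  have h3 : LinearMap.det (1 + 1 : Module.End (ZMod ℓ) V) = 2 ^ Module.finrank (ZMod ℓ) V := by
    rw [one_add_one_eq_two, show (2 : Module.End (ZMod ℓ) V) = (2 : ZMod ℓ) • 1 by
      ext; simp [two_smul], LinearMap.det_smul]
    simp
  have key := quadraticChar_prod_eq hℓ hr (by rw [hone]; simp)
    (by rw [hone, h3]; exact pow_ne_zero _ h2)
  rw [hone, h3, ← sq, quadraticChar_sq_one' (pow_ne_zero _ h2), List.map_append, List.prod_append,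
    List.map_reverse, List.prod_reverse, map_mul] at key
  rcases quadraticChar_dichotomy (list_prod_map_ne_zero hl) with h | h <;>
    rcases quadraticChar_dichotomy (list_prod_map_ne_zero hl') with h' | h' <;>
    rw [h, h'] at key <;> simp_all

theorem spinorNorm_eq (hℓ : ℓ ≠ 2) {g : orthogonalGroup Q} {l : List V} (hl : ∀ v ∈ l, Q v ≠ 0)
    (hg : toEnd g = (l.map (reflectionAt Q)).prod) :
    ((spinorNorm Q g : ℤˣ) : ℤ) = quadraticChar (ZMod ℓ) (l.map Q).prod := by
  unfold spinorNorm
  split_ifs with h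
  · obtain ⟨l', hl', hg', hsq⟩ := h
    rw [← quadraticChar_one_iff_isSquare (list_prod_map_ne_zero hl')] at hsq
    rw [quadraticChar_prod_eq_of_prod_eq hℓ hl hl' (hg.symm.trans hg'), hsq]
    rfl
  · rcases quadraticChar_dichotomy (list_prod_map_ne_zero hl) with h' | h'
    · rw [quadraticChar_one_iff_isSquare (list_prod_map_ne_zero hl)] at h'
      exact (h ⟨l, hl, hg, h'⟩).elim
    · rw [h']; rfl

theorem spinorNorm_mul (hℓ : ℓ ≠ 2) (hQ : (QuadraticMap.polarBilin Q).Nondegenerate)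
    (g h : orthogonalGroup Q) : spinorNorm Q (g * h) = spinorNorm Q g * spinorNorm Q h := by
  have h2 := two_ne_zero_of_ne_two hℓ
  obtain ⟨l, hl, hg⟩ := exists_reflections h2 hQ g
  obtain ⟨l', hl', hh⟩ := exists_reflections h2 hQ h
  have hmem : ∀ v ∈ l ++ l', Q v ≠ 0 := by
    intro v hv
    rcases List.mem_append.1 hv with hv | hv
    exacts [hl v hv, hl' v hv]
  apply Units.ext
  rw [Units.val_mul, spinorNorm_eq hℓ hl hg, spinorNorm_eq hℓ hl' hh, spinorNorm_eq hℓ hmem,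
    List.map_append, List.prod_append, map_mul]
  rw [toEnd_mul, hg, hh, List.map_append, List.prod_append]

/-- The spinor norm as a homomorphism. -/
def spinorHom (hℓ : ℓ ≠ 2) (hQ : (QuadraticMap.polarBilin Q).Nondegenerate) :
    orthogonalGroup Q →* ℤˣ :=
  MonoidHom.mk' (spinorNorm Q) (spinorNorm_mul hℓ hQ)

/-- The determinant as a homomorphism to units. -/
def detHom (Q : QuadraticForm (ZMod ℓ) V) : orthogonalGroup Q →* (ZMod ℓ)ˣ :=
  LinearEquiv.det.comp (orthogonalGroup Q).subtype

/-- If both square classes are represented, `Ω` has index at least four. -/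
theorem four_mul_card_omegaGroup_le (hℓ : ℓ ≠ 2) (hQ : (QuadraticMap.polarBilin Q).Nondegenerate)
    {v w : V} (hv : quadraticChar (ZMod ℓ) (Q v) = 1) (hw : quadraticChar (ZMod ℓ) (Q w) = -1) :
    4 * Nat.card (omegaGroup Q) ≤ Nat.card (orthogonalGroup Q) := by
  have : Finite V := Module.finite_of_finite (ZMod ℓ)
  have : Finite (V ≃ₗ[ZMod ℓ] V) := DFunLike.finite _
  let Φ : orthogonalGroup Q →* (ZMod ℓ)ˣ × ℤˣ := (detHom Q).prod (spinorHom hℓ hQ)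
  -- Commutators die in the abelian target, so the index of Ω is at least the order of the image of
  -- (det, spinor norm). Two reflections give (-1, 1) and (-1, -1), which generate a group of order
  -- four.
  have hle : omegaGroup Q ≤ Φ.ker := Abelianization.commutator_subset_ker Φ
  have hne : (-1 : (ZMod ℓ)ˣ) ≠ 1 := fun h =>
    Ring.neg_one_ne_one_of_char_ne_two (by rwa [ZMod.ringChar_zmod_n]) (congrArg Units.val h)
  have hrefl : ∀ u (hu : Q u ≠ 0) (ε : ℤˣ), quadraticChar (ZMod ℓ) (Q u) = (ε : ℤ) →
      ((-1 : (ZMod ℓ)ˣ), ε) ∈ Φ.range := by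
    intro u hu ε hε
    refine ⟨reflectionElt Q u hu, Prod.ext (Units.ext ?_) (Units.ext ?_)⟩
    · exact (LinearEquiv.coe_det _).trans (det_reflectionAt Q hu)
    · rw [← hε]
      refine (spinorNorm_eq hℓ (l := [u]) (by simpa using hu) ?_).trans ?_
      · simp [toEnd_reflectionElt]
      · simp
  have hv0 : Q v ≠ 0 := fun h => by simp [h] at hv
  have hw0 : Q w ≠ 0 := fun h => by simp [h] at hw
  have m1 := hrefl v hv0 1 (by simpa using hv)
  have m2 := hrefl w hw0 (-1) (by simpa using hw)
  have hcard : 4 ≤ Nat.card Φ.range := by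
    have hsub : Set.range (fun p : Bool × Bool =>
        ((if p.1 then (-1 : (ZMod ℓ)ˣ) else 1), (if p.2 then (-1 : ℤˣ) else 1))) ⊆ Φ.range := by
      rintro _ ⟨⟨a, c⟩, rfl⟩
      cases a <;> cases c
      · exact one_mem Φ.range
      · simpa using mul_mem m1 m2
      · exact m1
      · exact m2
    have hinj : Function.Injective (fun p : Bool × Bool =>
        ((if p.1 then (-1 : (ZMod ℓ)ˣ) else 1), (if p.2 then (-1 : ℤˣ) else 1))) := by
      rintro ⟨a, c⟩ ⟨a', c'⟩ h
      have h1 : (if a then (-1 : (ZMod ℓ)ˣ) else 1) = if a' then -1 else 1 := congrArg Prod.fst h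
      have h3 : (if c then (-1 : ℤˣ) else 1) = if c' then -1 else 1 := congrArg Prod.snd h
      have hz : (-1 : ℤˣ) ≠ 1 := by decide
      have e1 : a = a' := by
        cases a <;> cases a' <;> first | rfl | exact (hne h1).elim | exact (hne h1.symm).elim
      have e3 : c = c' := by
        cases c <;> cases c' <;> first | rfl | exact (hz h3).elim | exact (hz h3.symm).elim
      rw [e1, e3]
    calc 4 = Nat.card (Bool × Bool) := by simp
      _ = (Set.range _).ncard := (Set.ncard_range_of_injective hinj).symm
      _ ≤ (Φ.range : Set _).ncard := Set.ncard_le_ncard hsub (Set.toFinite _)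
      _ = _ := (Nat.card_coe_set_eq _).symm
  rw [← Subgroup.card_mul_index Φ.ker, Subgroup.index_ker, mul_comm]
  exact Nat.mul_le_mul (Subgroup.card_le_of_le hle) hcard

end Spinor

/-! ### Gram matrices and discriminants -/

section Gram

variable {K V : Type*} [Field K] [AddCommGroup V] [Module K V]

/-- The Gram matrix of a family of vectors for the polar form. -/
def gram {ι : Type*} (Q : QuadraticForm K V) (b : ι → V) : Matrix ι ι K :=
  Matrix.of fun i j => QuadraticMap.polar Q (b i) (b j)

@[simp] theorem gram_apply {ι : Type*} (Q : QuadraticForm K V) (b : ι → V) (i j : ι) :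
    gram Q b i j = QuadraticMap.polar Q (b i) (b j) := rfl

theorem gram_eq_toMatrix {ι : Type*} [Fintype ι] [DecidableEq ι] (Q : QuadraticForm K V)
    (b : Module.Basis ι K V) :
    gram Q b = LinearMap.BilinForm.toMatrix b (QuadraticMap.polarBilin Q) := by
  ext i j
  rw [LinearMap.BilinForm.toMatrix_apply]
  rfl

theorem nondegenerate_iff_gram {ι : Type*} [Fintype ι] [DecidableEq ι] (Q : QuadraticForm K V)
    (b : Module.Basis ι K V) :
    (QuadraticMap.polarBilin Q).Nondegenerate ↔ (gram Q b).det ≠ 0 := by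
  rw [gram_eq_toMatrix]
  exact LinearMap.BilinForm.nondegenerate_iff_det_ne_zero b

theorem exists_gram_det_eq {ι κ : Type*} [Fintype ι] [DecidableEq ι] [Fintype κ] [DecidableEq κ]
    (Q : QuadraticForm K V) (b : Module.Basis ι K V) (c : Module.Basis κ K V) :
    ∃ r : K, r ≠ 0 ∧ (gram Q c).det = r ^ 2 * (gram Q b).det := by
  let c' := c.reindex (c.indexEquiv b)
  have h1 : (gram Q c).det = (gram Q c').det := by
    rw [← Matrix.det_submatrix_equiv_self (c.indexEquiv b).symm]
    congr 1
    ext i j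
    simp [c']
  refine ⟨(b.toMatrix c').det, ?_, ?_⟩
  · intro h0
    have := congrArg Matrix.det (b.toMatrix_mul_toMatrix_flip c')
    rw [Matrix.det_mul, h0, zero_mul, Matrix.det_one] at this
    exact zero_ne_one this
  · rw [h1, gram_eq_toMatrix, ← LinearMap.BilinForm.toMatrix_mul_basis_toMatrix b c',
      gram_eq_toMatrix, Matrix.det_mul, Matrix.det_mul, Matrix.det_transpose]
    ring

/-- Two quadratic forms with bases with equal Gram matrices are isometric. -/
def isometryEquivOfGram {W ι : Type*} [AddCommGroup W] [Module K W] (h2 : (2 : K) ≠ 0)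
    {Q : QuadraticForm K V} {R : QuadraticForm K W} (b : Module.Basis ι K V)
    (c : Module.Basis ι K W) (h : gram Q b = gram R c) : Q.IsometryEquiv R where
  toLinearEquiv := b.equiv c (Equiv.refl ι)
  map_app' x := by
    set e := b.equiv c (Equiv.refl ι)
    have hB : QuadraticMap.polarBilin Q =
        (QuadraticMap.polarBilin R).compl₁₂ (e : V →ₗ[K] W) (e : V →ₗ[K] W) := by
      refine b.ext fun i => b.ext fun j => ?_
      simpa [e] using congrFun (congrFun h i) j
    have hx := LinearMap.congr_fun (LinearMap.congr_fun hB x) x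
    simp only [QuadraticMap.polarBilin_apply_apply, LinearMap.compl₁₂_apply, polar_self_eq] at hx
    exact (mul_left_cancel₀ h2 hx).symm

theorem gram_prod {W ι κ : Type*} [AddCommGroup W] [Module K W] [Fintype ι] [DecidableEq ι]
    [Fintype κ] [DecidableEq κ] (Q : QuadraticForm K V) (R : QuadraticForm K W)
    (b : Module.Basis ι K V) (c : Module.Basis κ K W) :
    (gram (Q.prod R) (b.prod c)).det = (gram Q b).det * (gram R c).det := by
  have : gram (Q.prod R) (b.prod c) = Matrix.fromBlocks (gram Q b) 0 0 (gram R c) := by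
    ext (i | i) (j | j) <;> simp
  rw [this, Matrix.det_fromBlocks_zero₂₁]

/-- An isometry without eigenvalues `±1` of a nondegenerate space of even dimension determines
the discriminant. -/
theorem isSquare_det_mul_gram [FiniteDimensional K V] {ι : Type*} [Fintype ι] [DecidableEq ι]
    (h2 : (2 : K) ≠ 0) (Q : QuadraticForm K V) (b : Module.Basis ι K V) (t s : Module.End K V)
    (hts : t * s = 1) (hQ : ∀ x y, QuadraticMap.polar Q (t x) y = QuadraticMap.polar Q x (s y)) :
    IsSquare (LinearMap.det (t - s) * (gram Q b).det) := by
  have hst : s * t = 1 := mul_eq_one_comm.mp hts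
  have hQ' : ∀ x y, QuadraticMap.polar Q (s x) y = QuadraticMap.polar Q x (t y) := fun x y => by
    rw [QuadraticMap.polar_comm, ← hQ, QuadraticMap.polar_comm]
  have hm : (LinearMap.toMatrix b b (t - s)).transpose * gram Q b =
      Matrix.of fun i j => QuadraticMap.polar Q ((t - s) (b i)) (b j) := by
    ext i j
    rw [Matrix.mul_apply, Matrix.of_apply]
    conv_rhs => rw [← b.sum_repr ((t - s) (b i)), ← QuadraticMap.polarBilin_apply_apply, map_sum]
    simp [LinearMap.toMatrix_apply, LinearMap.sum_apply]
  rw [← LinearMap.det_toMatrix b, ← Matrix.det_transpose, ← Matrix.det_mul, hm]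
  -- The bilinear form B((t - s)x, y) is antisymmetric because s is the adjoint of t.
  refine isSquare_det_of_antisymm h2 _ ?_
  ext i j
  simp only [Matrix.transpose_apply, Matrix.of_apply, Matrix.neg_apply, LinearMap.sub_apply,
    QuadraticMap.polar_sub_left, hQ, hQ']
  rw [QuadraticMap.polar_comm Q (b j), QuadraticMap.polar_comm Q (b j), hQ, hQ']
  ring

end Gram

/-! ### Diagonalization over a finite field -/

section OrthogonalFamilies

variable {K V : Type*} [Field K] [AddCommGroup V] [Module K V] {Q : QuadraticForm K V}

theorem exists_basis_of_orthogonal [FiniteDimensional K V] {ι : Type*} [Fintype ι]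
    [Nonempty ι] (h2 : (2 : K) ≠ 0) (hc : Fintype.card ι = Module.finrank K V) {v : ι → V}
    (ho : ∀ i j, i ≠ j → QuadraticMap.polar Q (v i) (v j) = 0) (hv : ∀ i, Q (v i) ≠ 0) :
    ∃ b : Module.Basis ι K V, ⇑b = v := by
  have hli : LinearIndependent K v := by
    refine LinearMap.linearIndependent_of_isOrthoᵢ (B := QuadraticMap.polarBilin Q)
      (fun i j hij => ho i j hij) fun i => ?_
    rw [QuadraticMap.polarBilin_apply_apply, polar_self_eq]
    exact mul_ne_zero h2 (hv i)
  exact ⟨basisOfLinearIndependentOfCardEqFinrank hli hc,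
    coe_basisOfLinearIndependentOfCardEqFinrank hli hc⟩

/-- Pigeonhole: over a finite field of odd order, the values of a x² and those of c - b y² each fill
more than half of the field, so they meet. -/
theorem exists_mul_sq_add_mul_sq_eq [Fintype K] (h2 : (2 : K) ≠ 0) {a b : K} (ha : a ≠ 0)
    (hb : b ≠ 0) (c : K) : ∃ x y, a * x ^ 2 + b * y ^ 2 = c := by
  have hdeg : ∀ c : K, (C b * X ^ 2 - C c : K[X]).degree = 2 := fun c => by
    rw [degree_sub_C (by rw [degree_C_mul_X_pow 2 hb]; norm_num), degree_C_mul_X_pow 2 hb]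
    rfl
  obtain ⟨x, y, h⟩ := FiniteField.exists_root_sum_quadratic (R := K) (f := C a * X ^ 2)
    (g := C b * X ^ 2 - C c) (by compute_degree!) (hdeg c)
    (FiniteField.odd_card_of_char_ne_two (fun h => h2 (by
      have := ringChar.of_eq h
      exact CharTwo.two_eq_zero)))
  refine ⟨x, y, ?_⟩
  simp at h
  linear_combination h

/-- An orthogonal family may be changed so that all values but one are equal to `1`. -/
theorem exists_orthogonal_family_eq_one [Fintype K] {ι : Type*} [DecidableEq ι] (h2 : (2 : K) ≠ 0)
    {v : ι → V} (ho : ∀ i j, i ≠ j → QuadraticMap.polar Q (v i) (v j) = 0)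
    (hv : ∀ i, Q (v i) ≠ 0) (i₀ : ι) (s : Finset ι) (hs : i₀ ∉ s) :
    ∃ w : ι → V, (∀ i j, i ≠ j → QuadraticMap.polar Q (w i) (w j) = 0) ∧ (∀ i, Q (w i) ≠ 0) ∧
      ∀ i ∈ s, Q (w i) = 1 := by
  induction s using Finset.induction_on with
  | empty => exact ⟨v, ho, hv, by simp⟩
  | insert i s his ih =>
    obtain ⟨w, h1, h3, h4⟩ := ih fun h => hs (Finset.mem_insert_of_mem h)
    have hne : i ≠ i₀ := fun h => hs (h ▸ Finset.mem_insert_self _ _)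
    obtain ⟨x, y, hxy⟩ := exists_mul_sq_add_mul_sq_eq h2 (h3 i) (h3 i₀) 1
    -- Inside the plane of `w i` and `w i₀`, p has value 1 and q is orthogonal to p. Since Q q = Q(w
    -- i) Q(w i₀) is nonzero, q may take the place of `w i₀`, and the discriminant accumulates at
    -- the index i₀.
    set p := x • w i + y • w i₀ with hp
    set q := (-(y * Q (w i₀))) • w i + (x * Q (w i)) • w i₀ with hq
    have hQc : ∀ a b : K, Q (a • w i + b • w i₀) = Q (w i) * a ^ 2 + Q (w i₀) * b ^ 2 := by
      intro a b
      rw [QuadraticMap.map_add Q, QuadraticMap.map_smul, QuadraticMap.map_smul,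
        QuadraticMap.polar_smul_left, QuadraticMap.polar_smul_right, h1 _ _ hne]
      simp only [smul_eq_mul]
      ring
    have hQp : Q p = 1 := by rw [hp, hQc, hxy]
    have hQq : Q q = Q (w i) * Q (w i₀) := by
      rw [hq, hQc]
      linear_combination Q (w i) * Q (w i₀) * hxy
    have hpq : QuadraticMap.polar Q p q = 0 := by
      rw [hp, hq]
      simp only [QuadraticMap.polar_add_left, QuadraticMap.polar_add_right,
        QuadraticMap.polar_smul_left, QuadraticMap.polar_smul_right, polar_self_eq, h1 _ _ hne,
        h1 _ _ hne.symm, smul_eq_mul]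
      ring
    have hpo : ∀ k, k ≠ i → k ≠ i₀ → QuadraticMap.polar Q p (w k) = 0 := by
      intro k hk hk'
      simp [hp, QuadraticMap.polar_add_left, QuadraticMap.polar_smul_left, h1 _ _ hk.symm,
        h1 _ _ hk'.symm]
    have hqo : ∀ k, k ≠ i → k ≠ i₀ → QuadraticMap.polar Q q (w k) = 0 := by
      intro k hk hk'
      simp only [hq, QuadraticMap.polar_add_left, QuadraticMap.polar_smul_left, h1 _ _ hk.symm,
        h1 _ _ hk'.symm, smul_zero, add_zero]
    let u : ι → V := fun k => if k = i then p else if k = i₀ then q else w k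
    have hui : u i = p := by simp [u]
    have hui₀ : u i₀ = q := by simp [u, hne.symm]
    have hu : ∀ k, k ≠ i → k ≠ i₀ → u k = w k := fun k hk hk' => by simp [u, hk, hk']
    refine ⟨u, ?_, ?_, ?_⟩
    · have main : ∀ j k, j ≠ k → k ≠ i → (k = i₀ → j = i) →
          QuadraticMap.polar Q (u j) (u k) = 0 := by
        intro j k hjk hki hk
        by_cases hk0 : k = i₀
        · rw [hk hk0, hk0, hui, hui₀, hpq]
        · rw [hu k hki hk0]
          by_cases hji : j = i
          · rw [hji, hui, hpo k hki hk0]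
          · by_cases hj0 : j = i₀
            · rw [hj0, hui₀, hqo k hki hk0]
            · rw [hu j hji hj0, h1 _ _ hjk]
      intro j k hjk
      by_cases hc : k ≠ i ∧ (k = i₀ → j = i)
      · exact main j k hjk hc.1 hc.2
      · rw [QuadraticMap.polar_comm]
        refine main k j hjk.symm ?_ ?_
        · rintro rfl
          by_cases hk : k = j
          · exact hjk hk.symm
          · exact hc ⟨hk, fun _ => rfl⟩
        · rintro rfl
          by_contra hk
          exact hc ⟨hk, fun h => (hjk h.symm).elim⟩
    · intro k
      by_cases hk : k = i
      · rw [hk, hui, hQp]; exact one_ne_zero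
      · by_cases hk' : k = i₀
        · rw [hk', hui₀, hQq]; exact mul_ne_zero (h3 _) (h3 _)
        · rw [hu k hk hk']; exact h3 k
    · intro k hk
      rcases Finset.mem_insert.1 hk with rfl | hk
      · rw [hui, hQp]
      · rw [hu k (fun h => his (h ▸ hk)) (fun h => hs (h ▸ Finset.mem_insert_of_mem hk)), h4 k hk]

end OrthogonalFamilies

/-! ### Classification of forms over a prime field -/

section FiniteFieldForms

variable {ℓ : ℕ} [Fact ℓ.Prime] {V W : Type*} [AddCommGroup V] [Module (ZMod ℓ) V]
  [FiniteDimensional (ZMod ℓ) V] [AddCommGroup W] [Module (ZMod ℓ) W]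
  [FiniteDimensional (ZMod ℓ) W] {Q : QuadraticForm (ZMod ℓ) V} {R : QuadraticForm (ZMod ℓ) W}

/-- The quadratic character of the Gram determinant. -/
def discChar (Q : QuadraticForm (ZMod ℓ) V) : ℤ :=
  quadraticChar (ZMod ℓ) (gram Q (Module.finBasis (ZMod ℓ) V)).det

theorem discChar_eq {ι : Type*} [Fintype ι] [DecidableEq ι] (Q : QuadraticForm (ZMod ℓ) V)
    (b : Module.Basis ι (ZMod ℓ) V) : discChar Q = quadraticChar (ZMod ℓ) (gram Q b).det := by
  obtain ⟨r, hr, h⟩ := exists_gram_det_eq Q b (Module.finBasis (ZMod ℓ) V)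
  rw [discChar, h, map_mul, quadraticChar_sq_one' hr, one_mul]

theorem discChar_ne_zero (hQ : (QuadraticMap.polarBilin Q).Nondegenerate) : discChar Q ≠ 0 := by
  rw [discChar, Ne, quadraticChar_eq_zero_iff]
  exact (nondegenerate_iff_gram Q _).1 hQ

theorem discChar_prod (Q : QuadraticForm (ZMod ℓ) V) (R : QuadraticForm (ZMod ℓ) W) :
    discChar (Q.prod R) = discChar Q * discChar R := by
  rw [discChar_eq (Q.prod R) ((Module.finBasis (ZMod ℓ) V).prod (Module.finBasis (ZMod ℓ) W)),
    gram_prod, map_mul]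
  rfl

theorem quadraticChar_quadDisc (Q : QuadraticForm (ZMod ℓ) V) :
    quadraticChar (ZMod ℓ) (quadDisc Q) = quadraticChar (ZMod ℓ) ((-1) ^
      (Module.finrank (ZMod ℓ) V * (Module.finrank (ZMod ℓ) V - 1) / 2)) * discChar Q := by
  rw [quadDisc, map_mul]
  rfl

omit [FiniteDimensional (ZMod ℓ) V] in
theorem gram_det_of_orthogonal {ι : Type*} [Fintype ι] [DecidableEq ι] {v : ι → V}
    (ho : ∀ i j, i ≠ j → QuadraticMap.polar Q (v i) (v j) = 0) :
    (gram Q v).det = ∏ i, (2 * Q (v i)) := by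
  have : gram Q v = Matrix.diagonal fun i => 2 * Q (v i) := by
    ext i j
    by_cases h : i = j
    · subst h; simp
    · simp [h, ho i j h]
  rw [this, Matrix.det_diagonal]

/-- Nondegenerate quadratic forms over a finite field of odd characteristic are classified by
dimension and discriminant. -/
theorem equivalent_of_discChar_eq (hℓ : ℓ ≠ 2) (hQ : (QuadraticMap.polarBilin Q).Nondegenerate)
    (hR : (QuadraticMap.polarBilin R).Nondegenerate)
    (hd : Module.finrank (ZMod ℓ) V = Module.finrank (ZMod ℓ) W) (h : discChar Q = discChar R) :
    Nonempty (Q.IsometryEquiv R) := by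
  have h2 := two_ne_zero_of_ne_two hℓ
  obtain ⟨b, hb, hb0⟩ := exists_orthogonal_basis_ne_zero h2 hQ
  obtain ⟨c', hc', hc0'⟩ := exists_orthogonal_basis_ne_zero h2 hR
  set N := Module.finrank (ZMod ℓ) V
  let c := c'.reindex (finCongr hd.symm)
  have hc : ∀ i j, i ≠ j → QuadraticMap.polar R (c i) (c j) = 0 := fun i j hij => by
    simpa [c] using hc' _ _ (by simpa using hij)
  have hc0 : ∀ i, R (c i) ≠ 0 := fun i => by simpa [c] using hc0' _
  rcases Nat.eq_zero_or_pos N with hN | hN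
  · have : IsEmpty (Fin N) := by rw [hN]; infer_instance
    exact ⟨isometryEquivOfGram h2 b c (by ext i; exact this.elim i)⟩
  have : NeZero N := ⟨hN.ne'⟩
  -- Both forms become diagonal with entries 1 away from the index 0. Equal discriminants leave
  -- values at 0 that differ by a square factor, and rescaling `v 0` removes it.
  obtain ⟨v, hv, hv0, hv1⟩ := exists_orthogonal_family_eq_one h2 hb hb0 0 (Finset.univ.erase 0)
    (by simp)
  obtain ⟨w, hw, hw0, hw1⟩ := exists_orthogonal_family_eq_one h2 hc hc0 0 (Finset.univ.erase 0)
    (by simp)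
  have hprod : ∀ f : Fin N → ZMod ℓ, (∀ i ∈ Finset.univ.erase 0, f i = 1) →
      ∏ i, 2 * f i = 2 ^ N * f 0 := by
    intro f hf
    rw [Finset.prod_mul_distrib, ← Finset.mul_prod_erase _ _ (Finset.mem_univ 0),
      ← Finset.mul_prod_erase _ f (Finset.mem_univ 0), Finset.prod_eq_one hf,
      Finset.mul_prod_erase _ (fun _ => (2 : ZMod ℓ)) (Finset.mem_univ 0)]
    simp
  obtain ⟨bv, hbv⟩ := exists_basis_of_orthogonal h2 (by simp [N]) hv hv0
  obtain ⟨bw, hbw⟩ := exists_basis_of_orthogonal h2 (by simp [hd]) hw hw0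
  have hsq : IsSquare (Q (v 0) * R (w 0)) := by
    rw [← quadraticChar_one_iff_isSquare (mul_ne_zero (hv0 0) (hw0 0)), map_mul]
    rw [discChar_eq Q bv, discChar_eq R bw, hbv, hbw, gram_det_of_orthogonal hv,
      gram_det_of_orthogonal hw, hprod _ hv1, hprod _ hw1, map_mul, map_mul] at h
    have h3 : quadraticChar (ZMod ℓ) (2 ^ N) ≠ 0 := by
      rw [Ne, quadraticChar_eq_zero_iff]; exact pow_ne_zero _ h2
    rw [mul_left_cancel₀ h3 h, ← sq, quadraticChar_sq_one (hw0 0)]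
  obtain ⟨r, hr⟩ := hsq
  let u : Fin N → V := Function.update v 0 ((r / Q (v 0)) • v 0)
  have hu0 : u 0 = (r / Q (v 0)) • v 0 := by simp [u]
  have hu : ∀ i, i ≠ 0 → u i = v i := fun i hi => by simp [u, hi]
  have huv : ∀ i, ∃ a : ZMod ℓ, u i = a • v i := fun i => by
    by_cases hi : i = 0
    · rw [hi]; exact ⟨_, hu0⟩
    · exact ⟨1, by rw [hu i hi, one_smul]⟩
  have hQu : ∀ i, Q (u i) = R (w i) := by
    intro i
    by_cases hi : i = 0
    · rw [hi, hu0, QuadraticMap.map_smul, smul_eq_mul]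
      have := hv0 0
      field_simp
      rw [sq, ← hr]
    · rw [hu i hi, hv1 i (by simp [hi]), hw1 i (by simp [hi])]
  have huo : ∀ i j, i ≠ j → QuadraticMap.polar Q (u i) (u j) = 0 := by
    intro i j hij
    obtain ⟨a, ha⟩ := huv i
    obtain ⟨a', ha'⟩ := huv j
    rw [ha, ha', QuadraticMap.polar_smul_left, QuadraticMap.polar_smul_right, hv _ _ hij]
    simp
  obtain ⟨bu, hbu⟩ := exists_basis_of_orthogonal h2 (by simp [N]) huo fun i => by
    rw [hQu]; exact hw0 i
  refine ⟨isometryEquivOfGram h2 bu bw ?_⟩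
  ext i j
  rw [gram_apply, gram_apply, hbu, hbw]
  by_cases hij : i = j
  · rw [hij, polar_self_eq, polar_self_eq, hQu]
  · rw [huo _ _ hij, hw _ _ hij]

/-- A nondegenerate form of dimension at least two represents everything. -/
theorem exists_apply_eq (hℓ : ℓ ≠ 2) (hQ : (QuadraticMap.polarBilin Q).Nondegenerate)
    (hN : 2 ≤ Module.finrank (ZMod ℓ) V) (c : ZMod ℓ) : ∃ v, Q v = c := by
  have h2 := two_ne_zero_of_ne_two hℓ
  obtain ⟨b, hb, hb0⟩ := exists_orthogonal_basis_ne_zero h2 hQ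
  let i : Fin (Module.finrank (ZMod ℓ) V) := ⟨0, by omega⟩
  let j : Fin (Module.finrank (ZMod ℓ) V) := ⟨1, by omega⟩
  have hij : i ≠ j := by simp [i, j]
  obtain ⟨x, y, h⟩ := exists_mul_sq_add_mul_sq_eq h2 (hb0 i) (hb0 j) c
  refine ⟨x • b i + y • b j, ?_⟩
  rw [QuadraticMap.map_add Q, QuadraticMap.map_smul, QuadraticMap.map_smul,
    QuadraticMap.polar_smul_left, QuadraticMap.polar_smul_right, hb _ _ hij, ← h]
  simp only [smul_eq_mul]
  ring

theorem four_mul_card_omegaGroup_le' (hℓ : ℓ ≠ 2)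
    (hQ : (QuadraticMap.polarBilin Q).Nondegenerate) (hN : 2 ≤ Module.finrank (ZMod ℓ) V) :
    4 * Nat.card (omegaGroup Q) ≤ Nat.card (orthogonalGroup Q) := by
  obtain ⟨v, hv⟩ := exists_apply_eq hℓ hQ hN 1
  obtain ⟨a, ha⟩ := quadraticChar_exists_neg_one (F := ZMod ℓ) (by rwa [ZMod.ringChar_zmod_n])
  obtain ⟨w, hw⟩ := exists_apply_eq hℓ hQ hN a
  exact four_mul_card_omegaGroup_le hℓ hQ (by rw [hv, map_one]) (by rw [hw, ha])

end FiniteFieldForms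

/-! ### Split spaces and the discriminant -/

section Split

theorem det_fromBlocks_zero_left {K ι : Type*} [CommRing K] [Fintype ι] [DecidableEq ι]
    (A B D : Matrix ι ι K) :
    (Matrix.fromBlocks 0 A B D).det = (-1) ^ Fintype.card ι * (A.det * B.det) := by
  have hJ : (Matrix.fromBlocks 0 1 1 0 : Matrix (ι ⊕ ι) (ι ⊕ ι) K).det = (-1) ^ Fintype.card ι := by
    have h1 : (Matrix.fromBlocks 1 1 0 1 : Matrix (ι ⊕ ι) (ι ⊕ ι) K) * Matrix.fromBlocks 0 1 1 0 =
        Matrix.fromBlocks 1 1 1 0 := by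
      rw [Matrix.fromBlocks_multiply]; simp
    have h3 := congrArg Matrix.det h1
    rw [Matrix.det_mul, Matrix.det_fromBlocks_zero₂₁, Matrix.det_fromBlocks_one₁₁] at h3
    simpa [Matrix.det_neg] using h3
  have h1 : Matrix.fromBlocks 0 A B D * Matrix.fromBlocks 0 1 1 0 = Matrix.fromBlocks A 0 D B := by
    rw [Matrix.fromBlocks_multiply]; simp
  have h3 := congrArg Matrix.det h1
  rw [Matrix.det_mul, hJ, Matrix.det_fromBlocks_zero₁₂] at h3
  rw [← h3, mul_comm, mul_assoc, ← mul_pow]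
  simp

variable {ℓ : ℕ} [Fact ℓ.Prime] {V : Type*} [AddCommGroup V] [Module (ZMod ℓ) V]
  [FiniteDimensional (ZMod ℓ) V] {Q : QuadraticForm (ZMod ℓ) V}

theorem neg_one_pow_half (n : ℕ) :
    ((-1 : ZMod ℓ)) ^ (2 * n * (2 * n - 1) / 2) = (-1) ^ n := by
  rcases Nat.eq_zero_or_pos n with rfl | hn
  · simp
  have : 2 * n * (2 * n - 1) / 2 = n + 2 * (n * (n - 1)) := by
    obtain ⟨m, rfl⟩ := Nat.exists_eq_add_of_le hn
    have h1 : 2 * (1 + m) - 1 = 2 * m + 1 := by omega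
    have h2 : 1 + m - 1 = m := by omega
    rw [h1, h2, mul_assoc, Nat.mul_div_cancel_left _ (by norm_num)]
    ring
  rw [this, pow_add, pow_mul]
  simp

theorem quadraticChar_quadDisc_of_finrank {n : ℕ} (hN : Module.finrank (ZMod ℓ) V = 2 * n) :
    quadraticChar (ZMod ℓ) (quadDisc Q) = quadraticChar (ZMod ℓ) ((-1) ^ n) * discChar Q := by
  rw [quadraticChar_quadDisc, hN, neg_one_pow_half]

/-- A totally singular subspace of half the dimension gives the Gram matrix a zero diagonal block,
so its determinant is (-1)^n times a square. -/
theorem quadraticChar_quadDisc_of_isSplit (hQ : (QuadraticMap.polarBilin Q).Nondegenerate)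
    (hs : IsSplit Q) : quadraticChar (ZMod ℓ) (quadDisc Q) = 1 := by
  obtain ⟨W, hW, h0⟩ := hs
  set n := Module.finrank (ZMod ℓ) W
  obtain ⟨U, hU⟩ := W.exists_isCompl
  have hUn : Module.finrank (ZMod ℓ) U = n := by
    have := Submodule.finrank_add_eq_of_isCompl hU
    omega
  let bW : Module.Basis (Fin n) (ZMod ℓ) W := Module.finBasis (ZMod ℓ) W
  let bU : Module.Basis (Fin n) (ZMod ℓ) U := Module.finBasisOfFinrankEq _ _ hUn
  let b := (bW.prod bU).map (W.prodEquivOfIsCompl U hU)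
  have hG : gram Q b = Matrix.fromBlocks 0
      (Matrix.of fun i j => QuadraticMap.polar Q (bW i : V) (bU j))
      (Matrix.of fun i j => QuadraticMap.polar Q (bW i : V) (bU j)).transpose
      (Matrix.of fun i j => QuadraticMap.polar Q (bU i : V) (bU j)) := by
    ext (i | i) (j | j)
    · simp [b, QuadraticMap.polar, h0 _ (bW _).2, h0 _ (W.add_mem (bW i).2 (bW j).2)]
    · simp [b]
    · simp [b, QuadraticMap.polar_comm Q (bU i : V)]
    · simp [b]
  have hne := (nondegenerate_iff_gram Q b).1 hQ
  rw [quadraticChar_quadDisc_of_finrank hW.symm, discChar_eq Q b, ← map_mul]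
  rw [hG, det_fromBlocks_zero_left, Matrix.det_transpose, Fintype.card_fin] at hne ⊢
  rw [← mul_assoc, ← mul_pow]
  simp only [mul_neg, mul_one, neg_neg, one_pow, one_mul]
  rw [← sq]
  exact quadraticChar_sq_one' (by
    intro h
    simp [h] at hne)

/-- The hyperbolic form on the product of a space and its dual is split, so its discriminant is a
square by the converse implication. The classification makes it isometric to Q, and its totally
singular half is transported. -/
theorem isSplit_of_quadraticChar_quadDisc (hℓ : ℓ ≠ 2)
    (hQ : (QuadraticMap.polarBilin Q).Nondegenerate) {n : ℕ}
    (hN : Module.finrank (ZMod ℓ) V = 2 * n) (h : quadraticChar (ZMod ℓ) (quadDisc Q) = 1) :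
    IsSplit Q := by
  let F := Fin n → ZMod ℓ
  let H := QuadraticForm.dualProd (ZMod ℓ) F
  have hpol : QuadraticMap.polarBilin H = LinearMap.dualProd (ZMod ℓ) F := by
    refine LinearMap.ext fun x => LinearMap.ext fun y => ?_
    simp only [QuadraticMap.polarBilin_apply_apply, QuadraticMap.polar, H,
      QuadraticForm.dualProd_apply, LinearMap.dualProd_apply_apply, Prod.fst_add, Prod.snd_add,
      map_add, LinearMap.add_apply]
    ring
  have hdim : Module.finrank (ZMod ℓ) (Module.Dual (ZMod ℓ) F × F) = 2 * n := by
    rw [Module.finrank_prod, Subspace.dual_finrank_eq]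
    simp [F, two_mul]
  have hnd : (QuadraticMap.polarBilin H).Nondegenerate := by
    have hl : (QuadraticMap.polarBilin H).SeparatingLeft := by
      rw [hpol, LinearMap.separatingLeft_dualProd]
      exact (Module.bijective_dual_eval (ZMod ℓ) F).1
    refine ⟨hl, fun y hy => hl y fun x => ?_⟩
    rw [← hy x, QuadraticMap.polarBilin_apply_apply, QuadraticMap.polarBilin_apply_apply,
      QuadraticMap.polar_comm]
  have hsplit : IsSplit H := by
    refine ⟨LinearMap.range (LinearMap.inr (ZMod ℓ) (Module.Dual (ZMod ℓ) F) F), ?_, ?_⟩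
    · rw [LinearMap.finrank_range_of_inj LinearMap.inr_injective, hdim]
      simp [F]
    · rintro _ ⟨x, rfl⟩
      simp [H, QuadraticForm.dualProd]
  have hH := quadraticChar_quadDisc_of_isSplit hnd hsplit
  have hd : discChar Q = discChar H := by
    rw [quadraticChar_quadDisc_of_finrank hN] at h
    rw [quadraticChar_quadDisc_of_finrank hdim] at hH
    refine mul_left_cancel₀ ?_ (h.trans hH.symm)
    rw [Ne, quadraticChar_eq_zero_iff]
    simp
  obtain ⟨e⟩ := equivalent_of_discChar_eq hℓ hnd hQ (hdim.trans hN.symm) hd.symm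
  obtain ⟨W, hW, h0⟩ := hsplit
  refine ⟨W.map (e.toLinearEquiv : _ →ₗ[ZMod ℓ] V), ?_, ?_⟩
  · rw [LinearEquiv.finrank_map_eq, hW, hdim, hN]
  · rintro _ ⟨x, hx, rfl⟩
    exact (e.map_app x).trans (h0 x hx)

end Split

/-! ### The transform of h into x^n h(x + 1/x) -/

section Recip

variable {K : Type*} [Field K]

/-- The polynomial `x ^ n h(x + x⁻¹)`, for `h` of degree at most `n`. -/
def recip (n : ℕ) (h : K[X]) : K[X] :=
  ∑ i ∈ Finset.range (n + 1), C (h.coeff i) * (X ^ (n - i) * (X ^ 2 + 1) ^ i)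

/-- Each summand works because a² + 1 = a(a + b). The algebra may be noncommutative, so that the
formula applies to an endomorphism and its inverse as well as to scalars and Laurent polynomials. -/
theorem aeval_recip {A : Type*} [Ring A] [Algebra K A] {n : ℕ} {h : K[X]} (hn : h.natDegree ≤ n)
    {a b : A} (hab : a * b = 1) (hba : b * a = 1) :
    aeval a (recip n h) = a ^ n * aeval (a + b) h := by
  have hc : Commute a (a + b) := by
    rw [Commute, SemiconjBy, mul_add, add_mul, hab, hba]
  rw [recip, map_sum, aeval_eq_sum_range' (Nat.lt_succ_of_le hn), Finset.mul_sum]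
  refine Finset.sum_congr rfl fun i hi => ?_
  have hi' : i ≤ n := Nat.lt_succ_iff.1 (Finset.mem_range.1 hi)
  have h1 : a ^ 2 + 1 = a * (a + b) := by rw [mul_add, hab, sq]
  simp only [map_mul, map_pow, map_add, aeval_X, aeval_C, map_one]
  rw [h1, hc.mul_pow, ← mul_assoc (a ^ (n - i)), ← pow_add, Nat.sub_add_cancel hi',
    ← Algebra.smul_def, mul_smul_comm]

theorem eval_one_recip {n : ℕ} {h : K[X]} (hn : h.natDegree ≤ n) :
    (recip n h).eval 1 = h.eval 2 := by
  have := aeval_recip hn (A := K) (a := 1) (b := 1) (by simp) (by simp)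
  simpa [one_add_one_eq_two] using this

theorem eval_neg_one_recip {n : ℕ} {h : K[X]} (hn : h.natDegree ≤ n) :
    (recip n h).eval (-1) = (-1) ^ n * h.eval (-2) := by
  have := aeval_recip hn (A := K) (a := -1) (b := -1) (by simp) (by simp)
  simpa [show (-1 + -1 : K) = -2 by ring] using this

theorem isTraceOf_recip {n : ℕ} {h : K[X]} (hn : h.natDegree ≤ n) : IsTraceOf n (recip n h) h := by
  have h1 := aeval_recip hn (A := LaurentPolynomial K) (a := LaurentPolynomial.T 1)
    (b := LaurentPolynomial.T (-1)) (by rw [← LaurentPolynomial.T_add]; simp)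
    (by rw [← LaurentPolynomial.T_add]; simp)
  have h3 : ∀ p : K[X], aeval (LaurentPolynomial.T 1 : LaurentPolynomial K) p = toLaurent p := by
    intro p
    rw [← Polynomial.toLaurentAlg_apply]
    congr 1
    refine Polynomial.algHom_ext ?_
    simp
  rw [h3, LaurentPolynomial.T_pow] at h1
  simpa [IsTraceOf] using h1

theorem eq_of_isTraceOf {n : ℕ} {f g h : K[X]} (hf : IsTraceOf n f h) (hg : IsTraceOf n g h) :
    f = g := toLaurent_injective (hf.trans hg.symm)

theorem isTraceOf_mul {n m : ℕ} {f g h k : K[X]} (hf : IsTraceOf n f h) (hg : IsTraceOf m g k) :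
    IsTraceOf (n + m) (f * g) (h * k) := by
  rw [IsTraceOf] at hf hg ⊢
  rw [map_mul, hf, hg, map_mul, Nat.cast_add, LaurentPolynomial.T_add]
  ring

/-- The comparison takes place among Laurent polynomials, where the transform is literally x^n h(x +
1/x) and visibly multiplicative. -/
theorem recip_mul {n m : ℕ} {h k : K[X]} (hn : h.natDegree ≤ n) (hm : k.natDegree ≤ m) :
    recip (n + m) (h * k) = recip n h * recip m k :=
  eq_of_isTraceOf (isTraceOf_recip (natDegree_mul_le.trans (add_le_add hn hm)))
    (isTraceOf_mul (isTraceOf_recip hn) (isTraceOf_recip hm))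

theorem natDegree_recip_term {n i : ℕ} (hi : i ≤ n) (a : K) :
    (C a * (X ^ (n - i) * (X ^ 2 + 1) ^ i)).natDegree ≤ n + i := by
  refine (natDegree_C_mul_le _ _).trans (natDegree_mul_le.trans ?_)
  have h1 : ((X ^ 2 + 1 : K[X]) ^ i).natDegree ≤ i * 2 :=
    natDegree_pow_le.trans (Nat.mul_le_mul_left _ (by compute_degree))
  rw [natDegree_X_pow]
  omega

theorem natDegree_recip_le (n : ℕ) (h : K[X]) : (recip n h).natDegree ≤ 2 * n := by
  refine natDegree_sum_le_of_forall_le _ _ fun i hi => ?_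
  have := Nat.lt_succ_iff.1 (Finset.mem_range.1 hi)
  exact (natDegree_recip_term this _).trans (by omega)

theorem coeff_two_mul_recip (n : ℕ) (h : K[X]) : (recip n h).coeff (2 * n) = h.coeff n := by
  rw [recip, finsetSum_coeff, Finset.sum_range_succ, Finset.sum_eq_zero, zero_add]
  · rw [Nat.sub_self, pow_zero, one_mul, coeff_C_mul]
    have hm : ((X ^ 2 + 1 : K[X]) ^ n).Monic := (monic_X_pow_add_C (1 : K) two_ne_zero).pow n
    have hd : ((X ^ 2 + 1 : K[X]) ^ n).natDegree = 2 * n := by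
      have := natDegree_X_pow_add_C (n := 2) (r := (1 : K))
      rw [natDegree_pow, ← C_1, this, mul_comm]
    rw [← hd, coeff_natDegree, hm.leadingCoeff, mul_one]
  · intro i hi
    rw [Finset.mem_range] at hi
    exact coeff_eq_zero_of_natDegree_lt
      ((natDegree_recip_term hi.le _).trans_lt (by omega))

theorem recip_monic {n : ℕ} {h : K[X]} (hm : h.Monic) (hn : h.natDegree = n) :
    (recip n h).Monic ∧ (recip n h).natDegree = 2 * n := by
  have h1 : (recip n h).coeff (2 * n) = 1 := by rw [coeff_two_mul_recip, ← hn, hm.coeff_natDegree]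
  refine ⟨monic_of_natDegree_le_of_coeff_eq_one _ (natDegree_recip_le n h) h1, ?_⟩
  exact le_antisymm (natDegree_recip_le n h) (le_natDegree_of_ne_zero (by rw [h1]; exact one_ne_zero))

/-- Inverting the variable fixes x + 1/x, so it only changes the power of x in front. -/
theorem reverse_recip {n : ℕ} {h : K[X]} (hm : h.Monic) (hn : h.natDegree = n) :
    (recip n h).reverse = recip n h := by
  obtain ⟨_, hd⟩ := recip_monic hm hn
  apply toLaurent_injective
  have h1 : toLaurent (recip n h).reverse =
      LaurentPolynomial.T (2 * n : ℕ) * LaurentPolynomial.invert (toLaurent (recip n h)) := by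
    rw [← hd, LaurentPolynomial.toLaurent_reverse, mul_comm]
  rw [h1, isTraceOf_recip hn.le, map_mul, ← aeval_algHom_apply]
  simp only [map_add, LaurentPolynomial.invert_T, neg_neg]
  rw [← mul_assoc, ← LaurentPolynomial.T_add, add_comm (LaurentPolynomial.T (-1))]
  congr 2
  push_cast
  ring

theorem coeff_sub_recip {n i : ℕ} {h : K[X]} (hm : h.Monic) (hn : h.natDegree = n)
    (hi : i ≤ 2 * n) : (recip n h).coeff (2 * n - i) = (recip n h).coeff i := by
  conv_rhs => rw [← reverse_recip hm hn, coeff_reverse, (recip_monic hm hn).2, revAt_le hi]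

theorem coeff_zero_recip {n : ℕ} {h : K[X]} (hm : h.Monic) (hn : h.natDegree = n) :
    (recip n h).coeff 0 = 1 := by
  rw [← coeff_sub_recip hm hn (Nat.zero_le _), Nat.sub_zero, coeff_two_mul_recip, ← hn,
    hm.coeff_natDegree]

theorem recip_mem_selfRecip {n : ℕ} {h : K[X]} (hm : h.Monic) (hn : h.natDegree = n) :
    recip n h ∈ selfRecip K (2 * n) := by
  have h1 : (recip n h).coeff (2 * n) = 1 := by rw [coeff_two_mul_recip, ← hn, hm.coeff_natDegree]
  refine ⟨natDegree_recip_le n h, coeff_zero_recip hm hn, by rw [h1, one_pow], fun i hi => ?_⟩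
  rw [h1, one_mul, coeff_sub_recip hm hn (by omega)]

/-- If the difference of h and k were nonzero of degree d, its transform would be X^(n - d) times a
polynomial whose coefficient of degree 2d is the leading coefficient of that difference. -/
theorem recip_injective {n : ℕ} {h k : K[X]} (hh : h.natDegree ≤ n) (hk : k.natDegree ≤ n)
    (e : recip n h = recip n k) : h = k := by
  have h1 := isTraceOf_recip hh
  have h3 := isTraceOf_recip hk
  rw [← e] at h3
  have h4 : recip n (h - k) = 0 := by
    have := isTraceOf_recip (n := n) (h := h - k) ((natDegree_sub_le _ _).trans (max_le hh hk))
    apply toLaurent_injective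
    rw [this, map_sub, mul_sub, ← h1, ← h3, sub_self, map_zero]
  by_contra hne
  have hsub : h - k ≠ 0 := sub_ne_zero.2 hne
  set d := (h - k).natDegree with hd
  have hdn : d ≤ n := (natDegree_sub_le _ _).trans (max_le hh hk)
  have h5 : recip n (h - k) = X ^ (n - d) * recip d (h - k) := by
    apply toLaurent_injective
    rw [map_mul, isTraceOf_recip (n := n) (h := h - k) hdn, isTraceOf_recip (n := d) (h := h - k) le_rfl,
      ← mul_assoc, toLaurent_X_pow, ← LaurentPolynomial.T_add]
    congr 2
    omega
  rw [h5, mul_eq_zero, or_iff_right (pow_ne_zero _ X_ne_zero)] at h4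
  have h6 := coeff_two_mul_recip d (h - k)
  rw [h4, coeff_zero, hd, coeff_natDegree, eq_comm, leadingCoeff_eq_zero] at h6
  exact hsub h6

end Recip

/-! ### A model space for an isometry with given characteristic polynomial -/

section Model

variable {K L : Type*} [Field K] [CommRing L] [Algebra K L]

/-- Multiplication by a root of `x ^ 2 - α x + 1` on `L[x] / (x ^ 2 - α x + 1)`. -/
def companion (K : Type*) [Field K] [Algebra K L] (α : L) : Module.End K (L × L) where
  toFun p := (-p.2, p.1 + α * p.2)
  map_add' p q := by ext <;> simp <;> ring
  map_smul' c p := by ext <;> simp [Algebra.smul_def]; ring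

/-- The inverse of `companion`. -/
def companionInv (K : Type*) [Field K] [Algebra K L] (α : L) : Module.End K (L × L) where
  toFun p := (p.2 + α * p.1, -p.1)
  map_add' p q := by ext <;> simp <;> ring
  map_smul' c p := by ext <;> simp [Algebra.smul_def]; ring

@[simp] theorem companion_apply (α : L) (p : L × L) :
    companion K α p = (-p.2, p.1 + α * p.2) := rfl

@[simp] theorem companionInv_apply (α : L) (p : L × L) :
    companionInv K α p = (p.2 + α * p.1, -p.1) := rfl

theorem companion_mul_inv (α : L) : companion K α * companionInv K α = 1 := by
  refine LinearMap.ext fun p => ?_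
  ext <;> simp

theorem companionInv_mul (α : L) : companionInv K α * companion K α = 1 := by
  refine LinearMap.ext fun p => ?_
  ext <;> simp

theorem companion_add_inv_apply (α : L) (p : L × L) :
    (companion K α + companionInv K α) p = (α * p.1, α * p.2) := by
  ext <;> simp

theorem aeval_companion_add_inv (α : L) (P : K[X]) (p : L × L) :
    aeval (companion K α + companionInv K α) P p = (aeval α P * p.1, aeval α P * p.2) := by
  induction P using Polynomial.induction_on' with
  | add P R hP hR => simp only [map_add, LinearMap.add_apply, hP, hR]; ext <;> simp <;> ring
  | monomial k c =>
    rw [aeval_monomial, aeval_monomial]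
    have : ∀ k : ℕ, ((companion K α + companionInv K α) ^ k) p = (α ^ k * p.1, α ^ k * p.2) := by
      intro k
      induction k with
      | zero => simp
      | succ k ih =>
        rw [pow_succ', Module.End.mul_apply, ih, companion_add_inv_apply]
        ext <;> simp <;> ring
    rw [Module.End.mul_apply, this, Module.algebraMap_end_apply]
    ext <;> simp [Algebra.smul_def, mul_assoc]

/-- The quadratic form `τ(u (a ^ 2 + α a b + b ^ 2))`. -/
def modelForm (τ : L →ₗ[K] K) (α u : L) : QuadraticForm K (L × L) :=
  LinearMap.BilinMap.toQuadraticMap (LinearMap.mk₂ K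
    (fun p q : L × L => τ (u * (p.1 * q.1 + α * (p.1 * q.2) + p.2 * q.2)))
    (fun p p' q => by rw [← map_add]; congr 1; simp; ring)
    (fun c p q => by rw [← map_smul]; congr 1; simp [Algebra.smul_def]; ring)
    (fun p q q' => by rw [← map_add]; congr 1; simp; ring)
    (fun c p q => by rw [← map_smul]; congr 1; simp [Algebra.smul_def]; ring))

theorem modelForm_apply (τ : L →ₗ[K] K) (α u : L) (p : L × L) :
    modelForm τ α u p = τ (u * (p.1 * p.1 + α * (p.1 * p.2) + p.2 * p.2)) := rfl

theorem polar_modelForm (τ : L →ₗ[K] K) (α u : L) (p q : L × L) :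
    QuadraticMap.polar (modelForm τ α u) p q =
      τ (u * (2 * (p.1 * q.1) + α * (p.1 * q.2 + q.1 * p.2) + 2 * (p.2 * q.2))) := by
  simp only [QuadraticMap.polar, modelForm_apply, ← map_sub]
  congr 1
  simp
  ring

theorem modelForm_companion (τ : L →ₗ[K] K) (α u : L) (p : L × L) :
    modelForm τ α u (companion K α p) = modelForm τ α u p := by
  simp only [modelForm_apply, companion_apply]
  congr 1
  ring

theorem polar_modelForm_companion (τ : L →ₗ[K] K) (α u : L) (p q : L × L) :
    QuadraticMap.polar (modelForm τ α u) (companion K α p) q =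
      QuadraticMap.polar (modelForm τ α u) p (companionInv K α q) := by
  simp only [polar_modelForm, companion_apply, companionInv_apply]
  congr 1
  ring

/-- Over L the polar form has Gram matrix u[2, α; α, 2], of determinant u²(4 - α²), a unit;
nondegeneracy of τ carries this down to K. -/
theorem modelForm_nondegenerate {τ : L →ₗ[K] K} (hτ : ∀ a, (∀ b, τ (a * b) = 0) → a = 0)
    {α u : L} (hu : IsUnit u) (hα : IsUnit (α ^ 2 - 4)) :
    (QuadraticMap.polarBilin (modelForm τ α u)).Nondegenerate := by
  have hl : (QuadraticMap.polarBilin (modelForm τ α u)).SeparatingLeft := by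
    intro p hp
    have hp' : ∀ q, QuadraticMap.polar (modelForm τ α u) p q = 0 := hp
    have h1 : 2 * p.1 + α * p.2 = 0 := by
      refine (hu.mul_right_eq_zero).1 (hτ _ fun b => ?_)
      rw [← hp' (b, 0), polar_modelForm]
      congr 1
      simp
      ring
    have h3 : α * p.1 + 2 * p.2 = 0 := by
      refine (hu.mul_right_eq_zero).1 (hτ _ fun b => ?_)
      rw [← hp' (0, b), polar_modelForm]
      congr 1
      simp
      ring
    ext
    · exact (hα.mul_right_eq_zero).1 (by linear_combination α * h3 - 2 * h1)
    · exact (hα.mul_right_eq_zero).1 (by linear_combination α * h1 - 2 * h3)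
  refine ⟨hl, fun y hy => hl y fun x => ?_⟩
  rw [← hy x, QuadraticMap.polarBilin_apply_apply, QuadraticMap.polarBilin_apply_apply,
    QuadraticMap.polar_comm]

/-- The polar value at (1, 0) and (b, 0) is 2τ(ub), and τ separates elements. The double counting
needs distinct units to give distinct forms. -/
theorem modelForm_injective {τ : L →ₗ[K] K} (hτ : ∀ a, (∀ b, τ (a * b) = 0) → a = 0)
    (h2 : (2 : K) ≠ 0) {α u v : L} (h : modelForm τ α u = modelForm τ α v) : u = v := by
  rw [← sub_eq_zero]
  refine hτ _ fun b => ?_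
  have h1 : QuadraticMap.polar (modelForm τ α u) (1, 0) (b, 0) =
    QuadraticMap.polar (modelForm τ α v) (1, 0) (b, 0) := by rw [h]
  rw [polar_modelForm, polar_modelForm, ← sub_eq_zero, ← map_sub] at h1
  have h3 : (2 : K) * τ ((u - v) * b) = 0 := by
    rw [← h1, ← smul_eq_mul, ← map_smul]
    congr 1
    simp [Algebra.smul_def, map_ofNat]
    ring
  exact (mul_eq_zero.1 h3).resolve_left h2

variable {n : ℕ} {h : K[X]} {α : L}

/-- Dividing h by X - c and evaluating at α gives (α - c) q(α) = -h(c), so α - c is a unit as soon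
as h(c) is nonzero; this is used for c = 2 and c = -2. -/
theorem isUnit_sq_sub_four (hα : aeval α h = 0) (h1 : h.eval 2 ≠ 0) (h3 : h.eval (-2) ≠ 0) :
    IsUnit (α ^ 2 - 4) := by
  have key : ∀ c : K, h.eval c ≠ 0 → IsUnit (α - algebraMap K L c) := by
    intro c hc
    have hd := congrArg (aeval α) (X_sub_C_mul_divByMonic_eq_sub_modByMonic h c)
    simp only [modByMonic_X_sub_C_eq_C_eval, map_mul, map_sub, aeval_X, aeval_C, hα] at hd
    refine isUnit_of_mul_isUnit_left (y := aeval α (h /ₘ (X - C c))) ?_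
    rw [hd, zero_sub]
    exact ((isUnit_iff_ne_zero.2 hc).map _).neg
  have h4 := (key 2 h1).mul (key (-2) h3)
  have : (α - algebraMap K L 2) * (α - algebraMap K L (-2)) = α ^ 2 - 4 := by
    simp only [map_neg, map_ofNat]
    ring
  rwa [this] at h4

/-- `(1, 0)` is a cyclic vector. -/
theorem exists_aeval_companion (hgen : ∀ a : L, ∃ P : K[X], P.natDegree ≤ n ∧ aeval α P = a)
    (y : L × L) : ∃ P : K[X], aeval (companion K α) P (1, 0) = y := by
  have ht := companion_mul_inv (K := K) α
  have hs := companionInv_mul (K := K) α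
  set t := companion K α with htdef
  set s := companionInv K α
  -- A polynomial of degree at most n in t + t⁻¹ becomes a polynomial in t after multiplication by
  -- t^n, so y is divided by t^n beforehand. The operator t + t⁻¹ acts as the scalar α, and t sends
  -- (a, 0) to (0, a), so both coordinates are reached.
  set x := (s ^ n) y with hx
  have hy : y = (t ^ n) x := by
    have hc : Commute t s := ht.trans hs.symm
    rw [hx, ← Module.End.mul_apply, ← hc.mul_pow, ht, one_pow, Module.End.one_apply]
  obtain ⟨P, hP, hPx⟩ := hgen x.1
  obtain ⟨R, hR, hRx⟩ := hgen x.2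
  have e : ∀ P : K[X], P.natDegree ≤ n → aeval t (recip n P) (1, 0) = (t ^ n) (aeval α P, 0) := by
    intro P hP
    rw [aeval_recip hP ht hs, Module.End.mul_apply, aeval_companion_add_inv]
    simp
  refine ⟨recip n P + X * recip n R, ?_⟩
  rw [map_add, map_mul, aeval_X, LinearMap.add_apply, Module.End.mul_apply, e P hP, e R hR, hPx,
    hRx, hy, ← Module.End.mul_apply t, ← pow_succ', pow_succ, Module.End.mul_apply, ← map_add]
  congr 1
  rw [htdef]
  ext <;> simp

/-- The transform of h is monic of degree 2n and kills t, since h(t + t⁻¹) acts as h(α) = 0. The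
cyclic vector forces the minimal polynomial to have degree at least 2n, so every monic annihilator
of degree 2n is equal to it. -/
theorem charpoly_companion [FiniteDimensional K L] (hm : h.Monic) (hn : h.natDegree = n)
    (hL : Module.finrank K L = n)
    (hα : aeval α h = 0) (hgen : ∀ a : L, ∃ P : K[X], P.natDegree ≤ n ∧ aeval α P = a) :
    (companion K α).charpoly = recip n h := by
  obtain ⟨hfm, hfd⟩ := recip_monic hm hn
  set t := companion K α with htdef
  have hf0 : aeval t (recip n h) = 0 := by
    rw [aeval_recip hn.le (companion_mul_inv α) (companionInv_mul α)]
    refine LinearMap.ext fun p => ?_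
    rw [Module.End.mul_apply, aeval_companion_add_inv, hα, zero_mul, zero_mul]
    exact map_zero _
  have hfin : Module.finrank K (L × L) = 2 * n := by rw [Module.finrank_prod, hL, two_mul]
  have hmin : 2 * n ≤ (minpoly K t).natDegree := by
    have hmm : (minpoly K t).Monic := minpoly.monic (Algebra.IsIntegral.isIntegral t)
    let Φ : degreeLT K (minpoly K t).natDegree →ₗ[K] L × L :=
      ((LinearMap.applyₗ ((1, 0) : L × L)).comp (aeval t).toLinearMap).comp (Submodule.subtype _)
    have hs : Function.Surjective Φ := by
      intro y
      obtain ⟨P, hP⟩ := exists_aeval_companion hgen y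
      refine ⟨⟨P %ₘ minpoly K t, ?_⟩, ?_⟩
      · rw [mem_degreeLT, ← degree_eq_natDegree hmm.ne_zero]
        exact degree_modByMonic_lt _ hmm
      · rw [← hP]
        change aeval t (P %ₘ minpoly K t) (1, 0) = _
        rw [aeval_modByMonic_eq_self_of_root (minpoly.aeval K t)]
    have : Module.finrank K (degreeLT K (minpoly K t).natDegree) = (minpoly K t).natDegree := by
      rw [(degreeLTEquiv K _).finrank_eq]; simp
    rw [← hfin, ← this]
    have : FiniteDimensional K (degreeLT K (minpoly K t).natDegree) :=
      (degreeLTEquiv K _).symm.finiteDimensional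
    exact LinearMap.finrank_le_finrank_of_surjective hs
  have hdm : ∀ p : K[X], p.Monic → p.natDegree = 2 * n → aeval t p = 0 → p = minpoly K t := by
    intro p hp hpd hp0
    refine (eq_of_monic_of_dvd_of_natDegree_le (minpoly.monic (Algebra.IsIntegral.isIntegral t))
      hp (minpoly.dvd K t hp0) (hpd ▸ hmin)).symm ▸ rfl
  rw [hdm _ (LinearMap.charpoly_monic _) ((LinearMap.charpoly_natDegree _).trans hfin)
    (LinearMap.aeval_self_charpoly _), hdm _ hfm hfd hf0]

end Model

/-! ### The algebra K[x]/(h): a nondegenerate functional and the number of units -/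

section AdjoinRootFacts

variable {K : Type*} [Field K] {h : K[X]}

theorem finrank_adjoinRoot (hm : h.Monic) : Module.finrank K (AdjoinRoot h) = h.natDegree :=
  (AdjoinRoot.powerBasis' hm).finrank

theorem exists_aeval_root_eq (hm : h.Monic) (a : AdjoinRoot h) :
    ∃ P : K[X], P.natDegree ≤ h.natDegree ∧ aeval (AdjoinRoot.root h) P = a :=
  ⟨AdjoinRoot.modByMonicHom hm a, by
    obtain ⟨p, rfl⟩ := AdjoinRoot.mk_surjective a
    rw [AdjoinRoot.modByMonicHom_mk]
    exact natDegree_modByMonic_le _ hm, by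
    rw [AdjoinRoot.aeval_eq]
    exact AdjoinRoot.mk_leftInverse hm a⟩

/-- The coefficient of highest order of the representative of lowest degree. -/
def topCoeff (hm : h.Monic) : AdjoinRoot h →ₗ[K] K :=
  (lcoeff K (h.natDegree - 1)).comp (AdjoinRoot.modByMonicHom hm)

/-- Multiplication by a power of x moves the leading term of a nonzero representative to degree deg
h - 1 without any reduction modulo h. Unlike the trace, this functional needs no separability of h.
-/
theorem topCoeff_nondegenerate (hm : h.Monic) (a : AdjoinRoot h)
    (ha : ∀ b, topCoeff hm (a * b) = 0) : a = 0 := by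
  set p := AdjoinRoot.modByMonicHom hm a with hp
  have hpa : AdjoinRoot.mk h p = a := AdjoinRoot.mk_leftInverse hm a
  by_contra h0
  have hp0 : p ≠ 0 := fun h => h0 (by rw [← hpa, h, map_zero])
  have hdeg : p.degree < h.degree := by
    obtain ⟨q, rfl⟩ := AdjoinRoot.mk_surjective a
    rw [hp, AdjoinRoot.modByMonicHom_mk]
    exact degree_modByMonic_lt _ hm
  have hlt : p.natDegree < h.natDegree := natDegree_lt_natDegree hp0 hdeg
  have key := ha (AdjoinRoot.mk h (X ^ (h.natDegree - 1 - p.natDegree)))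
  rw [← hpa, ← map_mul, topCoeff, LinearMap.comp_apply, AdjoinRoot.modByMonicHom_mk] at key
  have hd : (p * X ^ (h.natDegree - 1 - p.natDegree)).degree < h.degree := by
    rw [degree_mul, degree_X_pow, degree_eq_natDegree hp0, degree_eq_natDegree hm.ne_zero]
    norm_cast
    omega
  rw [(modByMonic_eq_self_iff hm).2 hd] at key
  have e : h.natDegree - 1 = p.natDegree + (h.natDegree - 1 - p.natDegree) := by omega
  simp only [lcoeff_apply] at key
  nth_rewrite 2 [e] at key
  rw [coeff_mul_X_pow, coeff_natDegree, leadingCoeff_eq_zero] at key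
  exact hp0 key

theorem card_normalizedFactors_le [DecidableEq K] (h0 : h ≠ 0) :
    Multiset.card (UniqueFactorizationMonoid.normalizedFactors h) ≤ h.natDegree := by
  rw [← natDegree_eq_of_degree_eq (degree_eq_degree_of_associated
    (UniqueFactorizationMonoid.prod_normalizedFactors h0)),
    natDegree_multiset_prod _ (UniqueFactorizationMonoid.zero_notMem_normalizedFactors h)]
  have := Multiset.card_nsmul_le_sum (s := (UniqueFactorizationMonoid.normalizedFactors h).map
    natDegree) (a := 1) (by
      intro x hx
      obtain ⟨r, hr, rfl⟩ := Multiset.mem_map.1 hx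
      exact (UniqueFactorizationMonoid.irreducible_of_normalized_factor r hr).natDegree_pos)
  simpa using this

/-- A nonunit is a multiple of some irreducible factor of h. There are at most n = deg h such
factors, and each generates a proper ideal, hence a subspace of at most ℓ^(n - 1) elements. -/
theorem pow_natDegree_le_card_units {ℓ : ℕ} [Fact ℓ.Prime] {h : (ZMod ℓ)[X]} (hm : h.Monic) :
    ℓ ^ h.natDegree ≤ Nat.card (AdjoinRoot h)ˣ + h.natDegree * ℓ ^ (h.natDegree - 1) := by
  classical
  set n := h.natDegree with hn
  have : FiniteDimensional (ZMod ℓ) (AdjoinRoot h) := (AdjoinRoot.powerBasis' hm).finite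
  have : Finite (AdjoinRoot h) := Module.finite_of_finite (ZMod ℓ)
  let S := (UniqueFactorizationMonoid.normalizedFactors h).toFinset
  have hS : S.card ≤ n := (Multiset.toFinset_card_le _).trans (card_normalizedFactors_le hm.ne_zero)
  let I : (ZMod ℓ)[X] → Submodule (ZMod ℓ) (AdjoinRoot h) := fun r =>
    (Ideal.span {AdjoinRoot.mk h r}).restrictScalars (ZMod ℓ)
  have hI : ∀ r ∈ S, (I r : Set (AdjoinRoot h)).ncard ≤ ℓ ^ (n - 1) := by
    intro r hr
    rw [Multiset.mem_toFinset] at hr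
    have hirr := UniqueFactorizationMonoid.irreducible_of_normalized_factor r hr
    have hdvd := UniqueFactorizationMonoid.dvd_of_mem_normalizedFactors hr
    have hne : I r < ⊤ := by
      rw [lt_top_iff_ne_top]
      intro ht
      have h1 : (1 : AdjoinRoot h) ∈ I r := ht ▸ Submodule.mem_top
      obtain ⟨c, hc⟩ := Ideal.mem_span_singleton'.1 h1
      obtain ⟨q, rfl⟩ := AdjoinRoot.mk_surjective c
      rw [← map_mul, ← (AdjoinRoot.mk h).map_one, ← sub_eq_zero, ← map_sub,
        AdjoinRoot.mk_eq_zero] at hc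
      have : r ∣ 1 := by
        have h3 := (hdvd.trans hc)
        exact (dvd_sub_right (Dvd.intro_left q rfl)).1 h3
      exact hirr.not_isUnit (isUnit_of_dvd_one this)
    have hlt := Submodule.finrank_lt hne.ne
    rw [finrank_adjoinRoot hm] at hlt
    have hc : (I r : Set (AdjoinRoot h)).ncard = ℓ ^ Module.finrank (ZMod ℓ) (I r) := by
      rw [← Nat.card_coe_set_eq]
      have := Module.natCard_eq_pow_finrank (K := ZMod ℓ) (V := I r)
      rwa [Nat.card_zmod] at this
    rw [hc]
    exact Nat.pow_le_pow_right (Fact.out : ℓ.Prime).pos (by omega)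
  have hcov : (Set.univ : Set (AdjoinRoot h)) ⊆
      Set.range (Units.val : (AdjoinRoot h)ˣ → _) ∪ ⋃ r ∈ S, (I r : Set (AdjoinRoot h)) := by
    intro a _
    obtain ⟨p, rfl⟩ := AdjoinRoot.mk_surjective a
    by_cases hr : ∃ r ∈ S, r ∣ p
    · right
      obtain ⟨r, hr, q, rfl⟩ := hr
      refine Set.mem_biUnion hr ?_
      exact Ideal.mem_span_singleton.2 (by rw [map_mul]; exact Dvd.intro _ rfl)
    · left
      have hcop : IsCoprime p h := by
        refine isCoprime_of_irreducible_dvd (fun h' => hm.ne_zero h'.2) fun z hz hzp hzh => hr ?_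
        obtain ⟨r, hrm, hrz⟩ := UniqueFactorizationMonoid.exists_mem_normalizedFactors_of_dvd
          hm.ne_zero hz hzh
        exact ⟨r, Multiset.mem_toFinset.2 hrm, hrz.symm.dvd.trans hzp⟩
      obtain ⟨a, b, hab⟩ := hcop
      have h1 := congrArg (AdjoinRoot.mk h) hab
      rw [map_add, map_mul, map_mul, AdjoinRoot.mk_self, mul_zero, add_zero, map_one] at h1
      exact ⟨(IsUnit.of_mul_eq_one_right _ h1).unit, rfl⟩
  have h1 : (Set.univ : Set (AdjoinRoot h)).ncard = ℓ ^ n := by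
    rw [Set.ncard_univ, Module.natCard_eq_pow_finrank (K := ZMod ℓ), finrank_adjoinRoot hm,
      Nat.card_zmod]
  rw [← h1]
  refine (Set.ncard_le_ncard hcov (Set.toFinite _)).trans ((Set.ncard_union_le _ _).trans ?_)
  refine add_le_add ?_ ?_
  · rw [Set.ncard_range_of_injective Units.val_injective]
  · refine (Finset.set_ncard_biUnion_le S _).trans ?_
    refine (Finset.sum_le_card_nsmul S _ _ hI).trans ?_
    rw [smul_eq_mul]
    exact Nat.mul_le_mul_right _ hS

end AdjoinRootFacts

/-! ### Double counting of isometries onto Q -/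

section PairCount

variable {K V M X : Type*} [Field K] [AddCommGroup V] [Module K V] [AddCommGroup M] [Module K M]

/-- Double counting of the pairs made of a form `R x` preserved by `T` and of an isometry onto
`(V, Q)`. -/
theorem card_orthogonalGroup_mul_le [Finite V] [Finite M] (Q : QuadraticForm K V)
    (T : Module.End K M) (R : X → QuadraticForm K M) (hR : Function.Injective R)
    (hT : ∀ x m, R x (T m) = R x m) (hTi : Function.Bijective T)
    (e : ∀ x, (R x).IsometryEquiv Q) :
    Nat.card (orthogonalGroup Q) * Nat.card X ≤
      Nat.card {g : orthogonalGroup Q // ∃ x, ∃ ψ : (R x).IsometryEquiv Q,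
        ∀ m, toEnd g (ψ m) = ψ (T m)} *
      Nat.card {z : Module.End K M // z * T = T * z ∧ ∃ x x', ∀ m, R x (z m) = R x' m} := by
  set G := {g : orthogonalGroup Q // ∃ x, ∃ ψ : (R x).IsometryEquiv Q,
    ∀ m, toEnd g (ψ m) = ψ (T m)}
  set Z := {z : Module.End K M // z * T = T * z ∧ ∃ x x', ∀ m, R x (z m) = R x' m}
  have : Finite (V ≃ₗ[K] V) := DFunLike.finite _
  have : Finite (Module.End K M) := DFunLike.finite _
  have : Finite G := Subtype.finite
  have : Finite Z := Subtype.finite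
  -- The fixed isometry `e x` followed by an element of the orthogonal group; each ψ transports T to
  -- an element `gOf` of the orthogonal group.
  let ψ : orthogonalGroup Q → (x : X) → (R x).IsometryEquiv Q := fun k x =>
    (e x).trans ⟨k.1, k.2⟩
  have hψ : ∀ k x m, ψ k x m = toEnd k (e x m) := fun k x m => rfl
  let Te : M ≃ₗ[K] M := LinearEquiv.ofBijective T hTi
  let gOf : orthogonalGroup Q × X → G := fun p =>
    ⟨⟨((ψ p.1 p.2).toLinearEquiv.symm.trans Te).trans (ψ p.1 p.2).toLinearEquiv, fun v => by
      have h1 := (ψ p.1 p.2).map_app (Te ((ψ p.1 p.2).toLinearEquiv.symm v))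
      have h3 := (ψ p.1 p.2).symm.map_app v
      exact h1.trans ((hT _ _).trans h3)⟩, p.2, ψ p.1 p.2, fun m => by
        change (ψ p.1 p.2).toLinearEquiv (T ((ψ p.1 p.2).toLinearEquiv.symm _)) = _
        exact congrArg (fun x => (ψ p.1 p.2).toLinearEquiv (T x))
          ((ψ p.1 p.2).toLinearEquiv.symm_apply_apply m)⟩
  have hg : ∀ p m, toEnd (gOf p).1 (ψ p.1 p.2 m) = ψ p.1 p.2 (T m) := by
    intro p m
    change (ψ p.1 p.2).toLinearEquiv (T ((ψ p.1 p.2).toLinearEquiv.symm _)) = _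
    exact congrArg (fun x => (ψ p.1 p.2).toLinearEquiv (T x))
      ((ψ p.1 p.2).toLinearEquiv.symm_apply_apply m)
  -- Every g obtained in this way receives one reference presentation φ. Another presentation ψ of
  -- the same g differs from it by z = φ⁻¹ψ, which commutes with T and carries one form of the
  -- family to another; the pair (g, z) recovers ψ.
  let y : G → X := fun g => g.2.choose
  let φ : (g : G) → (R (y g)).IsometryEquiv Q := fun g => g.2.choose_spec.choose
  have hφ : ∀ g m, toEnd g.1 (φ g m) = φ g (T m) := fun g => g.2.choose_spec.choose_spec
  let zOf : orthogonalGroup Q × X → Z := fun p =>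
    ⟨((φ (gOf p)).toLinearEquiv.symm : V →ₗ[K] M) ∘ₗ ((ψ p.1 p.2).toLinearEquiv : M →ₗ[K] V), by
      refine LinearMap.ext fun m => ?_
      apply (φ (gOf p)).toLinearEquiv.injective
      change (φ (gOf p)) ((φ (gOf p)).symm (ψ p.1 p.2 (T m))) =
        φ (gOf p) (T ((φ (gOf p)).symm (ψ p.1 p.2 m)))
      rw [← hφ, QuadraticMap.IsometryEquiv.apply_symm_apply,
        QuadraticMap.IsometryEquiv.apply_symm_apply, hg], y (gOf p), p.2, fun m => by
      change R (y (gOf p)) ((φ (gOf p)).symm (ψ p.1 p.2 m)) = _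
      rw [QuadraticMap.IsometryEquiv.map_app, QuadraticMap.IsometryEquiv.map_app]⟩
  rw [← Nat.card_prod, ← Nat.card_prod]
  refine Nat.card_le_card_of_injective (fun p => (gOf p, zOf p)) ?_
  rintro ⟨k, x⟩ ⟨k', x'⟩ heq
  have hg1 : gOf (k, x) = gOf (k', x') := congrArg Prod.fst heq
  have hz1 : zOf (k, x) = zOf (k', x') := congrArg Prod.snd heq
  have hk : ∀ m, ψ k x m = ψ k' x' m := by
    intro m
    have h1 := LinearMap.congr_fun (congrArg Subtype.val hz1) m
    change (φ (gOf (k, x))).symm (ψ k x m) = (φ (gOf (k', x'))).symm (ψ k' x' m) at h1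
    rw [hg1] at h1
    exact (φ (gOf (k', x'))).toLinearEquiv.symm.injective h1
  -- The isometry ψ determines the form on its source, hence x by injectivity of R.
  have hx : x = x' := by
    apply hR
    ext m
    rw [← (ψ k x).map_app, ← (ψ k' x').map_app, hk]
  subst hx
  congr 1
  apply toEnd_injective
  refine LinearMap.ext fun v => ?_
  have h1 := hk ((e x).symm v)
  rw [hψ, hψ, QuadraticMap.IsometryEquiv.apply_symm_apply] at h1
  exact h1

end PairCount

/-! ### Diagonal forms and endomorphisms -/

section Diagonal

variable {K : Type*} [Field K] {j : ℕ}

theorem polar_weightedSumSquares (c x y : Fin j → K) :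
    QuadraticMap.polar (QuadraticMap.weightedSumSquares K c) x y = ∑ i, 2 * c i * x i * y i := by
  simp only [QuadraticMap.polar, QuadraticMap.weightedSumSquares_apply, ← Finset.sum_sub_distrib,
    Pi.add_apply, smul_eq_mul]
  exact Finset.sum_congr rfl fun i _ => by ring

/-- The diagonal endomorphism. -/
def diagEnd (δ : Fin j → K) : Module.End K (Fin j → K) := Matrix.toLin' (Matrix.diagonal δ)

@[simp] theorem diagEnd_apply (δ x : Fin j → K) (i : Fin j) : diagEnd δ x i = δ i * x i := by
  rw [diagEnd, Matrix.toLin'_apply, Matrix.mulVec_diagonal]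

theorem charpoly_diagEnd (δ : Fin j → K) : (diagEnd δ).charpoly = ∏ i, (X - C (δ i)) := by
  rw [diagEnd, Matrix.charpoly_toLin', Matrix.charpoly_diagonal]

theorem weightedSumSquares_diagEnd (c δ x : Fin j → K) (hδ : ∀ i, δ i = 1 ∨ δ i = -1) :
    QuadraticMap.weightedSumSquares K c (diagEnd δ x) = QuadraticMap.weightedSumSquares K c x := by
  simp only [QuadraticMap.weightedSumSquares_apply, diagEnd_apply]
  refine Finset.sum_congr rfl fun i _ => ?_
  rcases hδ i with h | h <;> rw [h] <;> simp

end Diagonal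

/-! ### The discriminant of the model form -/

section DiscChar

variable {ℓ : ℕ} [Fact ℓ.Prime]

theorem nondegenerate_iff_discChar {V : Type*} [AddCommGroup V] [Module (ZMod ℓ) V]
    [FiniteDimensional (ZMod ℓ) V] (Q : QuadraticForm (ZMod ℓ) V) :
    (QuadraticMap.polarBilin Q).Nondegenerate ↔ discChar Q ≠ 0 := by
  rw [discChar, Ne, quadraticChar_eq_zero_iff]
  exact nondegenerate_iff_gram Q _

theorem discChar_weightedSumSquares {j : ℕ} (c : Fin j → ZMod ℓ) :
    discChar (QuadraticMap.weightedSumSquares (ZMod ℓ) c) =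
      quadraticChar (ZMod ℓ) (∏ i, 2 * c i) := by
  rw [discChar_eq _ (Pi.basisFun (ZMod ℓ) (Fin j)), gram_det_of_orthogonal]
  · congr 1
    refine Finset.prod_congr rfl fun i _ => ?_
    rw [QuadraticMap.weightedSumSquares_apply, Finset.sum_eq_single i] <;> simp +contextual
  · intro i k hik
    rw [polar_weightedSumSquares]
    refine Finset.sum_eq_zero fun m _ => ?_
    by_cases hm : m = i
    · subst hm; simp [hik]
    · simp [hm]

variable {L : Type*} [CommRing L] [Algebra (ZMod ℓ) L] [FiniteDimensional (ZMod ℓ) L]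

theorem det_sub_companion {n : ℕ} {h : (ZMod ℓ)[X]} {α : L}
    (hc : (companion (ZMod ℓ) α).charpoly = recip n h) (c : ZMod ℓ) :
    LinearMap.det (algebraMap (ZMod ℓ) (Module.End (ZMod ℓ) (L × L)) c - companion (ZMod ℓ) α) =
      (recip n h).eval c := by
  rw [← hc, LinearMap.eval_charpoly]

/-- For t = `companion` and s = t⁻¹, one has s - t = -s(1 - t)(-1 - t) and det t = 1, so det(s - t)
= f(1)f(-1), and `isSquare_det_mul_gram` identifies this with the Gram determinant up to squares.
The result does not involve u: all units give isometric forms. -/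
theorem discChar_modelForm (hℓ : ℓ ≠ 2) {n : ℕ} {h : (ZMod ℓ)[X]} (hm : h.Monic)
    (hn : h.natDegree = n) {α : L} (hc : (companion (ZMod ℓ) α).charpoly = recip n h)
    (τ : L →ₗ[ZMod ℓ] ZMod ℓ) (u : L)
    (h1 : (recip n h).eval 1 ≠ 0) (h3 : (recip n h).eval (-1) ≠ 0)
    (hnd : (QuadraticMap.polarBilin (modelForm τ α u)).Nondegenerate) :
    discChar (modelForm τ α u) =
      quadraticChar (ZMod ℓ) ((recip n h).eval 1 * (recip n h).eval (-1)) := by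
  have h2 := two_ne_zero_of_ne_two hℓ
  set t := companion (ZMod ℓ) α with ht
  set s := companionInv (ZMod ℓ) α with hs
  have hts : t * s = 1 := companion_mul_inv α
  have hst : s * t = 1 := companionInv_mul α
  have e0 := det_sub_companion hc 0
  have e1 := det_sub_companion hc 1
  have e3 := det_sub_companion hc (-1)
  rw [← coeff_zero_eq_eval_zero, coeff_zero_recip hm hn, map_zero, zero_sub] at e0
  rw [map_one] at e1
  rw [map_neg, map_one] at e3
  have ed : LinearMap.det (s - t) = (recip n h).eval 1 * (recip n h).eval (-1) := by
    have es : LinearMap.det (-s) = 1 := by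
      have : (-s) * (-t) = 1 := by
        refine LinearMap.ext fun p => ?_
        simpa using LinearMap.congr_fun hst p
      have := congrArg LinearMap.det this
      rwa [map_mul, e0, mul_one, map_one] at this
    have : s - t = (-s) * ((1 - t) * (-1 - t)) := by
      refine LinearMap.ext fun p => ?_
      ext <;> simp [ht, hs] <;> ring
    rw [this, map_mul, map_mul, es, e1, e3, one_mul]
  let b := Module.finBasis (ZMod ℓ) (L × L)
  have hsq := isSquare_det_mul_gram h2 (modelForm τ α u) b s t hst fun x y => by
    rw [QuadraticMap.polar_comm, ← polar_modelForm_companion, QuadraticMap.polar_comm]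
  have hg := (nondegenerate_iff_gram (modelForm τ α u) b).1 hnd
  have h13 := mul_ne_zero h1 h3
  rw [ed, ← quadraticChar_one_iff_isSquare (mul_ne_zero h13 hg), map_mul _ (_ * _)] at hsq
  rw [discChar_eq _ b]
  rcases quadraticChar_dichotomy h13 with h | h <;> rw [h] at hsq ⊢ <;> linarith

end DiscChar

/-! ### The model isometry and its commutant -/

section Count

variable {ℓ : ℕ} [Fact ℓ.Prime]

/-- The automorphism with characteristic polynomial `recip n h * ∏ (X - δ i)`. -/
def modelEnd (h : (ZMod ℓ)[X]) {j : ℕ} (δ : Fin j → ZMod ℓ) :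
    Module.End (ZMod ℓ) ((AdjoinRoot h × AdjoinRoot h) × (Fin j → ZMod ℓ)) :=
  (companion (ZMod ℓ) (AdjoinRoot.root h)).prodMap (diagEnd δ)

/-- The quadratic form preserved by `modelEnd`. -/
def modelFormSum {h : (ZMod ℓ)[X]} (hm : h.Monic) {j : ℕ} (c : Fin j → ZMod ℓ)
    (u : (AdjoinRoot h)ˣ) :
    QuadraticForm (ZMod ℓ) ((AdjoinRoot h × AdjoinRoot h) × (Fin j → ZMod ℓ)) :=
  (modelForm (topCoeff hm) (AdjoinRoot.root h) u).prod (QuadraticMap.weightedSumSquares (ZMod ℓ) c)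

theorem charpoly_companion_root {h : (ZMod ℓ)[X]} [FiniteDimensional (ZMod ℓ) (AdjoinRoot h)]
    (hm : h.Monic) :
    (companion (ZMod ℓ) (AdjoinRoot.root h)).charpoly = recip h.natDegree h :=
  charpoly_companion hm rfl (finrank_adjoinRoot hm)
    (by rw [AdjoinRoot.aeval_eq, AdjoinRoot.mk_self]) (exists_aeval_root_eq hm)

/-- No δ i is an eigenvalue of the companion part, so a commuting z preserves both summands. On L ×
L it is determined by the image of the cyclic vector (1, 0), with ℓ^(2n) possibilities for n = deg
h; on the diagonal part it preserves each of the j distinct eigenlines, and it acts there by ±1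
because the two forms have the same coefficients c. -/
theorem card_commutant_le {h : (ZMod ℓ)[X]} (hm : h.Monic)
    (h1 : (recip h.natDegree h).eval 1 ≠ 0) (h3 : (recip h.natDegree h).eval (-1) ≠ 0)
    {j : ℕ} {δ c : Fin j → ZMod ℓ} (hδ : ∀ i, δ i = 1 ∨ δ i = -1) (hδi : Function.Injective δ)
    (hc : ∀ i, c i ≠ 0) :
    Nat.card {z : Module.End (ZMod ℓ) ((AdjoinRoot h × AdjoinRoot h) × (Fin j → ZMod ℓ)) //
      z * modelEnd h δ = modelEnd h δ * z ∧
        ∃ x x', ∀ m, modelFormSum hm c x (z m) = modelFormSum hm c x' m} ≤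
      ℓ ^ (2 * h.natDegree) * 2 ^ j := by
  classical
  have : FiniteDimensional (ZMod ℓ) (AdjoinRoot h) := (AdjoinRoot.powerBasis' hm).finite
  have : Finite (AdjoinRoot h) := Module.finite_of_finite (ZMod ℓ)
  set α := AdjoinRoot.root h
  set t := companion (ZMod ℓ) α with ht
  have hcp := charpoly_companion_root hm
  have hinj : ∀ i (p : AdjoinRoot h × AdjoinRoot h), t p = δ i • p → p = 0 := by
    intro i p hp
    have hdet := det_sub_companion hcp (δ i)
    have hne : (recip h.natDegree h).eval (δ i) ≠ 0 := by
      rcases hδ i with h | h <;> rw [h] <;> assumption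
    rw [← hdet] at hne
    have hker := LinearMap.ker_eq_bot'.1 (LinearMap.ker_eq_bot.2 ((Module.End.isUnit_iff _).1
      ((LinearMap.isUnit_iff_isUnit_det _).2 (isUnit_iff_ne_zero.2 hne))).1)
    exact hker p (by rw [LinearMap.sub_apply, Module.algebraMap_end_apply, ← ht, hp, sub_self])
  have hsurj : ∀ i (p : AdjoinRoot h × AdjoinRoot h), ∃ q, δ i • q - t q = p := by
    intro i p
    have hi : Function.Injective (algebraMap (ZMod ℓ) (Module.End (ZMod ℓ)
        (AdjoinRoot h × AdjoinRoot h)) (δ i) - t) := by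
      rw [← LinearMap.ker_eq_bot, LinearMap.ker_eq_bot']
      intro q hq
      refine hinj i q ?_
      rw [LinearMap.sub_apply, Module.algebraMap_end_apply, sub_eq_zero] at hq
      exact hq.symm
    obtain ⟨q, hq⟩ := (LinearMap.injective_iff_surjective.1 hi) p
    exact ⟨q, by rwa [LinearMap.sub_apply, Module.algebraMap_end_apply] at hq⟩
  set Z := {z : Module.End (ZMod ℓ) ((AdjoinRoot h × AdjoinRoot h) × (Fin j → ZMod ℓ)) //
      z * modelEnd h δ = modelEnd h δ * z ∧
        ∃ x x', ∀ m, modelFormSum hm c x (z m) = modelFormSum hm c x' m}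
  have hcomm : ∀ (z : Z) p w, z.1 (t p, diagEnd δ w) =
      (t (z.1 (p, w)).1, diagEnd δ (z.1 (p, w)).2) := fun z p w =>
    LinearMap.congr_fun z.2.1 (p, w)
  have hE : ∀ (z : Z) p, (z.1 (p, 0)).2 = 0 := by
    intro z p
    funext i
    obtain ⟨q, rfl⟩ := hsurj i p
    have e := hcomm z q 0
    rw [map_zero] at e
    have : (δ i • q - t q, (0 : Fin j → ZMod ℓ)) = δ i • (q, (0 : Fin j → ZMod ℓ)) - (t q, 0) := by
      ext <;> simp
    rw [this, map_sub, map_smul, e]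
    simp
  have hW1 : ∀ (z : Z) i, (z.1 (0, Pi.single i 1)).1 = 0 := by
    intro z i
    refine hinj i _ ?_
    have e := congrArg Prod.fst (hcomm z 0 (Pi.single i 1))
    have : diagEnd δ (Pi.single i 1) = δ i • Pi.single i 1 := by
      ext k
      by_cases hk : k = i
      · subst hk; simp
      · simp [hk]
    have h5 : ((0 : AdjoinRoot h × AdjoinRoot h), δ i • (Pi.single i 1 : Fin j → ZMod ℓ)) =
        δ i • (0, Pi.single i 1) := by ext <;> simp
    rw [map_zero, this, h5, map_smul] at e
    exact e.symm
  have hW2 : ∀ (z : Z) i k, k ≠ i → (z.1 (0, Pi.single i 1)).2 k = 0 := by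
    intro z i k hk
    have e := congrFun (congrArg Prod.snd (hcomm z 0 (Pi.single i 1))) k
    have : diagEnd δ (Pi.single i 1) = δ i • Pi.single i 1 := by
      ext k
      by_cases hk : k = i
      · subst hk; simp
      · simp [hk]
    have h5 : ((0 : AdjoinRoot h × AdjoinRoot h), δ i • (Pi.single i 1 : Fin j → ZMod ℓ)) =
        δ i • (0, Pi.single i 1) := by ext <;> simp
    rw [map_zero, this, h5, map_smul] at e
    dsimp only at e
    rw [diagEnd_apply] at e
    have e' : (δ i - δ k) * (z.1 (0, Pi.single i 1)).2 k = 0 := by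
      rw [sub_mul, sub_eq_zero]; simpa using e
    exact (mul_eq_zero.1 e').resolve_left (sub_ne_zero.2 fun h => hk (hδi h).symm)
  have hsq : ∀ (z : Z) i, (z.1 (0, Pi.single i 1)).2 i = 1 ∨
      (z.1 (0, Pi.single i 1)).2 i = -1 := by
    intro z i
    obtain ⟨x, x', hx⟩ := z.2.2
    have e := hx (0, Pi.single i 1)
    have hs : ∀ w : Fin j → ZMod ℓ, (∀ k, k ≠ i → w k = 0) →
        QuadraticMap.weightedSumSquares (ZMod ℓ) c w = c i * (w i * w i) := by
      intro w hw
      rw [QuadraticMap.weightedSumSquares_apply, Finset.sum_eq_single i]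
      · rfl
      · intro k _ hk; simp [hw k hk]
      · simp
    rw [modelFormSum, modelFormSum, QuadraticMap.prod_apply, QuadraticMap.prod_apply, hW1,
      hs _ (hW2 z i), hs _ (fun k hk => by simp [hk])] at e
    simp only [map_zero, zero_add, Pi.single_eq_same, mul_one] at e
    rw [← mul_self_eq_one_iff]
    exact mul_left_cancel₀ (hc i) (e.trans (mul_one _).symm)
  let Ψ : Z → (AdjoinRoot h × AdjoinRoot h) × (Fin j → Bool) := fun z =>
    ((z.1 ((1, 0), 0)).1, fun i => decide ((z.1 (0, Pi.single i 1)).2 i = 1))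
  have hΨ : Function.Injective Ψ := by
    intro z z' he
    have he1 : (z.1 ((1, 0), 0)).1 = (z'.1 ((1, 0), 0)).1 := by
      have := congrArg Prod.fst he
      exact this
    have he2 : ∀ i, (z.1 (0, Pi.single i 1)).2 i = 1 ↔ (z'.1 (0, Pi.single i 1)).2 i = 1 := by
      intro i
      have := congrFun (congrArg Prod.snd he) i
      simpa [Ψ] using this
    have hz0 : z.1 ((1, 0), 0) = z'.1 ((1, 0), 0) := Prod.ext he1 (by rw [hE, hE])
    have hpow : ∀ (z : Z) (P : (ZMod ℓ)[X]) p, z.1 (aeval t P p, 0) =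
        (aeval t P (z.1 (p, 0)).1, 0) := by
      intro z P
      induction P using Polynomial.induction_on' with
      | add P R hP hR =>
        intro p
        have : (aeval t (P + R) p, (0 : Fin j → ZMod ℓ)) = (aeval t P p, 0) + (aeval t R p, 0) := by
          simp
        rw [this, map_add, hP, hR]
        simp
      | monomial k a =>
        intro p
        have hk : ∀ k : ℕ, ∀ p, z.1 ((t ^ k) p, 0) = ((t ^ k) (z.1 (p, 0)).1, 0) := by
          intro k
          induction k with
          | zero => intro p; exact Prod.ext rfl (hE z p)
          | succ k ih =>
            intro p
            have e := hcomm z p 0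
            rw [map_zero] at e
            rw [pow_succ, Module.End.mul_apply, ih, e, Module.End.mul_apply]
        have : (aeval t (monomial k a) p, (0 : Fin j → ZMod ℓ)) = a • ((t ^ k) p, 0) := by
          simp [aeval_monomial, Module.algebraMap_end_apply]
        rw [this, map_smul, hk]
        simp [aeval_monomial, Module.algebraMap_end_apply]
    apply Subtype.ext
    refine LinearMap.ext fun m => ?_
    obtain ⟨p, w⟩ := m
    have hp : z.1 (p, 0) = z'.1 (p, 0) := by
      obtain ⟨P, rfl⟩ := exists_aeval_companion (exists_aeval_root_eq hm) p
      rw [← ht, hpow, hpow, hz0]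
    have hw : ∀ i, z.1 (0, Pi.single i 1) = z'.1 (0, Pi.single i 1) := by
      intro i
      refine Prod.ext (by rw [hW1, hW1]) ?_
      funext k
      by_cases hk : k = i
      · subst hk
        rcases hsq z k with h | h
        · rw [h, (he2 k).1 h]
        · rcases hsq z' k with h' | h'
          · rw [h', (he2 k).2 h']
          · rw [h, h']
      · rw [hW2 z i k hk, hW2 z' i k hk]
    have hdecomp : ((p, w) : (AdjoinRoot h × AdjoinRoot h) × (Fin j → ZMod ℓ)) =
        (p, 0) + ∑ i, w i • (0, Pi.single i 1) := by
      refine Prod.ext ?_ ?_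
      · simp [Prod.fst_sum]
      · funext k
        simp [Prod.snd_sum, Finset.sum_apply, Pi.single_apply]
    rw [hdecomp, map_add, map_add, hp, map_sum, map_sum]
    congr 1
    exact Finset.sum_congr rfl fun i _ => by rw [map_smul, map_smul, hw]
  refine (Nat.card_le_card_of_injective Ψ hΨ).trans (le_of_eq ?_)
  rw [Nat.card_prod, Nat.card_prod, Module.natCard_eq_pow_finrank (K := ZMod ℓ) (V := AdjoinRoot h),
    finrank_adjoinRoot hm, Nat.card_zmod, two_mul, pow_add]
  simp

end Count

/-! ### Transport of reflections along an isometry -/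

section ReflectionTransport

variable {K V M : Type*} [Field K] [AddCommGroup V] [Module K V] [AddCommGroup M] [Module K M]

theorem reflectionAt_isometryEquiv {R : QuadraticForm K M} {Q : QuadraticForm K V}
    (ψ : R.IsometryEquiv Q) (v m : M) :
    reflectionAt Q (ψ v) (ψ m) = ψ (reflectionAt R v m) := by
  have hp : QuadraticMap.polar Q (ψ v) (ψ m) = QuadraticMap.polar R v m := by
    simp only [QuadraticMap.polar, ← map_add, QuadraticMap.IsometryEquiv.map_app]
  rw [reflectionAt_apply, reflectionAt_apply, map_sub, map_smul, hp,
    QuadraticMap.IsometryEquiv.map_app]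

end ReflectionTransport

/-! ### Spinor norm and number of the isometries conjugate to the model -/

section Count

variable {ℓ : ℕ} [Fact ℓ.Prime] {V : Type*} [AddCommGroup V] [Module (ZMod ℓ) V]
  [FiniteDimensional (ZMod ℓ) V] {Q : QuadraticForm (ZMod ℓ) V}

/-- The spinor norm of an isometry which is conjugate to `modelEnd`. -/
theorem spinorNorm_of_conj (hℓ : ℓ ≠ 2) (hQ : (QuadraticMap.polarBilin Q).Nondegenerate)
    {E : Type*} [AddCommGroup E] [Module (ZMod ℓ) E] [FiniteDimensional (ZMod ℓ) E] {n j : ℕ}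
    {RE : QuadraticForm (ZMod ℓ) E} {t : Module.End (ZMod ℓ) E} {f : (ZMod ℓ)[X]}
    (hE : Module.finrank (ZMod ℓ) E = 2 * n) (ht : t.charpoly = f) (hf0 : LinearMap.det t = 1)
    (hf : f.eval (-1) ≠ 0)
    {δ c : Fin j → ZMod ℓ} (hδ : ∀ i, δ i = 1 ∨ δ i = -1) (hδi : Function.Injective δ)
    (hc : ∀ i, c i ≠ 0)
    {R : QuadraticForm (ZMod ℓ) (E × (Fin j → ZMod ℓ))}
    (hR : R = RE.prod (QuadraticMap.weightedSumSquares (ZMod ℓ) c)) (ψ : R.IsometryEquiv Q)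
    (g : orthogonalGroup Q) (hg : ∀ m, toEnd g (ψ m) = ψ (t.prodMap (diagEnd δ) m)) :
    ((spinorNorm Q g : ℤˣ) : ℤ) = quadraticChar (ZMod ℓ) (f.eval (-1)) *
      ∏ i ∈ Finset.univ.filter (fun i => δ i = -1), quadraticChar (ZMod ℓ) (c i) := by
  classical
  have h2 := two_ne_zero_of_ne_two hℓ
  obtain ⟨l, hl, hgl⟩ := exists_reflections h2 hQ g
  -- Zassenhaus' formula requires that -1 not be an eigenvalue. Since δ is injective and f(-1) is
  -- nonzero, that eigenspace is at most a line; the reflection in it removes the eigenvalue and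
  -- accounts for the factor χ(c i).
  have main : ∃ l₀ : List V, (∀ v ∈ l₀, Q v ≠ 0) ∧
      quadraticChar (ZMod ℓ) (l₀.map Q).prod =
        ∏ i ∈ Finset.univ.filter (fun i => δ i = -1), quadraticChar (ZMod ℓ) (c i) ∧
      ∀ m, (l₀.map (reflectionAt Q)).prod (toEnd g (ψ m)) = ψ (t.prodMap LinearMap.id m) := by
    by_cases hex : ∃ i₀, δ i₀ = -1
    · obtain ⟨i₀, hi₀⟩ := hex
      have hfil : Finset.univ.filter (fun i => δ i = -1) = {i₀} := by
        ext i
        simp only [Finset.mem_filter, Finset.mem_univ, true_and, Finset.mem_singleton]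
        exact ⟨fun h => hδi (h.trans hi₀.symm), fun h => h ▸ hi₀⟩
      have hRe : R (0, Pi.single i₀ 1) = c i₀ := by
        rw [hR, QuadraticMap.prod_apply, map_zero, zero_add,
          QuadraticMap.weightedSumSquares_apply, Finset.sum_eq_single i₀] <;> simp +contextual
      have hpol : ∀ m, QuadraticMap.polar R (0, Pi.single i₀ 1) m = 2 * c i₀ * m.2 i₀ := by
        intro m
        rw [hR, QuadraticMap.polar_prod, QuadraticMap.polar_zero_left, zero_add,
          polar_weightedSumSquares, Finset.sum_eq_single i₀] <;> simp +contextual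
      refine ⟨[ψ (0, Pi.single i₀ 1)], ?_, ?_, fun m => ?_⟩
      · simp only [List.mem_singleton, forall_eq]
        rw [QuadraticMap.IsometryEquiv.map_app, hRe]
        exact hc i₀
      · rw [hfil, Finset.prod_singleton, List.map_singleton, List.prod_singleton,
          QuadraticMap.IsometryEquiv.map_app, hRe]
      · rw [List.map_singleton, List.prod_singleton, hg, reflectionAt_isometryEquiv,
          reflectionAt_apply, hpol, hRe]
        congr 1
        refine Prod.ext ?_ ?_
        · simp
        · funext i
          by_cases hi : i = i₀
          · subst hi
            have := hc i
            simp [hi₀]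
            field_simp
            ring
          · have h1 : δ i = 1 := (hδ i).resolve_right fun h => hi (hδi (h.trans hi₀.symm))
            simp [hi, h1]
    · push Not at hex
      refine ⟨[], by simp, ?_, fun m => ?_⟩
      · rw [Finset.filter_false_of_mem fun i _ => hex i]
        simp
      · rw [List.map_nil, List.prod_nil, Module.End.one_apply, hg]
        congr 1
        refine Prod.ext rfl ?_
        funext i
        simp [(hδ i).resolve_right (hex i)]
  obtain ⟨l₀, hl₀, hχ, hfix⟩ := main
  have hmem : ∀ v ∈ l₀ ++ l, Q v ≠ 0 := by
    intro v hv
    rcases List.mem_append.1 hv with hv | hv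
    exacts [hl₀ v hv, hl v hv]
  set g' := ((l₀ ++ l).map (reflectionAt Q)).prod with hg'
  have hg'ψ : ∀ m, g' (ψ m) = ψ (t.prodMap LinearMap.id m) := by
    intro m
    rw [hg', List.map_append, List.prod_append, ← hgl, Module.End.mul_apply, hfix]
  let e := ψ.toLinearEquiv
  have hconj : g' = (e : E × (Fin j → ZMod ℓ) →ₗ[ZMod ℓ] V) ∘ₗ (t.prodMap LinearMap.id) ∘ₗ
      (e.symm : V →ₗ[ZMod ℓ] E × (Fin j → ZMod ℓ)) := by
    refine LinearMap.ext fun v => ?_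
    have := hg'ψ (e.symm v)
    have h1 : ψ (e.symm v) = v := e.apply_symm_apply v
    rw [h1] at this
    exact this
  have hconj1 : 1 + g' = (e : E × (Fin j → ZMod ℓ) →ₗ[ZMod ℓ] V) ∘ₗ ((1 + t).prodMap (2 • LinearMap.id)) ∘ₗ
      (e.symm : V →ₗ[ZMod ℓ] E × (Fin j → ZMod ℓ)) := by
    refine LinearMap.ext fun v => ?_
    obtain ⟨m, rfl⟩ := e.surjective v
    rw [LinearMap.add_apply, hconj]
    simp only [LinearMap.comp_apply, LinearEquiv.coe_coe, LinearEquiv.symm_apply_apply,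
      Module.End.one_apply]
    rw [← map_add]
    congr 1
    refine Prod.ext ?_ ?_
    · simp
    · simp [two_smul]
  have hd1 : LinearMap.det g' = 1 := by
    rw [hconj, LinearMap.det_conj, LinearMap.det_prodMap, hf0]
    simp
  have ht1 : LinearMap.det (1 + t) = f.eval (-1) := by
    rw [← ht, LinearMap.eval_charpoly, map_neg, map_one]
    have : (-1 - t) = (-1 : ZMod ℓ) • (1 + t) := by module
    rw [this, LinearMap.det_smul, hE]
    simp
  have hd2 : LinearMap.det (1 + g') = f.eval (-1) * 2 ^ j := by
    rw [hconj1, LinearMap.det_conj, LinearMap.det_prodMap, ht1]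
    congr 1
    rw [← Nat.cast_smul_eq_nsmul (ZMod ℓ), LinearMap.det_smul]
    simp
  have hN : Module.finrank (ZMod ℓ) V = 2 * n + j := by
    rw [← e.finrank_eq, Module.finrank_prod, hE]
    simp
  have key := quadraticChar_prod_eq hℓ hmem hd1 (by
    rw [hd2]; exact mul_ne_zero hf (pow_ne_zero _ h2))
  -- With dimension 2n + j and det(1 + g') = f(-1) 2^j, the powers of 2 combine into a square.
  have e2 : (2 : ZMod ℓ) ^ Module.finrank (ZMod ℓ) V * LinearMap.det (1 + g') =
      (2 ^ (n + j)) ^ 2 * f.eval (-1) := by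
    rw [hd2, hN]; ring
  rw [← hg', e2, map_mul, quadraticChar_sq_one' (pow_ne_zero _ h2), one_mul, List.map_append,
    List.prod_append, map_mul, hχ] at key
  rw [spinorNorm_eq hℓ hl hgl, ← key]
  set P := ∏ i ∈ Finset.univ.filter (fun i => δ i = -1), quadraticChar (ZMod ℓ) (c i)
  have hP : P * P = 1 := by
    rw [← hχ, ← sq, quadraticChar_sq_one (list_prod_map_ne_zero hl₀)]
  linear_combination (-quadraticChar (ZMod ℓ) (l.map Q).prod) * hP

/-- Lower bound for the number of isometries with a given characteristic polynomial. -/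
theorem card_mul_card_units_le (hℓ : ℓ ≠ 2) (hQ : (QuadraticMap.polarBilin Q).Nondegenerate)
    {h : (ZMod ℓ)[X]} (hm : h.Monic) {n j : ℕ} (hn : h.natDegree = n)
    (hN : Module.finrank (ZMod ℓ) V = 2 * n + j)
    (h1 : (recip n h).eval 1 ≠ 0) (h3 : (recip n h).eval (-1) ≠ 0)
    {δ c : Fin j → ZMod ℓ} (hδ : ∀ i, δ i = 1 ∨ δ i = -1) (hδi : Function.Injective δ)
    (hc : ∀ i, c i ≠ 0)
    (hdisc : discChar Q = quadraticChar (ZMod ℓ)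
      ((recip n h).eval 1 * (recip n h).eval (-1) * ∏ i, 2 * c i)) :
    Nat.card (orthogonalGroup Q) * Nat.card (AdjoinRoot h)ˣ ≤
      Nat.card {g : orthogonalGroup Q //
        (toEnd g).charpoly = recip n h * ∏ i, (X - C (δ i)) ∧
        ((spinorNorm Q g : ℤˣ) : ℤ) = quadraticChar (ZMod ℓ) ((recip n h).eval (-1)) *
          ∏ i ∈ Finset.univ.filter (fun i => δ i = -1), quadraticChar (ZMod ℓ) (c i)} *
      (ℓ ^ (2 * n) * 2 ^ j) := by
  classical
  subst hn
  set n := h.natDegree with hn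
  have h2 := two_ne_zero_of_ne_two hℓ
  have : FiniteDimensional (ZMod ℓ) (AdjoinRoot h) := (AdjoinRoot.powerBasis' hm).finite
  have : Finite (AdjoinRoot h) := Module.finite_of_finite (ZMod ℓ)
  have : Finite V := Module.finite_of_finite (ZMod ℓ)
  have : Finite (V ≃ₗ[ZMod ℓ] V) := DFunLike.finite _
  have hcp := charpoly_companion_root hm
  have hα : IsUnit (AdjoinRoot.root h ^ 2 - 4) := by
    refine isUnit_sq_sub_four (h := h) (by rw [AdjoinRoot.aeval_eq, AdjoinRoot.mk_self]) ?_ ?_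
    · rwa [eval_one_recip le_rfl] at h1
    · rw [eval_neg_one_recip le_rfl] at h3
      exact right_ne_zero_of_mul h3
  have hτ := topCoeff_nondegenerate hm
  have hnd : ∀ u : (AdjoinRoot h)ˣ, (QuadraticMap.polarBilin
      (modelForm (topCoeff hm) (AdjoinRoot.root h) (u : AdjoinRoot h))).Nondegenerate :=
    fun u => modelForm_nondegenerate hτ u.isUnit hα
  -- The discriminant agrees with that of Q for every unit u, so the double counting runs over the
  -- whole group of units.
  have hdm : ∀ u, discChar (modelFormSum hm c u) = discChar Q := by
    intro u
    rw [modelFormSum, discChar_prod, discChar_modelForm hℓ hm hn.symm hcp _ _ h1 h3 (hnd u),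
      discChar_weightedSumSquares, ← map_mul, hdisc]
  have hequiv : ∀ u, Nonempty ((modelFormSum hm c u).IsometryEquiv Q) := by
    intro u
    refine equivalent_of_discChar_eq hℓ ?_ hQ ?_ (hdm u)
    · rw [nondegenerate_iff_discChar, hdm]
      exact discChar_ne_zero hQ
    · rw [hN, Module.finrank_prod, Module.finrank_prod, finrank_adjoinRoot hm]
      simp [two_mul, hn]
  have hinj : Function.Injective (modelFormSum hm c) := by
    intro u v huv
    apply Units.ext
    refine modelForm_injective hτ h2 (α := AdjoinRoot.root h) ?_
    ext p
    have := congrArg (fun R => R (p, 0)) huv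
    simpa [modelFormSum] using this
  have hbij : Function.Bijective (modelEnd h δ) := by
    have hc1 : Function.Bijective (companion (ZMod ℓ) (AdjoinRoot.root h)) :=
      (Module.End.isUnit_iff _).1 (IsUnit.of_mul_eq_one _ (companion_mul_inv _))
    have hd1 : Function.Bijective (diagEnd δ) := by
      refine (Module.End.isUnit_iff _).1 (IsUnit.of_mul_eq_one (diagEnd δ) ?_)
      refine LinearMap.ext fun x => ?_
      funext i
      rcases hδ i with h | h <;> simp [h]
    exact hc1.prodMap hd1
  have hpres : ∀ u m, modelFormSum hm c u (modelEnd h δ m) = modelFormSum hm c u m := by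
    rintro u ⟨p, w⟩
    rw [modelFormSum, modelEnd, LinearMap.prodMap_apply, QuadraticMap.prod_apply,
      QuadraticMap.prod_apply, modelForm_companion, weightedSumSquares_diagEnd _ _ _ hδ]
  refine (card_orthogonalGroup_mul_le Q (modelEnd h δ) (modelFormSum hm c) hinj hpres hbij
    fun u => (hequiv u).some).trans ?_
  refine Nat.mul_le_mul ?_ (card_commutant_le hm h1 h3 hδ hδi hc)
  have hdt : LinearMap.det (companion (ZMod ℓ) (AdjoinRoot.root h)) = 1 := by
    have e0 := det_sub_companion hcp 0
    rw [← coeff_zero_eq_eval_zero, coeff_zero_recip hm hn.symm, map_zero, zero_sub] at e0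
    have : -companion (ZMod ℓ) (AdjoinRoot.root h) =
      (-1 : ZMod ℓ) • companion (ZMod ℓ) (AdjoinRoot.root h) := by module
    rw [this, LinearMap.det_smul, Module.finrank_prod, finrank_adjoinRoot hm, ← two_mul] at e0
    simpa using e0
  refine Nat.card_le_card_of_injective (fun g => ⟨g.1, ?_⟩) fun g g' hgg => ?_
  · obtain ⟨g, u, ψ, hψ⟩ := g
    refine ⟨?_, ?_⟩
    · have : toEnd g = ψ.toLinearEquiv.conj (modelEnd h δ) := by
        refine LinearMap.ext fun v => ?_
        obtain ⟨m, rfl⟩ := ψ.toLinearEquiv.surjective v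
        rw [LinearEquiv.conj_apply_apply, LinearEquiv.symm_apply_apply]
        exact hψ m
      rw [this, LinearEquiv.charpoly_conj, modelEnd, LinearMap.charpoly_prodMap, hcp,
        charpoly_diagEnd]
    · refine spinorNorm_of_conj hℓ hQ (n := n) ?_ hcp hdt h3 hδ hδi hc rfl ψ g hψ
      rw [Module.finrank_prod, finrank_adjoinRoot hm, two_mul]
  · exact Subtype.ext (congrArg (fun x => x.1) hgg)

end Count

/-! ### Square classes of the values h(2) and h(-2) -/

section TraceClass

variable {ℓ : ℕ} [Fact ℓ.Prime]

/-- The quadratic characters of the values of `h` at `2` and `-2`. -/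
def HasClass (η : ℤˣ × ℤˣ) (h : (ZMod ℓ)[X]) : Prop :=
  quadraticChar (ZMod ℓ) (h.eval 2) = (η.1 : ℤ) ∧ quadraticChar (ZMod ℓ) (h.eval (-2)) = (η.2 : ℤ)

theorem HasClass.mul {η θ : ℤˣ × ℤˣ} {h k : (ZMod ℓ)[X]} (hh : HasClass η h) (hk : HasClass θ k) :
    HasClass (η * θ) (h * k) := by
  constructor
  · rw [eval_mul, map_mul, hh.1, hk.1]; simp
  · rw [eval_mul, map_mul, hh.2, hk.2]; simp

theorem HasClass.eval_ne_zero {η : ℤˣ × ℤˣ} {h : (ZMod ℓ)[X]} (hh : HasClass η h) :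
    h.eval 2 ≠ 0 ∧ h.eval (-2) ≠ 0 := by
  constructor
  · intro h0
    have := hh.1
    rw [h0, MulChar.map_zero] at this
    exact η.1.ne_zero this.symm
  · intro h0
    have := hh.2
    rw [h0, MulChar.map_zero] at this
    exact η.2.ne_zero this.symm

theorem HasClass.unique {η θ : ℤˣ × ℤˣ} {h : (ZMod ℓ)[X]} (hh : HasClass η h)
    (hk : HasClass θ h) : η = θ :=
  Prod.ext (Units.ext (hh.1.symm.trans hk.1)) (Units.ext (hh.2.symm.trans hk.2))

theorem exists_units_eq_quadraticChar {a : ZMod ℓ} (ha : a ≠ 0) :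
    ∃ u : ℤˣ, quadraticChar (ZMod ℓ) a = (u : ℤ) := by
  rcases quadraticChar_dichotomy ha with h | h
  · exact ⟨1, by simp [h]⟩
  · exact ⟨-1, by simp [h]⟩

theorem exists_quadraticChar_eq (hℓ : ℓ ≠ 2) (u : ℤˣ) :
    ∃ a : ZMod ℓ, a ≠ 0 ∧ quadraticChar (ZMod ℓ) a = (u : ℤ) := by
  rcases Int.units_eq_one_or u with rfl | rfl
  · exact ⟨1, one_ne_zero, by simp⟩
  · obtain ⟨a, ha⟩ := quadraticChar_exists_neg_one (F := ZMod ℓ) (by rwa [ZMod.ringChar_zmod_n])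
    refine ⟨a, ?_, by simp [ha]⟩
    rintro rfl
    simp at ha

theorem exists_hasClass {h : (ZMod ℓ)[X]} (h1 : h.eval 2 ≠ 0) (h2 : h.eval (-2) ≠ 0) :
    ∃ η, HasClass η h := by
  obtain ⟨u, hu⟩ := exists_units_eq_quadraticChar h1
  obtain ⟨v, hv⟩ := exists_units_eq_quadraticChar h2
  exact ⟨(u, v), hu, hv⟩

end TraceClass

/-! ### Reduced characteristic polynomials of the counted isometries -/

section RedCharpoly

variable {ℓ : ℕ} [Fact ℓ.Prime] {V : Type*} [AddCommGroup V] [Module (ZMod ℓ) V]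
  [FiniteDimensional (ZMod ℓ) V]

theorem reverse_X_sub_C {K : Type*} [Field K] (a : K) : (X - C a : K[X]).reverse = 1 - C a * X := by
  have h1 : (X : K[X]).reverse = 1 := by
    have := reverse_mul_X (1 : K[X])
    rwa [one_mul, ← C_1, reverse_C] at this
  rw [sub_eq_add_neg, ← C_neg, reverse_add_C, natDegree_X, pow_one, h1, C_neg, neg_mul,
    ← sub_eq_add_neg]

theorem revCharpoly_eq {g : Module.End (ZMod ℓ) V} {n j : ℕ} {h : (ZMod ℓ)[X]} (hm : h.Monic)
    (hn : h.natDegree = n) {δ : Fin j → ZMod ℓ}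
    (hg : g.charpoly = recip n h * ∏ i, (X - C (δ i))) :
    revCharpoly g = recip n h * ∏ i, (1 - C (δ i) * X) := by
  rw [revCharpoly, hg, reverse_mul_of_domain, reverse_recip hm hn]
  congr 1
  have : ∀ s : Finset (Fin j), (∏ i ∈ s, (X - C (δ i))).reverse = ∏ i ∈ s, (1 - C (δ i) * X) := by
    intro s
    induction s using Finset.induction_on with
    | empty => rw [Finset.prod_empty, Finset.prod_empty, ← C_1, reverse_C]
    | insert i s hi ih => rw [Finset.prod_insert hi, Finset.prod_insert hi, reverse_mul_of_domain,
        ih, reverse_X_sub_C]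
  exact this _

theorem det_eq_of_charpoly {g : Module.End (ZMod ℓ) V} {n j : ℕ} {h : (ZMod ℓ)[X]} (hm : h.Monic)
    (hn : h.natDegree = n) (hN : Module.finrank (ZMod ℓ) V = 2 * n + j) {δ : Fin j → ZMod ℓ}
    (hg : g.charpoly = recip n h * ∏ i, (X - C (δ i))) : LinearMap.det g = ∏ i, δ i := by
  have h1 := LinearMap.eval_charpoly g 0
  rw [hg, eval_mul, ← coeff_zero_eq_eval_zero, coeff_zero_recip hm hn, eval_prod, map_zero,
    zero_sub] at h1
  have : -g = (-1 : ZMod ℓ) • g := by module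
  rw [this, LinearMap.det_smul, hN, pow_add, pow_mul] at h1
  simp only [eval_sub, eval_X, eval_C, zero_sub, Finset.prod_neg, Finset.card_univ,
    Fintype.card_fin, neg_one_sq, one_pow, one_mul] at h1
  exact (mul_left_cancel₀ (pow_ne_zero _ (neg_ne_zero.2 one_ne_zero)) h1).symm

theorem one_sub_C_mul_X_ne_zero {K : Type*} [Field K] (a : K) : (1 - C a * X : K[X]) ≠ 0 := by
  intro h
  have := congrArg (eval 0) h
  simp at this

theorem redCharpoly_eq_of_even {g : Module.End (ZMod ℓ) V} {n : ℕ} (hℓ : ℓ ≠ 2) {h : (ZMod ℓ)[X]}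
    (hm : h.Monic) (hn : h.natDegree = n) (hN : Module.finrank (ZMod ℓ) V = 2 * n + 0)
    {δ : Fin 0 → ZMod ℓ} (hg : g.charpoly = recip n h * ∏ i, (X - C (δ i))) :
    LinearMap.det g = 1 ∧ redCharpoly g = recip n h := by
  have h1 := det_eq_of_charpoly hm hn hN hg
  have h2 := revCharpoly_eq hm hn hg
  rw [Fin.prod_univ_zero] at h1 h2
  refine ⟨h1, ?_⟩
  have : (1 : ZMod ℓ) ≠ -1 := by
    intro h
    exact two_ne_zero_of_ne_two hℓ (by linear_combination h)
  rw [redCharpoly, if_neg, if_neg, h2, mul_one]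
  · rwa [h1]
  · rw [hN]; simp

theorem redCharpoly_eq_of_odd {g : Module.End (ZMod ℓ) V} {n : ℕ} {h : (ZMod ℓ)[X]}
    (hm : h.Monic) (hn : h.natDegree = n) (hN : Module.finrank (ZMod ℓ) V = 2 * n + 1)
    {δ : Fin 1 → ZMod ℓ} (hg : g.charpoly = recip n h * ∏ i, (X - C (δ i))) :
    LinearMap.det g = δ 0 ∧ redCharpoly g = recip n h := by
  have h1 := det_eq_of_charpoly hm hn hN hg
  have h2 := revCharpoly_eq hm hn hg
  rw [Fin.prod_univ_one] at h1 h2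
  refine ⟨h1, ?_⟩
  rw [redCharpoly, if_pos, h2, h1, mul_div_cancel_right₀ _ (one_sub_C_mul_X_ne_zero _)]
  rw [hN]; simp

theorem redCharpoly_eq_of_even_neg {g : Module.End (ZMod ℓ) V} {n : ℕ} {h : (ZMod ℓ)[X]}
    (hm : h.Monic) (hn : h.natDegree = n) (hN : Module.finrank (ZMod ℓ) V = 2 * n + 2)
    (hg : g.charpoly = recip n h * ∏ i, (X - C ((![1, -1] : Fin 2 → ZMod ℓ) i))) :
    LinearMap.det g = -1 ∧ redCharpoly g = recip n h := by
  have h1 := det_eq_of_charpoly hm hn hN hg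
  have h2 := revCharpoly_eq hm hn hg
  rw [Fin.prod_univ_two] at h1 h2
  have h1' : LinearMap.det g = -1 := by simpa using h1
  refine ⟨h1', ?_⟩
  have e : (1 - C ((![1, -1] : Fin 2 → ZMod ℓ) 0) * X) * (1 - C ((![1, -1] : Fin 2 → ZMod ℓ) 1) * X)
      = (1 - X ^ 2 : (ZMod ℓ)[X]) := by
    simp; ring
  have e0 : (1 - X ^ 2 : (ZMod ℓ)[X]) ≠ 0 := by
    rw [← e]
    exact mul_ne_zero (one_sub_C_mul_X_ne_zero _) (one_sub_C_mul_X_ne_zero _)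
  rw [redCharpoly, if_neg, if_pos h1', h2, e, mul_div_cancel_right₀ _ e0]
  rw [hN]
  simp [parity_simps]

end RedCharpoly

/-! ### From sets of polynomials to densities -/

section Density

variable {ℓ : ℕ} [Fact ℓ.Prime] {V : Type*} [AddCommGroup V] [Module (ZMod ℓ) V]
  [FiniteDimensional (ZMod ℓ) V] {Q : QuadraticForm (ZMod ℓ) V}

/-- Lower bound for the density of a sieving set in terms of the number of polynomials associated
with the reduced characteristic polynomials. -/
theorem le_density (hℓ : ℓ ≠ 2) (hQ : (QuadraticMap.polarBilin Q).Nondegenerate) {n j : ℕ}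
    (hN : Module.finrank (ZMod ℓ) V = 2 * n + j) (hn0 : 1 ≤ n)
    {δ : Fin j → ZMod ℓ} (hδ : ∀ i, δ i = 1 ∨ δ i = -1) (hδi : Function.Injective δ)
    {ε₁ ε₂ : ℤˣ} {P : Set (ZMod ℓ)[X]} (A : Finset (ZMod ℓ)[X])
    (hA : ∀ h ∈ A, h.Monic ∧ h.natDegree = n ∧ recip n h ∈ P)
    (hA0 : ∀ h ∈ A, h.eval 2 ≠ 0 ∧ h.eval (-2) ≠ 0)
    (hred : ∀ h ∈ A, ∀ g : Module.End (ZMod ℓ) V,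
      g.charpoly = recip n h * ∏ i, (X - C (δ i)) →
        LinearMap.det g = ((ε₁ : ℤ) : ZMod ℓ) ∧ redCharpoly g = recip n h)
    (hc : ∀ h ∈ A, ∃ c : Fin j → ZMod ℓ, (∀ i, c i ≠ 0) ∧
      discChar Q = quadraticChar (ZMod ℓ)
        ((recip n h).eval 1 * (recip n h).eval (-1) * ∏ i, 2 * c i) ∧
      (ε₂ : ℤ) = quadraticChar (ZMod ℓ) ((recip n h).eval (-1)) *
        ∏ i ∈ Finset.univ.filter (fun i => δ i = -1), quadraticChar (ZMod ℓ) (c i)) :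
    4 / 2 ^ j * (A.card / (ℓ : ℝ) ^ n) * (1 - n / ℓ) ≤ density Q (sievingSet Q ε₁ ε₂ P) := by
  classical
  have hℓ0 : (0 : ℝ) < ℓ := by exact_mod_cast (Fact.out : ℓ.Prime).pos
  have : Finite V := Module.finite_of_finite (ZMod ℓ)
  have : Finite (V ≃ₗ[ZMod ℓ] V) := DFunLike.finite _
  set S := sievingSet Q ε₁ ε₂ P
  have hsub : ∀ h ∈ A, Nat.card (orthogonalGroup Q) * (ℓ ^ n - n * ℓ ^ (n - 1) : ℝ) ≤
      Nat.card {g : orthogonalGroup Q // g ∈ S ∧ redCharpoly (toEnd g) = recip n h} *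
        (ℓ ^ (2 * n) * 2 ^ j : ℝ) := by
    intro h hh
    obtain ⟨hm, hn, hP⟩ := hA h hh
    obtain ⟨c, hc0, hd, hs⟩ := hc h hh
    have h1 : (recip n h).eval 1 ≠ 0 := by
      rw [eval_one_recip hn.le]; exact (hA0 h hh).1
    have h3 : (recip n h).eval (-1) ≠ 0 := by
      rw [eval_neg_one_recip hn.le]
      exact mul_ne_zero (pow_ne_zero _ (neg_ne_zero.2 one_ne_zero)) (hA0 h hh).2
    have key := card_mul_card_units_le hℓ hQ hm hn hN h1 h3 hδ hδi hc0 hd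
    have hle : Nat.card {g : orthogonalGroup Q //
        (toEnd g).charpoly = recip n h * ∏ i, (X - C (δ i)) ∧
        ((spinorNorm Q g : ℤˣ) : ℤ) = quadraticChar (ZMod ℓ) ((recip n h).eval (-1)) *
          ∏ i ∈ Finset.univ.filter (fun i => δ i = -1), quadraticChar (ZMod ℓ) (c i)} ≤
        Nat.card {g : orthogonalGroup Q // g ∈ S ∧ redCharpoly (toEnd g) = recip n h} := by
      refine Nat.card_le_card_of_injective (fun g => ⟨g.1, ?_⟩)
        fun g g' e => Subtype.ext (congrArg (fun x => x.1) e)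
      obtain ⟨hdet, hr⟩ := hred h hh _ g.2.1
      refine ⟨⟨hdet, Units.ext (g.2.2.trans hs.symm), ?_⟩, hr⟩
      rw [hr]; exact hP
    have hu := pow_natDegree_le_card_units hm
    rw [hn] at hu
    have hu' : (ℓ ^ n - n * ℓ ^ (n - 1) : ℝ) ≤ Nat.card (AdjoinRoot h)ˣ := by
      rw [sub_le_iff_le_add]; exact_mod_cast hu
    have key' : (Nat.card (orthogonalGroup Q) * Nat.card (AdjoinRoot h)ˣ : ℝ) ≤
        Nat.card {g : orthogonalGroup Q // g ∈ S ∧ redCharpoly (toEnd g) = recip n h} *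
          (ℓ ^ (2 * n) * 2 ^ j : ℝ) := by
      exact_mod_cast key.trans (Nat.mul_le_mul_right _ hle)
    exact (mul_le_mul_of_nonneg_left hu' (Nat.cast_nonneg _)).trans key'
  -- The contributions of different h are disjoint, since the reduced characteristic polynomial
  -- recovers h.
  have hdisj : ∑ h ∈ A, Nat.card {g : orthogonalGroup Q //
      g ∈ S ∧ redCharpoly (toEnd g) = recip n h} ≤ Nat.card S := by
    rw [← Finset.sum_coe_sort, ← Nat.card_sigma]
    refine Nat.card_le_card_of_injective (fun x => ⟨x.2.1, x.2.2.1⟩) ?_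
    rintro ⟨⟨h, hh⟩, ⟨g, hg⟩⟩ ⟨⟨h', hh'⟩, ⟨g', hg'⟩⟩ e
    obtain rfl : g = g' := congrArg Subtype.val e
    obtain rfl : h = h' := recip_injective (hA h hh).2.1.le (hA h' hh').2.1.le
      (hg.2.symm.trans hg'.2)
    rfl
  have hsum := Finset.sum_le_sum hsub
  rw [Finset.sum_const, nsmul_eq_mul, ← Finset.sum_mul] at hsum
  have hS : (∑ h ∈ A, (Nat.card {g : orthogonalGroup Q //
      g ∈ S ∧ redCharpoly (toEnd g) = recip n h} : ℝ)) ≤ Nat.card S := by exact_mod_cast hdisj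
  have hΩ : (4 : ℝ) * Nat.card (omegaGroup Q) ≤ Nat.card (orthogonalGroup Q) := by
    exact_mod_cast four_mul_card_omegaGroup_le' hℓ hQ (by omega)
  have hΩ0 : (0 : ℝ) < Nat.card (omegaGroup Q) := by exact_mod_cast Nat.card_pos
  rw [density, le_div_iff₀ hΩ0]
  have hden : (0 : ℝ) < ℓ ^ (2 * n) * 2 ^ j := by positivity
  rcases le_or_gt (1 - n / ℓ : ℝ) 0 with hneg | hpos
  · refine le_trans ?_ (Nat.cast_nonneg _)
    refine mul_nonpos_of_nonpos_of_nonneg ?_ hΩ0.le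
    exact mul_nonpos_of_nonneg_of_nonpos (by positivity) hneg
  have e1 : (ℓ ^ n - n * ℓ ^ (n - 1) : ℝ) = ℓ ^ n * (1 - n / ℓ) := by
    obtain ⟨k, rfl⟩ : ∃ k, n = k + 1 := ⟨n - 1, by omega⟩
    rw [Nat.add_sub_cancel, pow_succ]
    field_simp
  rw [← mul_le_mul_iff_left₀ hden]
  refine le_trans ?_ (hsum.trans (mul_le_mul_of_nonneg_right hS hden.le))
  rw [e1]
  calc 4 / 2 ^ j * (A.card / (ℓ : ℝ) ^ n) * (1 - n / ℓ) * Nat.card (omegaGroup Q) *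
        (ℓ ^ (2 * n) * 2 ^ j)
      = A.card * ((4 * Nat.card (omegaGroup Q)) * (ℓ ^ n * (1 - n / ℓ))) := by
        rw [two_mul n, pow_add]
        field_simp
    _ ≤ _ := by gcongr

/-- The discriminant of Q and the spinor norm impose two conditions on square classes, while the j =
N - N_red diagonal coefficients are free. Each coefficient absorbs one condition, which leaves 2^j
of the four classes. When j > 0 one of them has product -1, which the first family uses to get
irreducible transforms. -/
theorem exists_goodClasses (hℓ : ℓ ≠ 2) (hQ : (QuadraticMap.polarBilin Q).Nondegenerate) {N : ℕ}
    (hN : Module.finrank (ZMod ℓ) V = N) (h5 : 5 ≤ N) (ε₁ ε₂ : ℤˣ) :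
    ∃ G : Finset (ℤˣ × ℤˣ), G.card = 2 ^ (N - Nred N ε₁) ∧
      (¬ (Even N ∧ ε₁ = 1) → ∃ η ∈ G, η.1 * η.2 = -1) ∧
      (Even N ∧ ε₁ = 1 → ∀ η ∈ G,
        ((η.1 * η.2 : ℤˣ) : ℤ) = quadraticChar (ZMod ℓ) (quadDisc Q) ∧
        ∀ h : (ZMod ℓ)[X], h.natDegree = Nred N ε₁ / 2 → HasClass η h →
          quadraticChar (ZMod ℓ) ((recip (Nred N ε₁ / 2) h).eval (-1)) = (ε₂ : ℤ)) ∧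
      ∀ (P : Set (ZMod ℓ)[X]) (A : Finset (ZMod ℓ)[X]),
        (∀ h ∈ A, h.Monic ∧ h.natDegree = Nred N ε₁ / 2 ∧ recip (Nred N ε₁ / 2) h ∈ P ∧
          ∃ η ∈ G, HasClass η h) →
        4 / 2 ^ (N - Nred N ε₁) * (A.card / (ℓ : ℝ) ^ (Nred N ε₁ / 2)) *
          (1 - ((Nred N ε₁ / 2 : ℕ) : ℝ) / ℓ) ≤ density Q (sievingSet Q ε₁ ε₂ P) := by
  classical
  set n := Nred N ε₁ / 2 with hn
  have h2 := two_ne_zero_of_ne_two hℓ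
  obtain ⟨σ, hσ⟩ := exists_units_eq_quadraticChar (ℓ := ℓ) (a := (-1) ^ n)
    (pow_ne_zero _ (neg_ne_zero.2 one_ne_zero))
  obtain ⟨τ, hτ⟩ := exists_units_eq_quadraticChar h2
  obtain ⟨d, hd⟩ : ∃ d : ℤˣ, discChar Q = d := by
    have h0 := discChar_ne_zero hQ
    rw [discChar, Ne, quadraticChar_eq_zero_iff] at h0
    exact exists_units_eq_quadraticChar h0
  have hf1 : ∀ {η} {h : (ZMod ℓ)[X]}, h.natDegree = n → HasClass η h →
      quadraticChar (ZMod ℓ) ((recip n h).eval 1) = (η.1 : ℤ) := by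
    intro η h hh hc
    rw [eval_one_recip hh.le, hc.1]
  have hf3 : ∀ {η} {h : (ZMod ℓ)[X]}, h.natDegree = n → HasClass η h →
      quadraticChar (ZMod ℓ) ((recip n h).eval (-1)) = ((σ * η.2 : ℤˣ) : ℤ) := by
    intro η h hh hc
    rw [eval_neg_one_recip hh.le, map_mul, hc.2, hσ, Units.val_mul]
  have huu : ∀ u v : ℤˣ, u * (u * v) = v := fun u v => by
    rw [← mul_assoc, Int.units_mul_self, one_mul]
  by_cases hodd : Odd N
  · have hNr : Nred N ε₁ = N - 1 := if_pos hodd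
    have hN' : Module.finrank (ZMod ℓ) V = 2 * n + 1 := by
      obtain ⟨k, hk⟩ := hodd
      omega
    have hj : N - Nred N ε₁ = 1 := by omega
    have hev : ¬ (Even N ∧ ε₁ = 1) := fun h => (Nat.not_even_iff_odd.2 hodd) h.1
    rw [hj]
    rcases Int.units_eq_one_or ε₁ with h1 | h1
    -- Without the eigenvalue -1 the spinor norm prescribes the class of h(-2); the diagonal
    -- coefficient then adjusts the discriminant.
    · refine ⟨{(1, σ * ε₂), (-1, σ * ε₂)}, ?_, fun _ => ?_, fun h => absurd h hev, ?_⟩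
      · rw [Finset.card_pair]
        · rfl
        · intro h
          exact absurd (show (1 : ℤˣ) = -1 from congrArg Prod.fst h) (by decide)
      · rcases Int.units_eq_one_or (σ * ε₂) with h | h
        · exact ⟨(-1, σ * ε₂), by simp, by simp [h]⟩
        · exact ⟨(1, σ * ε₂), by simp, by simp [h]⟩
      · intro P A hA
        refine le_density hℓ hQ hN' (by omega) (δ := fun _ => 1) (fun _ => Or.inl rfl)
          (Function.injective_of_subsingleton _) A (fun h hh => ⟨(hA h hh).1, (hA h hh).2.1,
            (hA h hh).2.2.1⟩) (fun h hh => ?_) (fun h hh g hg => ?_) fun h hh => ?_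
        · obtain ⟨-, -, -, η, -, hη⟩ := hA h hh
          exact hη.eval_ne_zero
        · obtain ⟨e1, e3⟩ := redCharpoly_eq_of_odd (hA h hh).1 (hA h hh).2.1 hN' hg
          exact ⟨by rw [e1, h1]; simp, e3⟩
        · obtain ⟨-, hdeg, -, η, hηG, hη⟩ := hA h hh
          have hη2 : η.2 = σ * ε₂ := by
            simp only [Finset.mem_insert, Finset.mem_singleton] at hηG
            rcases hηG with rfl | rfl <;> rfl
          obtain ⟨c, hc0, hc⟩ := exists_quadraticChar_eq hℓ (η.1 * (σ * η.2) * τ * d)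
          refine ⟨fun _ => c, fun _ => hc0, ?_, ?_⟩
          · rw [Fin.prod_univ_one, map_mul, map_mul, map_mul, hf1 hdeg hη, hf3 hdeg hη, hτ, hc, hd]
            norm_cast
            calc d = d * (τ * τ) * ((σ * η.2) * (σ * η.2)) * (η.1 * η.1) := by
                  simp only [Int.units_mul_self, mul_one]
              _ = _ := by simp only [mul_comm, mul_left_comm]
          · rw [Finset.filter_false_of_mem, Finset.prod_empty, mul_one, hf3 hdeg hη, hη2, huu]
            intro _ _ h
            exact h2 (by linear_combination h)
    -- The coefficient on the line of eigenvalue -1 is spent on the spinor norm, and the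
    -- discriminant then prescribes the class of h(2).
    · refine ⟨{(d * τ * ε₂, 1), (d * τ * ε₂, -1)}, ?_, fun _ => ?_, fun h => absurd h hev, ?_⟩
      · rw [Finset.card_pair]
        · rfl
        · intro h
          exact absurd (show (1 : ℤˣ) = -1 from congrArg Prod.snd h) (by decide)
      · rcases Int.units_eq_one_or (d * τ * ε₂) with h | h
        · exact ⟨(d * τ * ε₂, -1), by simp, by simp [h]⟩
        · exact ⟨(d * τ * ε₂, 1), by simp, by simp [h]⟩
      · intro P A hA
        refine le_density hℓ hQ hN' (by omega) (δ := fun _ => -1) (fun _ => Or.inr rfl)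
          (Function.injective_of_subsingleton _) A (fun h hh => ⟨(hA h hh).1, (hA h hh).2.1,
            (hA h hh).2.2.1⟩) (fun h hh => ?_) (fun h hh g hg => ?_) fun h hh => ?_
        · obtain ⟨-, -, -, η, -, hη⟩ := hA h hh
          exact hη.eval_ne_zero
        · obtain ⟨e1, e3⟩ := redCharpoly_eq_of_odd (hA h hh).1 (hA h hh).2.1 hN' hg
          exact ⟨by rw [e1, h1]; simp, e3⟩
        · obtain ⟨-, hdeg, -, η, hηG, hη⟩ := hA h hh
          have hη1 : η.1 = d * τ * ε₂ := by
            simp only [Finset.mem_insert, Finset.mem_singleton] at hηG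
            rcases hηG with rfl | rfl <;> rfl
          obtain ⟨c, hc0, hc⟩ := exists_quadraticChar_eq hℓ (σ * η.2 * ε₂)
          refine ⟨fun _ => c, fun _ => hc0, ?_, ?_⟩
          · rw [Fin.prod_univ_one, map_mul, map_mul, map_mul, hf1 hdeg hη, hf3 hdeg hη, hτ, hc, hd,
              hη1]
            norm_cast
            calc d = d * (τ * τ) * (ε₂ * ε₂) * ((σ * η.2) * (σ * η.2)) := by
                  simp only [Int.units_mul_self, mul_one]
              _ = _ := by simp only [mul_comm, mul_left_comm]
          · rw [Finset.filter_true_of_mem fun _ _ => rfl, Fin.prod_univ_one, hc, hf3 hdeg hη]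
            norm_cast
            rw [huu]
  · have heven : Even N := Nat.not_odd_iff_even.1 hodd
    rcases Int.units_eq_one_or ε₁ with h1 | h1
    · have hNr : Nred N ε₁ = N := by rw [Nred, if_neg hodd, if_pos h1]
      have hN' : Module.finrank (ZMod ℓ) V = 2 * n + 0 := by
        obtain ⟨k, hk⟩ := heven
        omega
      have hj : N - Nred N ε₁ = 0 := by omega
      rw [hj]
      -- No coefficient is free: f(-1) must have class ε₂ and f(1)f(-1) must have class d.
      refine ⟨{(d * ε₂, σ * ε₂)}, by simp, fun h => absurd ⟨heven, h1⟩ h, fun _ η hη => ?_, ?_⟩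
      · rw [Finset.mem_singleton] at hη
        subst hη
        refine ⟨?_, fun h hh hc => ?_⟩
        · rw [quadraticChar_quadDisc_of_finrank hN', hσ, hd]
          norm_cast
          calc d * ε₂ * (σ * ε₂) = (ε₂ * ε₂) * (σ * d) := by simp only [mul_comm, mul_left_comm]
            _ = _ := by rw [Int.units_mul_self, one_mul]
        · rw [hf3 hh hc, huu]
      · intro P A hA
        refine le_density hℓ hQ hN' (by omega) (δ := Fin.elim0) (fun i => i.elim0)
          (Function.injective_of_subsingleton _) A (fun h hh => ⟨(hA h hh).1, (hA h hh).2.1,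
            (hA h hh).2.2.1⟩) (fun h hh => ?_) (fun h hh g hg => ?_) fun h hh => ?_
        · obtain ⟨-, -, -, η, -, hη⟩ := hA h hh
          exact hη.eval_ne_zero
        · obtain ⟨e1, e3⟩ := redCharpoly_eq_of_even hℓ (hA h hh).1 (hA h hh).2.1 hN' hg
          exact ⟨by rw [e1, h1]; simp, e3⟩
        · obtain ⟨-, hdeg, -, η, hηG, hη⟩ := hA h hh
          rw [Finset.mem_singleton] at hηG
          subst hηG
          refine ⟨Fin.elim0, fun i => i.elim0, ?_, ?_⟩
          · rw [Fin.prod_univ_zero, mul_one, map_mul, hf1 hdeg hη, hf3 hdeg hη, hd]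
            norm_cast
            rw [huu, mul_assoc, Int.units_mul_self, mul_one]
          · rw [Finset.univ_eq_empty, Finset.filter_empty, Finset.prod_empty, mul_one,
              hf3 hdeg hη, huu]
    · have hε : ε₁ ≠ 1 := by rw [h1]; decide
      have hNr : Nred N ε₁ = N - 2 := by rw [Nred, if_neg hodd, if_neg hε]
      have hN' : Module.finrank (ZMod ℓ) V = 2 * n + 2 := by
        obtain ⟨k, hk⟩ := heven
        omega
      have hj : N - Nred N ε₁ = 2 := by omega
      rw [hj]
      -- Both conditions are absorbed: c on the line of eigenvalue -1 gives the spinor norm, b on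
      -- the line of eigenvalue 1 gives the discriminant.
      refine ⟨Finset.univ, by decide, fun _ => ⟨(1, -1), Finset.mem_univ _, by decide⟩,
        fun h => absurd h.2 hε, ?_⟩
      intro P A hA
      have h11 : (1 : ZMod ℓ) ≠ -1 := fun h => h2 (by linear_combination h)
      refine le_density hℓ hQ hN' (by omega) (δ := ![1, -1]) ?_ ?_ A
          (fun h hh => ⟨(hA h hh).1, (hA h hh).2.1, (hA h hh).2.2.1⟩) (fun h hh => ?_)
          (fun h hh g hg => ?_) fun h hh => ?_
      · intro i
        fin_cases i <;> simp
      · intro i k hik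
        fin_cases i <;> fin_cases k <;> simp_all
      · obtain ⟨-, -, -, η, -, hη⟩ := hA h hh
        exact hη.eval_ne_zero
      · obtain ⟨e1, e3⟩ := redCharpoly_eq_of_even_neg (hA h hh).1 (hA h hh).2.1 hN' hg
        exact ⟨by rw [e1, h1]; simp, e3⟩
      · obtain ⟨-, hdeg, -, η, hηG, hη⟩ := hA h hh
        obtain ⟨c, hc0, hc⟩ := exists_quadraticChar_eq hℓ (σ * η.2 * ε₂)
        obtain ⟨b, hb0, hb⟩ := exists_quadraticChar_eq hℓ (d * η.1 * ε₂)
        refine ⟨![b, c], ?_, ?_, ?_⟩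
        · intro i
          fin_cases i <;> simpa
        · simp only [Fin.prod_univ_two, Matrix.cons_val_zero, Matrix.cons_val_one, map_mul,
            hf1 hdeg hη, hf3 hdeg hη, hτ, hc, hd, hb]
          norm_cast
          calc d = d * (τ * τ) * (ε₂ * ε₂) * ((σ * η.2) * (σ * η.2)) * (η.1 * η.1) := by
                simp only [Int.units_mul_self, mul_one]
            _ = _ := by simp only [mul_comm, mul_left_comm]
        · have : Finset.univ.filter (fun i => (![1, -1] : Fin 2 → ZMod ℓ) i = -1) = {1} := by
            ext i
            fin_cases i <;> simp [h11]
          rw [this, Finset.prod_singleton]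
          simp only [Matrix.cons_val_one, Matrix.cons_val_zero, hc, hf3 hdeg hη]
          norm_cast
          rw [huu]

end Density

/-! ### The discriminant of a self-reciprocal polynomial -/

section Discriminant

variable {K F : Type*} [Field K] [Field F]

theorem map_recip (φ : K →+* F) (n : ℕ) (h : K[X]) :
    (recip n h).map φ = recip n (h.map φ) := by
  simp [recip, Polynomial.map_sum]

/-- The product rule for x^n h(x + 1/x), cleared of denominators. At a root of the transform only
the second term survives, which expresses its derivative through that of h. -/
theorem X_mul_derivative_recip {n : ℕ} {h : K[X]} (hn : h.natDegree ≤ n) :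
    X * derivative (recip n h) =
      C (n : K) * recip n h + (X ^ 2 - 1) * recip (n - 1) (derivative h) := by
  -- After the shift of index, the term i = 0 has coefficient 0, so the truncated exponent i - 1 is
  -- harmless.
  have hk : recip (n - 1) (derivative h) = ∑ i ∈ Finset.range (n + 1),
      C (h.coeff i) * (C (i : K) * (X ^ (n - i) * (X ^ 2 + 1) ^ (i - 1))) := by
    rcases n with _ | n
    · rw [Nat.le_zero, natDegree_eq_zero] at hn
      obtain ⟨a, rfl⟩ := hn
      simp [recip]
    · rw [Finset.sum_range_succ', recip]
      simp only [Nat.cast_zero, C_0, zero_mul, mul_zero, add_zero, Nat.add_sub_cancel]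
      refine Finset.sum_congr rfl fun i hi => ?_
      rw [coeff_derivative, C_mul, Nat.add_sub_add_right]
      push_cast
      ring
  rw [hk, recip, derivative_sum, Finset.mul_sum, Finset.mul_sum, Finset.mul_sum,
    ← Finset.sum_add_distrib]
  refine Finset.sum_congr rfl fun i hi => ?_
  have hi' : i ≤ n := Nat.lt_succ_iff.1 (Finset.mem_range.1 hi)
  obtain ⟨k, rfl⟩ := Nat.exists_eq_add_of_le hi'
  rw [Nat.add_sub_cancel_left, derivative_C_mul, derivative_mul, derivative_X_pow,
    derivative_pow]
  have e1 : (X : K[X]) * (C (k : K) * X ^ (k - 1)) = C (k : K) * X ^ k := by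
    rcases k with _ | k
    · simp
    · rw [Nat.add_sub_cancel, pow_succ]; ring
  have e2 : C (i : K) * (X ^ 2 + 1 : K[X]) ^ i = C (i : K) * ((X ^ 2 + 1) ^ (i - 1) * (X ^ 2 + 1)) := by
    rcases i with _ | i
    · simp
    · rw [Nat.add_sub_cancel, pow_succ]
  have e3 : derivative (X ^ 2 + 1 : K[X]) = 2 * X := by
    rw [derivative_add, derivative_X_pow, derivative_one]; simp; rfl
  rw [e3]
  push_cast [C_add]
  linear_combination (C (h.coeff i) * (X ^ 2 + 1) ^ i) * e1 - (C (h.coeff i) * X ^ k) * e2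

theorem eval_recip {n : ℕ} {h : K[X]} (hn : h.natDegree ≤ n) {a b : K} (hab : a * b = 1) :
    (recip n h).eval a = a ^ n * h.eval (a + b) := by
  have := aeval_recip (A := K) hn hab (by rw [mul_comm, hab])
  simpa using this

theorem recip_prod_X_sub_C (B : Multiset K) :
    recip (Multiset.card B) (B.map fun b => X - C b).prod =
      (B.map fun b => X ^ 2 - C b * X + 1).prod := by
  induction B using Multiset.induction_on with
  | empty => simp [recip]
  | cons b B ih =>
    have h1 : recip 1 (X - C b : K[X]) = X ^ 2 - C b * X + 1 := by
      simp [recip, Finset.sum_range_succ, coeff_X, coeff_C]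
      ring
    rw [Multiset.map_cons, Multiset.prod_cons, Multiset.map_cons, Multiset.prod_cons,
      Multiset.card_cons, add_comm, recip_mul, h1, ih]
    · exact (natDegree_X_sub_C b).le
    · rw [natDegree_multiset_prod_X_sub_C_eq_card]

/-- Over an algebraic closure each root b of h gives two roots a and b - a of f with product 1, and
f'(a) f'(b - a) = (2 - b)(2 + b) h'(b)². The product over all b is (-1)^n h(2) h(-2) times the
square of the resultant, and this sign cancels the one relating resultant and discriminant. -/
theorem discr_recip {n : ℕ} {h : K[X]} (hm : h.Monic) (hn : h.natDegree = n) (hn0 : 0 < n) :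
    (recip n h).discr =
      h.eval 2 * h.eval (-2) * (resultant h (derivative h) n (n - 1)) ^ 2 := by
  let F := AlgebraicClosure K
  let φ := algebraMap K F
  have hφ : Function.Injective φ := φ.injective
  obtain ⟨hfm, hfd⟩ := recip_monic hm hn
  set f := recip n h with hf
  set H := h.map φ with hH
  have hHm : H.Monic := hm.map φ
  have hHd : H.natDegree = n := by rw [hH, natDegree_map, hn]
  have hHs : H.Splits := IsAlgClosed.splits H
  set B := H.roots with hB
  have hBc : Multiset.card B = n := by rw [← hHd, hB, hHs.natDegree_eq_card_roots]
  have hHp : H = (B.map fun b => X - C b).prod := hHs.eq_prod_roots_of_monic hHm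
  have hex : ∀ b : F, ∃ a : F, a * (b - a) = 1 := by
    intro b
    obtain ⟨a, ha⟩ := IsAlgClosed.exists_root (X ^ 2 - C b * X + 1 : F[X]) (by
      have : (X ^ 2 - C b * X + 1 : F[X]).degree = 2 := by compute_degree!
      rw [this]; decide)
    refine ⟨a, ?_⟩
    simp only [IsRoot.def, eval_add, eval_sub, eval_pow, eval_X, eval_mul, eval_C, eval_one] at ha
    linear_combination -ha
  choose a ha using hex
  have hfF : f.map φ = ((B.bind fun b => {a b, b - a b}).map fun x => X - C x).prod := by
    rw [hf, map_recip, ← hH]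
    conv_lhs => rw [hHp, ← hBc]
    rw [recip_prod_X_sub_C, Multiset.map_bind, Multiset.prod_bind]
    congr 1
    refine Multiset.map_congr rfl fun b _ => ?_
    simp only [Multiset.insert_eq_cons, Multiset.map_cons, Multiset.map_singleton,
      Multiset.prod_cons, Multiset.prod_singleton]
    have := congrArg (C : F → F[X]) (ha b)
    rw [C_mul, C_1] at this
    rw [← this, C_sub]
    ring
  have hroots : (f.map φ).roots = B.bind fun b => {a b, b - a b} := by
    rw [hfF, roots_multiset_prod_X_sub_C]
  have hval : ∀ b ∈ B, (derivative (f.map φ)).eval (a b) * (derivative (f.map φ)).eval (b - a b) =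
      (2 - b) * (2 + b) * (derivative H).eval b ^ 2 := by
    intro b hb
    have hb0 : H.eval b = 0 := (mem_roots'.1 hb).2
    have hD : ∀ x y : F, x * y = 1 → x + y = b →
        x * (derivative (f.map φ)).eval x = (x ^ 2 - 1) * (x ^ (n - 1) * (derivative H).eval b) := by
      intro x y hxy hs
      have := congrArg (eval x) (X_mul_derivative_recip (K := F) hHd.le)
      rw [← map_recip] at this
      simp only [eval_mul, eval_add, eval_X, eval_sub, eval_pow, eval_one, eval_C] at this
      rw [hf, this, map_recip, eval_recip hHd.le hxy,
        eval_recip ((natDegree_derivative_le _).trans (by rw [hHd])) hxy, hs, hb0]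
      ring
    have e1 := hD (a b) (b - a b) (ha b) (by ring)
    have e2 := hD (b - a b) (a b) (by rw [mul_comm]; exact ha b) (by ring)
    set x := a b
    set y := b - x with hy
    have hxy : x * y = 1 := ha b
    have hb' : b = x + y := by rw [hy]; ring
    calc (derivative (f.map φ)).eval x * (derivative (f.map φ)).eval y
        = (x * y) * ((derivative (f.map φ)).eval x * (derivative (f.map φ)).eval y) := by
          rw [hxy, one_mul]
      _ = (x * (derivative (f.map φ)).eval x) * (y * (derivative (f.map φ)).eval y) := by ring
      _ = (x ^ 2 - 1) * (y ^ 2 - 1) * (x * y) ^ (n - 1) * (derivative H).eval b ^ 2 := by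
          rw [e1, e2, mul_pow]; ring
      _ = _ := by
          rw [hxy, one_pow, hb']
          linear_combination (x * y + 3) * (derivative H).eval (x + y) ^ 2 * hxy
  have key : φ (resultant f (derivative f) (2 * n) (2 * n - 1)) =
      φ ((-1) ^ n * (h.eval 2 * h.eval (-2) * resultant h (derivative h) n (n - 1) ^ 2)) := by
    have r1 : φ (resultant f (derivative f) (2 * n) (2 * n - 1)) =
        ((f.map φ).roots.map (derivative (f.map φ)).eval).prod := by
      have hfd' : (f.map φ).natDegree = 2 * n := by rw [natDegree_map, hfd]
      rw [← resultant_map_map, ← derivative_map]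
      conv_lhs => rw [← hfd']
      rw [resultant_eq_prod_eval _ _ _ (natDegree_derivative_le _) (IsAlgClosed.splits _),
        (hfm.map φ).leadingCoeff, one_pow, one_mul]
    have r2 : φ (resultant h (derivative h) n (n - 1)) = (B.map (derivative H).eval).prod := by
      rw [← resultant_map_map, ← derivative_map, ← hH]
      conv_lhs => rw [← hHd]
      rw [resultant_eq_prod_eval _ _ _ (natDegree_derivative_le _) hHs, hHm.leadingCoeff, one_pow,
        one_mul]
    have r3 : φ (h.eval 2) = (B.map fun b => 2 - b).prod := by
      have : φ (h.eval 2) = H.eval 2 := by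
        rw [hH, ← map_ofNat φ 2, eval_map, eval₂_at_apply]
      rw [this, hHp, eval_multiset_prod, Multiset.map_map]
      simp
    have r4 : φ (h.eval (-2)) = (-1) ^ n * (B.map fun b => 2 + b).prod := by
      have : φ (h.eval (-2)) = H.eval (-2) := by
        rw [hH, ← map_ofNat φ 2, ← map_neg, eval_map, eval₂_at_apply]
      rw [this, hHp, eval_multiset_prod, Multiset.map_map, ← hBc, ← Multiset.prod_replicate,
        ← Multiset.map_const', ← Multiset.prod_map_mul]
      congr 1
      refine Multiset.map_congr rfl fun b _ => ?_
      simp; ring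
    rw [r1, hroots, Multiset.map_bind, Multiset.prod_bind, map_mul, map_mul, map_mul, map_pow,
      map_pow, map_neg, map_one, r2, r3, r4, ← Multiset.prod_map_pow]
    have : (B.map fun b => (Multiset.map (derivative (f.map φ)).eval {a b, b - a b}).prod) =
        B.map fun b => (2 - b) * (2 + b) * (derivative H).eval b ^ 2 := by
      refine Multiset.map_congr rfl fun b hb => ?_
      simpa using hval b hb
    rw [this, Multiset.prod_map_mul, Multiset.prod_map_mul]
    have h1 : ((-1 : F) ^ n) * (-1) ^ n = 1 := by rw [← mul_pow, neg_one_mul, neg_neg, one_pow]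
    linear_combination (-(B.map fun b => 2 - b).prod * (B.map fun b => 2 + b).prod *
      (B.map fun b => (derivative H).eval b ^ 2).prod) * h1
  have hres := resultant_deriv (f := f) (natDegree_pos_iff_degree_pos.1 (by omega))
  rw [hfd, hfm.leadingCoeff, mul_one] at hres
  have hsgn : ((-1 : K)) ^ (2 * n * (2 * n - 1) / 2) = (-1) ^ n := by
    rw [mul_assoc, Nat.mul_div_cancel_left _ two_pos, pow_mul]
    obtain ⟨k, rfl⟩ : ∃ k, n = k + 1 := ⟨n - 1, by omega⟩
    rw [show 2 * (k + 1) - 1 = 2 * k + 1 by omega, pow_succ, ← pow_mul,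
      Even.neg_one_pow ⟨(k + 1) * k, by ring⟩, one_mul]
  have := hφ key
  rw [hres, hsgn] at this
  exact mul_left_cancel₀ (pow_ne_zero _ (neg_ne_zero.2 one_ne_zero)) this

theorem resultant_derivative_ne_zero {n : ℕ} {h : K[X]} (hm : h.Monic) (hn : h.natDegree = n)
    (hs : h.Separable) : resultant h (derivative h) n (n - 1) ≠ 0 := by
  let F := AlgebraicClosure K
  let φ := algebraMap K F
  intro h0
  have := congrArg φ h0
  have hd : (h.map φ).natDegree = n := by rw [natDegree_map, hn]
  rw [← resultant_map_map, ← derivative_map, map_zero] at this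
  conv_lhs at this => rw [← hd]
  rw [resultant_eq_prod_eval _ _ _ (natDegree_derivative_le _) (IsAlgClosed.splits _),
    (hm.map φ).leadingCoeff, one_pow, one_mul, Multiset.prod_eq_zero_iff] at this
  obtain ⟨b, hb, hb0⟩ := Multiset.mem_map.1 this
  have hsep : (h.map φ).Separable := hs.map
  obtain ⟨u, v, huv⟩ := hsep
  have := congrArg (eval b) huv
  rw [eval_add, eval_mul, eval_mul, hb0, (mem_roots'.1 hb).2] at this
  simp at this

theorem separable_recip {n : ℕ} {h : K[X]} (hm : h.Monic) (hn : h.natDegree = n) (hn0 : 0 < n)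
    (hs : h.Separable) (h1 : h.eval 2 ≠ 0) (h3 : h.eval (-2) ≠ 0) : (recip n h).Separable := by
  obtain ⟨hfm, hfd⟩ := recip_monic hm hn
  have hd : (recip n h).discr ≠ 0 := by
    rw [discr_recip hm hn hn0]
    exact mul_ne_zero (mul_ne_zero h1 h3) (pow_ne_zero _ (resultant_derivative_ne_zero hm hn hs))
  have hres := resultant_deriv (f := recip n h) (natDegree_pos_iff_degree_pos.1 (by omega))
  rw [hfm.leadingCoeff, mul_one] at hres
  obtain ⟨p, q, -, -, e⟩ := exists_mul_add_mul_eq_C_resultant (recip n h) (derivative (recip n h))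
    le_rfl (natDegree_derivative_le _) (Or.inl (by omega))
  set r := resultant (recip n h) (derivative (recip n h)) (recip n h).natDegree
    ((recip n h).natDegree - 1)
  have hr : r ≠ 0 := by
    rw [hres]; exact mul_ne_zero (pow_ne_zero _ (neg_ne_zero.2 one_ne_zero)) hd
  refine ⟨C r⁻¹ * p, C r⁻¹ * q, ?_⟩
  have : (C r⁻¹ * C r : K[X]) = 1 := by rw [← C_mul, inv_mul_cancel₀ hr, C_1]
  rw [← e] at this
  linear_combination this

end Discriminant

/-! ### Factorization of a self-reciprocal polynomial -/

section Norm

variable {ℓ : ℕ} [Fact ℓ.Prime]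

open Classical in
-- Euler's criterion in both fields: with q the order of L, the norm of x is x^((q - 1)/(ℓ - 1)),
-- and its power (ℓ - 1)/2 is x^((q - 1)/2).
theorem quadraticChar_norm (hℓ : ℓ ≠ 2) {L : Type*} [Field L] [Fintype L] [Algebra (ZMod ℓ) L]
    (x : L) : quadraticChar (ZMod ℓ) (Algebra.norm (ZMod ℓ) x) = quadraticChar L x := by
  have : FiniteDimensional (ZMod ℓ) L := Module.Finite.of_finite
  by_cases hx : x = 0
  · rw [hx, Algebra.norm_zero, MulChar.map_zero, MulChar.map_zero]
  have hch : CharP L ℓ := charP_of_injective_algebraMap (algebraMap (ZMod ℓ) L).injective ℓ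
  have hK : ringChar (ZMod ℓ) ≠ 2 := by rwa [ZMod.ringChar_zmod_n]
  have hL : ringChar L ≠ 2 := by rwa [ringChar.eq L ℓ]
  have hx' : Algebra.norm (ZMod ℓ) x ≠ 0 := Algebra.norm_ne_zero_iff.2 hx
  have e1 : ((quadraticChar (ZMod ℓ) (Algebra.norm (ZMod ℓ) x) : ℤ) : L) =
      ((quadraticChar L x : ℤ) : L) := by
    rw [quadraticChar_eq_pow_of_char_ne_two' hL]
    have := congrArg (algebraMap (ZMod ℓ) L)
      (quadraticChar_eq_pow_of_char_ne_two' hK (Algebra.norm (ZMod ℓ) x))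
    rw [map_intCast, map_pow, FiniteField.algebraMap_norm_eq_pow, ← pow_mul] at this
    rw [this]
    congr 1
    rw [ZMod.card, Nat.card_zmod, ← Nat.card_eq_fintype_card]
    have hodd : ℓ % 2 = 1 := (Fact.out : ℓ.Prime).eq_two_or_odd.resolve_left hℓ
    have hLodd : Nat.card L % 2 = 1 := by
      rw [Nat.card_eq_fintype_card]
      exact FiniteField.odd_card_of_char_ne_two hL
    have hdvd : ℓ - 1 ∣ Nat.card L - 1 := by
      rw [Nat.card_eq_fintype_card, Module.card_eq_pow_finrank (K := ZMod ℓ), ZMod.card]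
      simpa using Nat.sub_dvd_pow_sub_pow ℓ 1 (Module.finrank (ZMod ℓ) L)
    have h1 : ℓ - 1 = 2 * (ℓ / 2) := by omega
    have h2 : Nat.card L / 2 * 2 = Nat.card L - 1 := by omega
    refine Nat.eq_of_mul_eq_mul_right two_pos ?_
    rw [h2, mul_assoc, mul_comm (ℓ / 2), ← h1, Nat.div_mul_cancel hdvd]
  refine Int.cast_injOn_of_ringChar_ne_two hL ?_ ?_ e1
  · rcases quadraticChar_dichotomy hx' with h | h <;> simp [h]
  · rcases quadraticChar_dichotomy hx with h | h <;> simp [h]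

end Norm

/-! ### Irreducible factors of the transform of an irreducible polynomial -/

section Irreducible

variable {ℓ : ℕ} [Fact ℓ.Prime]

theorem norm_algebraMap_sub_root {K : Type*} [Field K] {h : K[X]} (hm : h.Monic)
    (hi : Irreducible h) (a : K) :
    Algebra.norm K (algebraMap K (AdjoinRoot h) a - AdjoinRoot.root h) = h.eval a := by
  have : Fact (Irreducible h) := ⟨hi⟩
  let pb := AdjoinRoot.powerBasis hi.ne_zero
  rw [Algebra.norm_eq_matrix_det pb.basis]
  have e : h = (Algebra.leftMulMatrix pb.basis (AdjoinRoot.root h)).charpoly := by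
    have := charpoly_leftMulMatrix pb
    rw [show pb.gen = AdjoinRoot.root h from AdjoinRoot.powerBasis_gen hi.ne_zero,
      AdjoinRoot.minpoly_root hi.ne_zero, hm.leadingCoeff, inv_one, C_1, mul_one] at this
    exact this.symm
  conv_rhs => rw [e, Matrix.eval_charpoly]
  rw [map_sub, AlgHom.commutes]
  rfl

/-- The factorization α² - 4 = (2 - α)(-2 - α) has norm h(2)h(-2), and the norm preserves the
quadratic character. -/
theorem isSquare_root_sq_sub_four_iff (hℓ : ℓ ≠ 2) {h : (ZMod ℓ)[X]} (hm : h.Monic)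
    (hi : Irreducible h) {η : ℤˣ × ℤˣ} (hη : HasClass η h) :
    IsSquare (AdjoinRoot.root h ^ 2 - 4) ↔ η.1 * η.2 = 1 := by
  classical
  have : Fact (Irreducible h) := ⟨hi⟩
  have : FiniteDimensional (ZMod ℓ) (AdjoinRoot h) := (AdjoinRoot.powerBasis hi.ne_zero).finite
  have : Finite (AdjoinRoot h) := Module.finite_of_finite (ZMod ℓ)
  have := Fintype.ofFinite (AdjoinRoot h)
  have e : AdjoinRoot.root h ^ 2 - 4 =
      (algebraMap (ZMod ℓ) (AdjoinRoot h) 2 - AdjoinRoot.root h) *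
        (algebraMap (ZMod ℓ) (AdjoinRoot h) (-2) - AdjoinRoot.root h) := by
    rw [map_neg, map_ofNat]; ring
  have h1 : quadraticChar (AdjoinRoot h) (AdjoinRoot.root h ^ 2 - 4) = ((η.1 * η.2 : ℤˣ) : ℤ) := by
    rw [← quadraticChar_norm hℓ, e, map_mul, norm_algebraMap_sub_root hm hi,
      norm_algebraMap_sub_root hm hi, map_mul, hη.1, hη.2, Units.val_mul]
  have h0 : AdjoinRoot.root h ^ 2 - 4 ≠ 0 := by
    intro h0
    rw [h0, MulChar.map_zero] at h1
    exact Units.ne_zero _ h1.symm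
  rw [← quadraticChar_one_iff_isSquare h0, h1]
  exact ⟨fun h => Units.ext h, fun h => by rw [h]; rfl⟩

/-- The degree of an irreducible factor of `recip n h`, for `h` irreducible of degree `n`. -/
theorem natDegree_of_irreducible_dvd_recip (hℓ : ℓ ≠ 2) {n : ℕ} {h : (ZMod ℓ)[X]} (hm : h.Monic)
    (hn : h.natDegree = n) (hi : Irreducible h) {η : ℤˣ × ℤˣ} (hη : HasClass η h) {g : (ZMod ℓ)[X]}
    (hg : Irreducible g) (hgf : g ∣ recip n h) :
    (η.1 * η.2 = 1 → g.natDegree = n) ∧ (η.1 * η.2 ≠ 1 → 2 * n ≤ g.natDegree) := by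
  have hsq := isSquare_root_sq_sub_four_iff hℓ hm hi hη
  have : Fact (Irreducible h) := ⟨hi⟩
  have : Fact (Irreducible g) := ⟨hg⟩
  have h2 := two_ne_zero_of_ne_two hℓ
  let pbh := AdjoinRoot.powerBasis hi.ne_zero
  let pbg := AdjoinRoot.powerBasis hg.ne_zero
  have : FiniteDimensional (ZMod ℓ) (AdjoinRoot h) := pbh.finite
  have : FiniteDimensional (ZMod ℓ) (AdjoinRoot g) := pbg.finite
  have hLd : Module.finrank (ZMod ℓ) (AdjoinRoot h) = n := by rw [← hn]; exact pbh.finrank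
  have hEd : Module.finrank (ZMod ℓ) (AdjoinRoot g) = g.natDegree := pbg.finrank
  set θ := AdjoinRoot.root g with hθ
  have hgθ : aeval θ g = 0 := by rw [hθ, AdjoinRoot.aeval_eq, AdjoinRoot.mk_self]
  have hfθ : aeval θ (recip n h) = 0 := by
    obtain ⟨k, hk⟩ := hgf
    rw [hk, map_mul, hgθ, zero_mul]
  have hθ0 : θ ≠ 0 := by
    intro h0
    rw [h0, aeval_def, eval₂_at_zero, coeff_zero_recip hm hn, map_one] at hfθ
    exact one_ne_zero hfθ
  have hhθ : aeval (θ + θ⁻¹) h = 0 := by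
    rw [aeval_recip hn.le (mul_inv_cancel₀ hθ0) (inv_mul_cancel₀ hθ0)] at hfθ
    exact (mul_eq_zero.1 hfθ).resolve_left (pow_ne_zero _ hθ0)
  -- A root θ of g satisfies θ² - αθ + 1 = 0 over the field of h, with discriminant α² - 4 = (θ -
  -- θ⁻¹)². Hence θ lies in that field exactly when this is a square there.
  let ι : AdjoinRoot h →ₐ[ZMod ℓ] AdjoinRoot g := AdjoinRoot.liftAlgHom h (Algebra.ofId _ _)
    (θ + θ⁻¹) hhθ
  have hι : ι (AdjoinRoot.root h) = θ + θ⁻¹ := AdjoinRoot.liftAlgHom_root _ _ _ hhθ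
  have hιi : Function.Injective ι := ι.toRingHom.injective
  have hsurj : (∃ x, ι x = θ) ↔ Function.Surjective ι := by
    refine ⟨fun ⟨x, hx⟩ y => ?_, fun hs => hs θ⟩
    obtain ⟨p, rfl⟩ := AdjoinRoot.mk_surjective y
    refine ⟨aeval x p, ?_⟩
    rw [← Polynomial.aeval_algHom_apply, hx, hθ, AdjoinRoot.aeval_eq]
  have hθe : (θ - θ⁻¹) ^ 2 = ι (AdjoinRoot.root h ^ 2 - 4) := by
    rw [map_sub, map_pow, hι, map_ofNat]
    field_simp
    ring
  constructor
  · intro hη1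
    obtain ⟨s, hs⟩ := hsq.2 hη1
    have hfac : (θ - θ⁻¹ - ι s) * (θ - θ⁻¹ + ι s) = 0 := by
      have : ι s * ι s = (θ - θ⁻¹) ^ 2 := by rw [hθe, hs, map_mul]
      linear_combination -this
    have h2E : (algebraMap (ZMod ℓ) (AdjoinRoot g) 2⁻¹) * 2 = 1 := by
      rw [← map_ofNat (algebraMap (ZMod ℓ) (AdjoinRoot g)) 2, ← map_mul, inv_mul_cancel₀ h2, map_one]
    have hx : ∃ x, ι x = θ := by
      rcases mul_eq_zero.1 hfac with h0 | h0
      · refine ⟨algebraMap (ZMod ℓ) _ 2⁻¹ * (AdjoinRoot.root h + s), ?_⟩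
        rw [map_mul, map_add, hι, AlgHom.commutes]
        linear_combination θ * h2E - algebraMap (ZMod ℓ) (AdjoinRoot g) 2⁻¹ * h0
      · refine ⟨algebraMap (ZMod ℓ) _ 2⁻¹ * (AdjoinRoot.root h - s), ?_⟩
        rw [map_mul, map_sub, hι, AlgHom.commutes]
        linear_combination θ * h2E - algebraMap (ZMod ℓ) (AdjoinRoot g) 2⁻¹ * h0
    have := (LinearEquiv.ofBijective ι.toLinearMap ⟨hιi, hsurj.1 hx⟩).finrank_eq
    rw [← hEd, ← this, hLd]
  · intro hη1
    have hns : ¬ Function.Surjective ι := by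
      intro hs
      obtain ⟨x, hx⟩ := hs (θ - θ⁻¹)
      refine hη1 (hsq.1 ⟨x, hιi ?_⟩)
      rw [← hθe, map_mul, hx, sq]
    let := ι.toRingHom.toAlgebra
    have : IsScalarTower (ZMod ℓ) (AdjoinRoot h) (AdjoinRoot g) :=
      IsScalarTower.of_algebraMap_eq fun x => (ι.commutes x).symm
    have : FiniteDimensional (AdjoinRoot h) (AdjoinRoot g) :=
      FiniteDimensional.right (ZMod ℓ) _ _
    have ht := Module.finrank_mul_finrank (ZMod ℓ) (AdjoinRoot h) (AdjoinRoot g)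
    rw [hLd, hEd] at ht
    have h0 : Module.finrank (AdjoinRoot h) (AdjoinRoot g) ≠ 0 := Module.finrank_pos.ne'
    have h1 : Module.finrank (AdjoinRoot h) (AdjoinRoot g) ≠ 1 := by
      intro h1
      rw [h1, mul_one] at ht
      have hle : Module.finrank (ZMod ℓ) (AdjoinRoot h) = Module.finrank (ZMod ℓ) (AdjoinRoot g) := by
        rw [hLd, hEd, ht]
      exact hns ((LinearMap.injective_iff_surjective_of_finrank_eq_finrank hle
        (f := ι.toLinearMap)).1 hιi)
    rw [← ht, mul_comm]
    exact Nat.mul_le_mul_left _ (by omega)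

theorem irreducible_recip (hℓ : ℓ ≠ 2) {n : ℕ} {h : (ZMod ℓ)[X]} (hm : h.Monic)
    (hn : h.natDegree = n) (hi : Irreducible h) {η : ℤˣ × ℤˣ} (hη : HasClass η h)
    (hD : η.1 * η.2 = -1) : Irreducible (recip n h) := by
  obtain ⟨hfm, hfd⟩ := recip_monic hm hn
  have hn0 : 0 < n := hn ▸ hi.natDegree_pos
  obtain ⟨g, hgm, hg, hgf⟩ := exists_monic_irreducible_factor (recip n h) (by
    intro hu
    have := natDegree_eq_zero_of_isUnit hu
    omega)
  have hd := (natDegree_of_irreducible_dvd_recip hℓ hm hn hi hη hg hgf).2 (by rw [hD]; decide)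
  rwa [eq_of_monic_of_dvd_of_natDegree_le hgm hfm hgf (by rw [hfd]; exact hd)]

/-- For `h` irreducible of degree `n`, with a square for the product of the values at `2` and `-2`,
`recip n h` is the product of two irreducible polynomials of degree `n`. -/
theorem exists_factors_recip (hℓ : ℓ ≠ 2) {n : ℕ} {h : (ZMod ℓ)[X]} (hm : h.Monic)
    (hn : h.natDegree = n) (hi : Irreducible h) {η : ℤˣ × ℤˣ} (hη : HasClass η h)
    (hD : η.1 * η.2 = 1) : ∃ p q : (ZMod ℓ)[X], p.Monic ∧ Irreducible p ∧ q.Monic ∧ Irreducible q ∧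
      p ≠ q ∧ p.natDegree = n ∧ q.natDegree = n ∧ recip n h = p * q := by
  obtain ⟨hfm, hfd⟩ := recip_monic hm hn
  have hn0 : 0 < n := hn ▸ hi.natDegree_pos
  obtain ⟨p, hpm, hp, q, hq⟩ := exists_monic_irreducible_factor (recip n h) (by
    intro hu
    have := natDegree_eq_zero_of_isUnit hu
    omega)
  have hpd := (natDegree_of_irreducible_dvd_recip hℓ hm hn hi hη hp ⟨q, hq⟩).1 hD
  have hqm : q.Monic := hpm.of_mul_monic_left (hq ▸ hfm)
  have hqd : q.natDegree = n := by
    have := hpm.natDegree_mul hqm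
    rw [← hq, hfd, hpd] at this
    omega
  obtain ⟨r, hrm, hr, hrq⟩ := exists_monic_irreducible_factor q (by
    intro hu
    have := natDegree_eq_zero_of_isUnit hu
    omega)
  have hrd := (natDegree_of_irreducible_dvd_recip hℓ hm hn hi hη hr
    (hrq.trans ⟨p, by rw [hq, mul_comm]⟩)).1 hD
  have hrq' : q = r := eq_of_monic_of_dvd_of_natDegree_le hrm hqm hrq (by omega)
  have hqi : Irreducible q := hrq' ▸ hr
  refine ⟨p, q, hpm, hp, hqm, hqi, ?_, hpd, hqd, hq⟩
  rintro rfl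
  have hsep := separable_recip hm hn hn0
    (PerfectField.separable_of_irreducible hi) hη.eval_ne_zero.1 hη.eval_ne_zero.2
  rw [hq] at hsep
  exact hp.not_isUnit (hsep.squarefree p dvd_rfl)

end Irreducible

/-! ### Counting irreducible polynomials with prescribed classes of values -/

section CharacterSum

variable {L : Type*} [Field L] [Fintype L] [DecidableEq L]

/-- The substitution x = 4y - 2 turns the sum into χ(-1) times the Jacobi sum of χ with itself,
which is -χ(-1) because χ is its own inverse. -/
theorem sum_quadraticChar_mul (hL : ringChar L ≠ 2) :
    ∑ x : L, quadraticChar L (2 - x) * quadraticChar L (-2 - x) = -1 := by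
  have h2 : (2 : L) ≠ 0 := Ring.two_ne_zero hL
  have h4 : (4 : L) ≠ 0 := by
    have : (4 : L) = 2 * 2 := by norm_num
    rw [this]; exact mul_ne_zero h2 h2
  have hJ := jacobiSum_nontrivial_inv (quadraticChar_ne_one hL)
  rw [(quadraticChar_isQuadratic L).inv] at hJ
  have e : ∑ x : L, quadraticChar L (2 - x) * quadraticChar L (-2 - x) =
      ∑ x : L, quadraticChar L (-1) * (quadraticChar L x * quadraticChar L (1 - x)) := by
    symm
    refine Fintype.sum_bijective (fun x => 4 * x - 2)
      ⟨fun x y h => mul_left_cancel₀ h4 (sub_left_injective h),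
        fun y => ⟨(y + 2) / 4, by field_simp; ring⟩⟩ _ _ fun x => ?_
    have e1 : (2 - (4 * x - 2) : L) = 2 ^ 2 * (1 - x) := by ring
    have e2 : (-2 - (4 * x - 2) : L) = 2 ^ 2 * (-1 * x) := by ring
    rw [e1, e2, map_mul, map_mul, map_mul, quadraticChar_sq_one' h2]
    ring
  have hm : quadraticChar L (-1) * quadraticChar L (-1) = 1 := by
    rw [← sq, quadraticChar_sq_one (neg_ne_zero.2 one_ne_zero)]
  rw [e, ← Finset.mul_sum]
  rw [jacobiSum] at hJ
  rw [hJ]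
  linear_combination -hm

/-- Lower bound for the number of `x` with prescribed quadratic characters of `2 - x` and
`-2 - x`. -/
theorem card_le_card_quadraticChar (hL : ringChar L ≠ 2) (a b : ℤˣ) :
    (Fintype.card L : ℤ) ≤ 4 * (Finset.univ.filter fun x : L =>
      quadraticChar L (2 - x) = a ∧ quadraticChar L (-2 - x) = b).card + 5 := by
  set S := Finset.univ.filter fun x : L =>
      quadraticChar L (2 - x) = a ∧ quadraticChar L (-2 - x) = b
  have h1 : ∑ x : L, quadraticChar L (2 - x) = 0 := by
    rw [← quadraticChar_sum_zero hL]
    exact (Equiv.subLeft (2 : L)).sum_comp (quadraticChar L)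
  have h2 : ∑ x : L, quadraticChar L (-2 - x) = 0 := by
    rw [← quadraticChar_sum_zero hL]
    exact (Equiv.subLeft (-2 : L)).sum_comp (quadraticChar L)
  -- Away from x = ±2 the product is 4 on S and 0 elsewhere; at each of these two points it is at
  -- most 2. With ab ≤ 1 this accounts for the constant 5.
  have hsum : ∑ x : L, (1 + a * quadraticChar L (2 - x)) * (1 + b * quadraticChar L (-2 - x)) =
      Fintype.card L - a * b := by
    have : ∀ x : L, (1 + (a : ℤ) * quadraticChar L (2 - x)) * (1 + b * quadraticChar L (-2 - x)) =
        1 + a * quadraticChar L (2 - x) + b * quadraticChar L (-2 - x) +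
          (a * b) * (quadraticChar L (2 - x) * quadraticChar L (-2 - x)) := fun x => by ring
    simp only [this, Finset.sum_add_distrib, ← Finset.mul_sum, h1, h2, sum_quadraticChar_mul hL]
    simp
    ring
  have hab : (a : ℤ) * b ≤ 1 := by
    rcases Int.units_eq_one_or a with rfl | rfl <;> rcases Int.units_eq_one_or b with rfl | rfl <;>
      simp
  have hle : ∀ x : L, (1 + (a : ℤ) * quadraticChar L (2 - x)) * (1 + b * quadraticChar L (-2 - x)) ≤
      (if x ∈ S then 4 else 0) + ((if x = 2 then 2 else 0) + if x = -2 then 2 else 0) := by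
    intro x
    have hnn : ∀ P : Prop, ∀ [Decidable P], (0 : ℤ) ≤ if P then 2 else 0 := by
      intro P _; split_ifs <;> norm_num
    have hnn4 : (0 : ℤ) ≤ if x ∈ S then 4 else 0 := by split_ifs <;> norm_num
    have hu : ∀ (u : ℤˣ) (y : L), (u : ℤ) * quadraticChar L y ≤ 1 ∧
        -1 ≤ (u : ℤ) * quadraticChar L y := by
      intro u y
      rcases eq_or_ne y 0 with rfl | hy
      · simp
      · rcases quadraticChar_dichotomy hy with h | h <;>
          rcases Int.units_eq_one_or u with rfl | rfl <;> simp [h]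
    by_cases hx2 : 2 - x = 0
    · rw [hx2, MulChar.map_zero, mul_zero, add_zero, one_mul,
        if_pos (show x = 2 from (sub_eq_zero.1 hx2).symm)]
      have := (hu b (-2 - x)).1
      have := hnn (x = -2)
      linarith
    by_cases hx3 : -2 - x = 0
    · rw [hx3, MulChar.map_zero, mul_zero, add_zero, mul_one,
        if_pos (show x = -2 from (sub_eq_zero.1 hx3).symm)]
      have := (hu a (2 - x)).1
      have := hnn (x = 2)
      linarith
    have hpos := add_nonneg hnn4 (add_nonneg (hnn (x = 2)) (hnn (x = -2)))
    by_cases hS : x ∈ S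
    · rw [if_pos hS] at hpos ⊢
      have h3 := hu a (2 - x)
      have h5 := hu b (-2 - x)
      have := hnn (x = 2)
      have := hnn (x = -2)
      nlinarith
    · refine le_trans (le_of_eq ?_) hpos
      simp only [S, Finset.mem_filter, Finset.mem_univ, true_and, not_and_or] at hS
      rcases hS with hS | hS
      · have : 1 + (a : ℤ) * quadraticChar L (2 - x) = 0 := by
          rcases quadraticChar_dichotomy hx2 with h | h <;>
            rcases Int.units_eq_one_or a with rfl | rfl <;> simp_all
        rw [this, zero_mul]
      · have : 1 + (b : ℤ) * quadraticChar L (-2 - x) = 0 := by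
          rcases quadraticChar_dichotomy hx3 with h | h <;>
            rcases Int.units_eq_one_or b with rfl | rfl <;> simp_all
        rw [this, mul_zero]
  have := Finset.sum_le_sum fun x (_ : x ∈ Finset.univ) => hle x
  rw [hsum, Finset.sum_add_distrib, Finset.sum_add_distrib, Finset.sum_ite_eq' ,
    Finset.sum_ite_eq', Finset.sum_ite_mem, Finset.univ_inter, Finset.sum_const, nsmul_eq_mul] at this
  simp only [Finset.mem_univ, if_true] at this
  linarith

end CharacterSum

/-! ### Irreducible polynomials as minimal polynomials of field elements -/

section Minpoly

theorem norm_algebraMap_sub_eq_eval_minpoly {K L : Type*} [Field K] [Field L] [Algebra K L]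
    [FiniteDimensional K L] {x : L} (hx : (minpoly K x).natDegree = Module.finrank K L) (a : K) :
    Algebra.norm K (algebraMap K L a - x) = (minpoly K x).eval a := by
  have hd : minpoly K x ∣ (Algebra.lmul K L x).charpoly := by
    refine minpoly.dvd K x ?_
    have := LinearMap.aeval_self_charpoly (Algebra.lmul K L x)
    rw [aeval_algHom_apply] at this
    exact Algebra.lmul_injective (this.trans (map_zero _).symm)
  have e := eq_of_monic_of_dvd_of_natDegree_le (minpoly.monic (Algebra.IsIntegral.isIntegral x))
    (LinearMap.charpoly_monic _) hd (by rw [LinearMap.charpoly_natDegree, hx])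
  rw [← e, LinearMap.eval_charpoly, Algebra.norm_apply, map_sub]
  congr 1
  ext y
  simp [Algebra.smul_def]

variable {ℓ : ℕ} [Fact ℓ.Prime]

/-- An element of degree e < d lies in a subfield of ℓ^e elements, hence is a root of X^(ℓ^e) - X.
-/
theorem card_minpoly_natDegree_ne_le {L : Type*} [Field L] [Fintype L] [Algebra (ZMod ℓ) L]
    {d : ℕ} (hd : Module.finrank (ZMod ℓ) L = d) :
    (Finset.univ.filter fun x : L => (minpoly (ZMod ℓ) x).natDegree ≠ d).card ≤
      d * ℓ ^ (d - 1) := by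
  classical
  have hℓ1 : 1 < ℓ := (Fact.out : ℓ.Prime).one_lt
  have : FiniteDimensional (ZMod ℓ) L := Module.Finite.of_finite
  have hsub : (Finset.univ.filter fun x : L => (minpoly (ZMod ℓ) x).natDegree ≠ d) ⊆
      (Finset.range d).biUnion fun e => (X ^ ℓ ^ e - X : L[X]).roots.toFinset.filter fun _ => e ≠ 0 := by
    intro x hx
    have hx' := (Finset.mem_filter.1 hx).2
    have hint := Algebra.IsIntegral.isIntegral (R := ZMod ℓ) x
    have hle : (minpoly (ZMod ℓ) x).natDegree ≤ d := hd ▸ minpoly.natDegree_le x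
    have hpos := minpoly.natDegree_pos hint
    refine Finset.mem_biUnion.2 ⟨_, Finset.mem_range.2 (lt_of_le_of_ne hle hx'), ?_⟩
    refine Finset.mem_filter.2 ⟨?_, hpos.ne'⟩
    have h1 : 1 < ℓ ^ (minpoly (ZMod ℓ) x).natDegree := Nat.one_lt_pow hpos.ne' hℓ1
    rw [Multiset.mem_toFinset, mem_roots (FiniteField.X_pow_card_sub_X_ne_zero L h1), IsRoot.def,
      eval_sub, eval_pow, eval_X, sub_eq_zero]
    set M := IntermediateField.adjoin (ZMod ℓ) {x}
    have := Fintype.ofFinite M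
    have hc : Fintype.card M = ℓ ^ (minpoly (ZMod ℓ) x).natDegree := by
      rw [Module.card_eq_pow_finrank (K := ZMod ℓ), ZMod.card,
        IntermediateField.adjoin.finrank hint]
    have := FiniteField.pow_card (IntermediateField.AdjoinSimple.gen (ZMod ℓ) x)
    rw [hc] at this
    exact congrArg (fun y : M => (y : L)) this
  refine (Finset.card_le_card hsub).trans (Finset.card_biUnion_le.trans ?_)
  have : ∀ e ∈ Finset.range d, ((X ^ ℓ ^ e - X : L[X]).roots.toFinset.filter fun _ => e ≠ 0).card ≤
      ℓ ^ (d - 1) := by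
    intro e he
    have hed := Finset.mem_range.1 he
    by_cases he0 : e = 0
    · simp [he0]
    · refine (Finset.card_filter_le _ _).trans ((Multiset.toFinset_card_le _).trans
        ((card_roots' _).trans ?_))
      rw [FiniteField.X_pow_card_sub_X_natDegree_eq L (Nat.one_lt_pow he0 hℓ1)]
      exact Nat.pow_le_pow_right hℓ1.le (by omega)
  refine (Finset.sum_le_sum this).trans ?_
  simp

/-- If x generates the field of ℓ^d elements, the values of its minimal polynomial at ±2 are the
norms of ±2 - x, so its class is given by the characters of 2 - x and -2 - x. About a quarter of all
x have prescribed characters, few of them lie in a smaller field, and each polynomial comes from at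
most d elements. -/
theorem exists_irreducible_hasClass (hℓ : ℓ ≠ 2) {d : ℕ} (hd : 0 < d) (η : ℤˣ × ℤˣ) :
    ∃ R : Finset (ZMod ℓ)[X],
      (∀ r ∈ R, r.Monic ∧ r.natDegree = d ∧ Irreducible r ∧ HasClass η r) ∧
      ℓ ^ d ≤ 4 * (d * R.card + d * ℓ ^ (d - 1)) + 5 := by
  classical
  let L := GaloisField ℓ d
  have := Fintype.ofFinite L
  have : FiniteDimensional (ZMod ℓ) L := Module.Finite.of_finite
  have hfr : Module.finrank (ZMod ℓ) L = d := GaloisField.finrank ℓ hd.ne'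
  have hch : CharP L ℓ := charP_of_injective_algebraMap (algebraMap (ZMod ℓ) L).injective ℓ
  have hL : ringChar L ≠ 2 := by rwa [ringChar.eq L ℓ]
  set S := Finset.univ.filter fun x : L =>
      quadraticChar L (2 - x) = η.1 ∧ quadraticChar L (-2 - x) = η.2 with hS
  set T := S.filter fun x => (minpoly (ZMod ℓ) x).natDegree = d with hT
  have hST : S.card ≤ T.card + d * ℓ ^ (d - 1) := by
    rw [← Finset.card_filter_add_card_filter_not (s := S)
      (fun x => (minpoly (ZMod ℓ) x).natDegree = d)]
    refine Nat.add_le_add_left ((Finset.card_le_card ?_).trans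
      (card_minpoly_natDegree_ne_le hfr)) _
    exact Finset.filter_subset_filter _ (Finset.subset_univ _)
  refine ⟨T.image (minpoly (ZMod ℓ)), fun r hr => ?_, ?_⟩
  · obtain ⟨x, hx, rfl⟩ := Finset.mem_image.1 hr
    obtain ⟨hxS, hxd⟩ := Finset.mem_filter.1 hx
    obtain ⟨-, h1, h2⟩ := Finset.mem_filter.1 hxS
    have hint := Algebra.IsIntegral.isIntegral (R := ZMod ℓ) x
    refine ⟨minpoly.monic hint, hxd, minpoly.irreducible hint, ?_, ?_⟩
    · rw [← norm_algebraMap_sub_eq_eval_minpoly (hxd.trans hfr.symm), quadraticChar_norm hℓ,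
        map_ofNat, ← h1]
    · rw [← norm_algebraMap_sub_eq_eval_minpoly (hxd.trans hfr.symm), quadraticChar_norm hℓ,
        map_neg, map_ofNat, ← h2]
  · have h1 := card_le_card_quadraticChar hL η.1 η.2
    have hcard : Fintype.card L = ℓ ^ d := by
      rw [Module.card_eq_pow_finrank (K := ZMod ℓ), ZMod.card, hfr]
    rw [hcard] at h1
    have h2 : T.card ≤ d * (T.image (minpoly (ZMod ℓ))).card := by
      refine Finset.card_le_mul_card_image T d fun r hr => ?_
      obtain ⟨x, hx, rfl⟩ := Finset.mem_image.1 hr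
      obtain ⟨hxS, hxd⟩ := Finset.mem_filter.1 hx
      have hint := Algebra.IsIntegral.isIntegral (R := ZMod ℓ) x
      have hne : (minpoly (ZMod ℓ) x).map (algebraMap (ZMod ℓ) L) ≠ 0 :=
        (Polynomial.map_ne_zero (minpoly.ne_zero hint))
      refine (Finset.card_le_card (t := ((minpoly (ZMod ℓ) x).aroots L).toFinset) ?_).trans
        ((Multiset.toFinset_card_le _).trans ((card_roots' _).trans ?_))
      · intro y hy
        rw [Multiset.mem_toFinset, mem_aroots', ← (Finset.mem_filter.1 hy).2]
        exact ⟨by rw [(Finset.mem_filter.1 hy).2]; exact hne, minpoly.aeval _ _⟩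
      · rw [natDegree_map, hxd]
    have h3 : (ℓ ^ d : ℤ) ≤ 4 * (d * (T.image (minpoly (ZMod ℓ))).card + d * ℓ ^ (d - 1)) + 5 := by
      push_cast at h1
      have : (S.card : ℤ) ≤ d * (T.image (minpoly (ZMod ℓ))).card + d * ℓ ^ (d - 1) := by
        exact_mod_cast hST.trans (Nat.add_le_add_right h2 _)
      linarith
    exact_mod_cast h3

end Minpoly

/-! ### Asymptotic lower bounds for numbers of monic polynomials -/

section Monics

variable {ℓ : ℕ} [Fact ℓ.Prime]

open Classical in
/-- The monic polynomials of degree `m`. -/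
def monics (ℓ : ℕ) [Fact ℓ.Prime] (m : ℕ) : Finset (ZMod ℓ)[X] :=
  Finset.univ.image fun c : Fin m → ZMod ℓ => X ^ m + ∑ i, C (c i) * X ^ (i : ℕ)

theorem degree_sum_C_mul_X_pow_lt {m : ℕ} (c : Fin m → ZMod ℓ) :
    (∑ i, C (c i) * X ^ (i : ℕ) : (ZMod ℓ)[X]).degree < (m : WithBot ℕ) := by
  refine (degree_sum_le _ _).trans_lt ((Finset.sup_lt_iff (WithBot.bot_lt_coe m)).2 fun i _ => ?_)
  exact (degree_C_mul_X_pow_le _ _).trans_lt (WithBot.coe_lt_coe.2 i.2)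

theorem mem_monics {m : ℕ} {h : (ZMod ℓ)[X]} : h ∈ monics ℓ m ↔ h.Monic ∧ h.natDegree = m := by
  classical
  rw [monics, Finset.mem_image]
  constructor
  · rintro ⟨c, -, rfl⟩
    have := degree_sum_C_mul_X_pow_lt c
    refine ⟨monic_X_pow_add this, ?_⟩
    rw [← degree_X_pow (R := ZMod ℓ) m] at this
    rw [natDegree_add_eq_left_of_degree_lt this, natDegree_X_pow]
  · rintro ⟨hm, hd⟩
    refine ⟨fun i => h.coeff i, Finset.mem_univ _, ?_⟩
    conv_rhs => rw [hm.as_sum, hd]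
    rw [Fin.sum_univ_eq_sum_range (fun i => C (h.coeff i) * X ^ i)]

theorem card_monics (m : ℕ) : (monics ℓ m).card = ℓ ^ m := by
  classical
  rw [monics, Finset.card_image_of_injective]
  · simp
  · intro c c' h
    have h' : (∑ i, C (c i) * X ^ (i : ℕ) : (ZMod ℓ)[X]) = ∑ i, C (c' i) * X ^ (i : ℕ) :=
      add_left_cancel h
    funext i
    have := congrArg (fun p => coeff p i) h'
    simpa [finsetSum_coeff, coeff_C_mul, coeff_X_pow, Fin.val_inj] using this

open Classical in
theorem card_filter_eval_eq_zero_le {m : ℕ} (hm : 0 < m) (a : ZMod ℓ) :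
    ((monics ℓ m).filter fun h => h.eval a = 0).card ≤ ℓ ^ (m - 1) := by
  rw [← card_monics (ℓ := ℓ) (m - 1)]
  refine (Finset.card_le_card (t := (monics ℓ (m - 1)).image fun q => (X - C a) * q) ?_).trans
    Finset.card_image_le
  intro h hh
  obtain ⟨hh, h0⟩ := Finset.mem_filter.1 hh
  obtain ⟨hmon, hd⟩ := mem_monics.1 hh
  obtain ⟨q, rfl⟩ := dvd_iff_isRoot.2 h0
  have hq : q.Monic := (monic_X_sub_C a).of_mul_monic_left hmon
  rw [(monic_X_sub_C a).natDegree_mul hq, natDegree_X_sub_C] at hd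
  exact Finset.mem_image.2 ⟨q, mem_monics.2 ⟨hq, by omega⟩, rfl⟩

open Classical in
-- A multiple of the square of a monic polynomial of degree e + 1 is given by that polynomial and
-- the cofactor, at most ℓ^(m - e - 1) choices, and fewer than m values of e occur.
theorem card_filter_not_squarefree_le (m : ℕ) :
    ((monics ℓ m).filter fun h => ¬ Squarefree h).card ≤ m * ℓ ^ (m - 1) := by
  have hℓ1 : 1 ≤ ℓ := (Fact.out : ℓ.Prime).one_le
  have hsub : ((monics ℓ m).filter fun h => ¬ Squarefree h) ⊆
      (Finset.range m).biUnion fun e => if 2 * (e + 1) ≤ m then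
        ((monics ℓ (e + 1)) ×ˢ (monics ℓ (m - 2 * (e + 1)))).image fun x => x.1 * x.1 * x.2
        else ∅ := by
    intro h hh
    obtain ⟨hh, h0⟩ := Finset.mem_filter.1 hh
    obtain ⟨hmon, hd⟩ := mem_monics.1 hh
    rw [squarefree_iff_irreducible_sq_not_dvd_of_ne_zero hmon.ne_zero] at h0
    push Not at h0
    obtain ⟨p, hp, hpd⟩ := h0
    have hn : (normalize p).Monic := monic_normalize hp.ne_zero
    have hnd : normalize p * normalize p ∣ h := by
      exact ((normalize_associated p).mul_mul (normalize_associated p)).dvd_iff_dvd_left.2 hpd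
    obtain ⟨q, rfl⟩ := hnd
    have hq : q.Monic := (hn.mul hn).of_mul_monic_left hmon
    rw [(hn.mul hn).natDegree_mul hq, hn.natDegree_mul hn] at hd
    have hpos : 0 < (normalize p).natDegree :=
      ((normalize_associated p).symm.irreducible hp).natDegree_pos
    refine Finset.mem_biUnion.2 ⟨(normalize p).natDegree - 1, Finset.mem_range.2 (by omega), ?_⟩
    rw [if_pos (by omega)]
    exact Finset.mem_image.2 ⟨(normalize p, q), Finset.mem_product.2
      ⟨mem_monics.2 ⟨hn, (Nat.sub_add_cancel hpos).symm⟩,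
        mem_monics.2 ⟨hq, by dsimp only; omega⟩⟩, rfl⟩
  refine (Finset.card_le_card hsub).trans (Finset.card_biUnion_le.trans ?_)
  refine (Finset.sum_le_card_nsmul _ _ (ℓ ^ (m - 1)) fun e _ => ?_).trans (by simp)
  split_ifs with he
  · refine Finset.card_image_le.trans ?_
    rw [Finset.card_product, card_monics, card_monics, ← pow_add]
    exact Nat.pow_le_pow_right hℓ1 (by omega)
  · simp

/-- The number of distinct monic irreducible divisors of degree `d`. -/
theorem mul_card_irreducible_dvd_le {K : Type*} [Field K] {g : K[X]} (hg : g ≠ 0) {d : ℕ}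
    {D : Finset K[X]} (hD : ∀ r ∈ D, r.Monic ∧ Irreducible r ∧ r.natDegree = d ∧ r ∣ g) :
    d * D.card ≤ g.natDegree := by
  have hdvd : ∏ r ∈ D, r ∣ g := by
    refine Finset.prod_dvd_of_coprime (fun r hr s hs hrs => ?_) fun r hr => (hD r hr).2.2.2
    refine (hD r hr).2.1.coprime_iff_not_dvd.2 fun h => hrs ?_
    exact eq_of_monic_of_associated (hD r hr).1 (hD s hs).1
      ((hD r hr).2.1.associated_of_dvd (hD s hs).2.1 h)
  have := natDegree_le_of_dvd hdvd hg
  rw [natDegree_prod_of_monic _ _ fun r hr => (hD r hr).1,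
    Finset.sum_congr rfl fun r hr => (hD r hr).2.2.1] at this
  simpa [mul_comm] using this

end Monics

/-! ### Families of polynomials of positive density -/

section Abundant

/-- There are at least `w ℓ ^ m - C ℓ ^ (m - 1)` monic polynomials of degree `m` over `ZMod ℓ`
with the property `P` which do not vanish at `2` and `-2`. -/
def Abundant (m : ℕ) (w : ℝ) (P : ∀ (ℓ : ℕ) [Fact ℓ.Prime], (ZMod ℓ)[X] → Prop) : Prop :=
  ∃ C : ℝ, 0 ≤ C ∧ ∀ (ℓ : ℕ) [Fact ℓ.Prime], ℓ ≠ 2 → ∃ A : Finset (ZMod ℓ)[X],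
    (∀ h ∈ A, h.Monic ∧ h.natDegree = m ∧ h.eval 2 ≠ 0 ∧ h.eval (-2) ≠ 0 ∧ P ℓ h) ∧
      (w - C / ℓ) * (ℓ : ℝ) ^ m ≤ A.card

variable {m : ℕ} {w : ℝ} {P P' : ∀ (ℓ : ℕ) [Fact ℓ.Prime], (ZMod ℓ)[X] → Prop}

theorem Abundant.mono (h : Abundant m w P) {w' : ℝ} (hw : w' ≤ w)
    (hP : ∀ (ℓ : ℕ) [Fact ℓ.Prime] (h : (ZMod ℓ)[X]), ℓ ≠ 2 → h.Monic → h.natDegree = m →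
      h.eval 2 ≠ 0 → h.eval (-2) ≠ 0 → P ℓ h → P' ℓ h) : Abundant m w' P' := by
  obtain ⟨C, hC, H⟩ := h
  refine ⟨C, hC, fun ℓ _ hℓ => ?_⟩
  obtain ⟨A, hA, hc⟩ := H ℓ hℓ
  refine ⟨A, fun h hh => ?_, le_trans ?_ hc⟩
  · obtain ⟨h1, h2, h3, h4, h5⟩ := hA h hh
    exact ⟨h1, h2, h3, h4, hP ℓ h hℓ h1 h2 h3 h4 h5⟩
  · gcongr

theorem Abundant.or (h : Abundant m w P) {w' : ℝ} (h' : Abundant m w' P')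
    (hd : ∀ (ℓ : ℕ) [Fact ℓ.Prime] (h : (ZMod ℓ)[X]), h.Monic → h.natDegree = m →
      P ℓ h → ¬ P' ℓ h) : Abundant m (w + w') (fun ℓ _ h => P ℓ h ∨ P' ℓ h) := by
  classical
  obtain ⟨C, hC, H⟩ := h
  obtain ⟨C', hC', H'⟩ := h'
  refine ⟨C + C', add_nonneg hC hC', fun ℓ _ hℓ => ?_⟩
  obtain ⟨A, hA, hc⟩ := H ℓ hℓ
  obtain ⟨A', hA', hc'⟩ := H' ℓ hℓ
  refine ⟨A ∪ A', fun h hh => ?_, ?_⟩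
  · rcases Finset.mem_union.1 hh with hh | hh
    · obtain ⟨h1, h2, h3, h4, h5⟩ := hA h hh
      exact ⟨h1, h2, h3, h4, Or.inl h5⟩
    · obtain ⟨h1, h2, h3, h4, h5⟩ := hA' h hh
      exact ⟨h1, h2, h3, h4, Or.inr h5⟩
  · rw [Finset.card_union_of_disjoint]
    · push_cast
      rw [add_div]
      linarith
    · rw [Finset.disjoint_left]
      intro h hh hh'
      exact hd ℓ h (hA h hh).1 (hA h hh).2.1 (hA h hh).2.2.2.2 (hA' h hh').2.2.2.2

theorem Abundant.zero : Abundant m 0 P :=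
  ⟨0, le_rfl, fun ℓ _ _ => ⟨∅, by simp, by simp⟩⟩

theorem Abundant.exists_mem {ι : Type*} (s : Finset ι) {w : ι → ℝ}
    {P : ι → ∀ (ℓ : ℕ) [Fact ℓ.Prime], (ZMod ℓ)[X] → Prop} (h : ∀ i ∈ s, Abundant m (w i) (P i))
    (hd : ∀ i ∈ s, ∀ k ∈ s, i ≠ k → ∀ (ℓ : ℕ) [Fact ℓ.Prime] (h : (ZMod ℓ)[X]), h.Monic →
      h.natDegree = m → P i ℓ h → ¬ P k ℓ h) :
    Abundant m (∑ i ∈ s, w i) (fun ℓ _ h => ∃ i ∈ s, P i ℓ h) := by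
  classical
  induction s using Finset.induction_on with
  | empty => simpa using Abundant.zero
  | insert i s hi ih =>
    rw [Finset.sum_insert hi]
    refine ((h i (Finset.mem_insert_self _ _)).or (ih
      (fun k hk => h k (Finset.mem_insert_of_mem hk)) fun k hk k' hk' =>
        hd k (Finset.mem_insert_of_mem hk) k' (Finset.mem_insert_of_mem hk')) ?_).mono le_rfl ?_
    · rintro ℓ _ h hm hn hP ⟨k, hk, hPk⟩
      exact hd i (Finset.mem_insert_self _ _) k (Finset.mem_insert_of_mem hk)
        (fun h => hi (h ▸ hk)) ℓ h hm hn hP hPk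
    · rintro ℓ _ h - - - - - (hP | ⟨k, hk, hP⟩)
      · exact ⟨i, Finset.mem_insert_self _ _, hP⟩
      · exact ⟨k, Finset.mem_insert_of_mem hk, hP⟩

/-- Polynomials with a repeated factor only enter the error term. -/
theorem Abundant.squarefree (h : Abundant m w P) :
    Abundant m w (fun ℓ _ h => P ℓ h ∧ Squarefree h) := by
  classical
  obtain ⟨C, hC, H⟩ := h
  refine ⟨C + m, by positivity, fun ℓ _ hℓ => ?_⟩
  have hℓ0 : (0 : ℝ) < ℓ := by exact_mod_cast (Fact.out : ℓ.Prime).pos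
  obtain ⟨A, hA, hc⟩ := H ℓ hℓ
  refine ⟨A.filter Squarefree, fun h hh => ?_, ?_⟩
  · obtain ⟨hh, hs⟩ := Finset.mem_filter.1 hh
    obtain ⟨h1, h2, h3, h4, h5⟩ := hA h hh
    exact ⟨h1, h2, h3, h4, h5, hs⟩
  · have h1 : A.card ≤ (A.filter Squarefree).card + m * ℓ ^ (m - 1) := by
      rw [← Finset.card_filter_add_card_filter_not (s := A) Squarefree]
      refine Nat.add_le_add_left ((Finset.card_le_card ?_).trans
        (card_filter_not_squarefree_le m)) _
      exact Finset.filter_subset_filter _ fun h hh =>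
        mem_monics.2 ⟨(hA h hh).1, (hA h hh).2.1⟩
    have h2 : (A.card : ℝ) ≤ (A.filter Squarefree).card + m * ℓ ^ (m - 1) := by exact_mod_cast h1
    have h3 : (m * ℓ ^ (m - 1) : ℝ) = m / ℓ * ℓ ^ m := by
      rcases m with _ | m
      · simp
      · rw [Nat.add_sub_cancel, pow_succ]; field_simp
    rw [h3] at h2
    rw [add_div]
    linarith

theorem abundant_true (m : ℕ) : Abundant m 1 (fun _ _ _ => True) := by
  classical
  refine ⟨2, by norm_num, fun ℓ _ hℓ => ?_⟩
  have hℓ0 : (0 : ℝ) < ℓ := by exact_mod_cast (Fact.out : ℓ.Prime).pos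
  rcases Nat.eq_zero_or_pos m with rfl | hm
  · refine ⟨{1}, by simp, ?_⟩
    have : (0 : ℝ) ≤ 2 / ℓ := by positivity
    simp [this]
  · refine ⟨(monics ℓ m).filter fun h => h.eval 2 ≠ 0 ∧ h.eval (-2) ≠ 0, fun h hh => ?_, ?_⟩
    · obtain ⟨hh, h1, h2⟩ := Finset.mem_filter.1 hh
      exact ⟨(mem_monics.1 hh).1, (mem_monics.1 hh).2, h1, h2, trivial⟩
    · have h1 := card_filter_eval_eq_zero_le (ℓ := ℓ) hm 2
      have h2 := card_filter_eval_eq_zero_le (ℓ := ℓ) hm (-2)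
      have h3 : (monics ℓ m).card ≤
          ((monics ℓ m).filter fun h => h.eval 2 ≠ 0 ∧ h.eval (-2) ≠ 0).card +
            (((monics ℓ m).filter fun h => h.eval 2 = 0).card +
              ((monics ℓ m).filter fun h => h.eval (-2) = 0).card) := by
        rw [← Finset.card_filter_add_card_filter_not (s := monics ℓ m)
          (fun h => h.eval 2 ≠ 0 ∧ h.eval (-2) ≠ 0)]
        refine Nat.add_le_add_left ((Finset.card_le_card ?_).trans (Finset.card_union_le _ _)) _
        intro h hh
        obtain ⟨hh, h0⟩ := Finset.mem_filter.1 hh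
        rw [Finset.mem_union, Finset.mem_filter, Finset.mem_filter]
        tauto
      rw [card_monics] at h3
      have h4 : (ℓ ^ m : ℝ) ≤
          ((monics ℓ m).filter fun h => h.eval 2 ≠ 0 ∧ h.eval (-2) ≠ 0).card +
            (ℓ ^ (m - 1) + ℓ ^ (m - 1)) := by
        exact_mod_cast h3.trans (Nat.add_le_add_left (Nat.add_le_add h1 h2) _)
      have h5 : (ℓ : ℝ) ^ m = ℓ ^ (m - 1) * ℓ := by
        rw [← pow_succ, Nat.sub_add_cancel hm]
      have h6 : (1 - 2 / ℓ : ℝ) * ℓ ^ m = ℓ ^ m - 2 * ℓ ^ (m - 1) := by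
        rw [h5]; field_simp
      rw [h6]
      linarith

theorem exists_irreducible_hasClass' {ℓ : ℕ} [Fact ℓ.Prime] (hℓ : ℓ ≠ 2) {d : ℕ} (hd : 0 < d)
    (η : ℤˣ × ℤˣ) : ∃ R : Finset (ZMod ℓ)[X],
      (∀ r ∈ R, r.Monic ∧ r.natDegree = d ∧ Irreducible r ∧ HasClass η r) ∧
      (1 / (4 * d) - (4 * d + 5) / ℓ) * (ℓ : ℝ) ^ d ≤ R.card := by
  obtain ⟨R, hR, hc⟩ := exists_irreducible_hasClass hℓ hd η
  refine ⟨R, hR, ?_⟩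
  have hℓ1 : (1 : ℝ) ≤ ℓ := by exact_mod_cast (Fact.out : ℓ.Prime).one_le
  have hd1 : (1 : ℝ) ≤ d := by exact_mod_cast hd
  have h1 : (ℓ ^ d : ℝ) ≤ 4 * (d * R.card + d * ℓ ^ (d - 1)) + 5 := by exact_mod_cast hc
  have h2 : (1 : ℝ) ≤ ℓ ^ (d - 1) := one_le_pow₀ hℓ1
  have h3 : (ℓ : ℝ) ^ d = ℓ ^ (d - 1) * ℓ := by rw [← pow_succ, Nat.sub_add_cancel hd]
  have h4 : (1 / (4 * d) - (4 * d + 5) / ℓ) * (ℓ : ℝ) ^ d =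
      1 / (4 * d) * ℓ ^ d - (4 * d + 5) * ℓ ^ (d - 1) := by
    rw [h3]; field_simp
  rw [h4, sub_le_iff_le_add, div_mul_eq_mul_div, one_mul, div_le_iff₀ (by positivity)]
  nlinarith [mul_nonneg (sub_nonneg.2 hd1) (sub_nonneg.2 h2), sq_nonneg ((d : ℝ)),
    mul_le_mul_of_nonneg_right hd1 (zero_le_one.trans h2)]

/-- The lower bounds a - b and c - d may be negative, so they cannot simply be multiplied; when
either is negative, the left side is at most 0. -/
theorem sub_le_mul_of_le {a b c d x y : ℝ} (ha : 0 ≤ a) (hb : 0 ≤ b) (hc : 0 ≤ c) (hd : 0 ≤ d)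
    (hx : 0 ≤ x) (hy : 0 ≤ y) (hxa : a - b ≤ x) (hyc : c - d ≤ y) :
    a * c - (b * c + a * d) ≤ x * y := by
  rcases le_total a b with h | h
  · nlinarith [mul_nonneg (sub_nonneg.2 h) hc, mul_nonneg ha hd, mul_nonneg hx hy]
  rcases le_total c d with h' | h'
  · nlinarith [mul_nonneg (sub_nonneg.2 h') ha, mul_nonneg hb hc, mul_nonneg hx hy]
  · nlinarith [mul_le_mul hxa hyc (sub_nonneg.2 h') hx, mul_nonneg hb hd]

/-- Classes have exponent 2, so a factor s of class θ is paired with irreducible r of class ηθ, of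
which there are about ℓ^d/(4d) whatever θ is. A product of degree m + d < (k + 1)d has at most k
monic irreducible divisors of degree d, and r determines s, so each product arises at most k times.
-/
theorem Abundant.mul_irreducible (h : Abundant m w P) (hw : 0 ≤ w) {d k : ℕ} (hd : 0 < d)
    (hk : 0 < k) (hmd : m + d < (k + 1) * d) (η : ℤˣ × ℤˣ) :
    Abundant (m + d) (w / (4 * d * k)) (fun ℓ _ h => HasClass η h ∧
      ∃ (s r : (ZMod ℓ)[X]) (θ : ℤˣ × ℤˣ), s.Monic ∧ s.natDegree = m ∧ P ℓ s ∧ HasClass θ s ∧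
        r.Monic ∧ r.natDegree = d ∧ Irreducible r ∧ HasClass (η * θ) r ∧ h = s * r) := by
  classical
  obtain ⟨C, hC, H⟩ := h
  refine ⟨(C * (1 / (4 * d)) + w * (4 * d + 5)) / k, by positivity, fun ℓ _ hℓ => ?_⟩
  have hℓ0 : (0 : ℝ) < ℓ := by exact_mod_cast (Fact.out : ℓ.Prime).pos
  have hd0 : (0 : ℝ) < d := by exact_mod_cast hd
  have hk0 : (0 : ℝ) < k := by exact_mod_cast hk
  obtain ⟨A, hA, hc⟩ := H ℓ hℓ
  choose R hR hRc using fun η => exists_irreducible_hasClass' (ℓ := ℓ) hℓ hd η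
  have hcls : ∀ s : A, ∃ θ, HasClass θ s.1 := fun s =>
    exists_hasClass (hA s.1 s.2).2.2.1 (hA s.1 s.2).2.2.2.1
  choose θ hθ using hcls
  let T : Finset (Σ _ : A, (ZMod ℓ)[X]) := Finset.univ.sigma fun s => R (η * θ s)
  have hT : ∀ x ∈ T, x.2 ∈ R (η * θ x.1) := fun x hx => (Finset.mem_sigma.1 hx).2
  have hηθ : ∀ θ : ℤˣ × ℤˣ, θ * (η * θ) = η := fun θ => by
    rw [mul_comm η, ← mul_assoc]
    have : θ * θ = 1 := Prod.ext (Int.units_mul_self _) (Int.units_mul_self _)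
    rw [this, one_mul]
  let μ : (Σ _ : A, (ZMod ℓ)[X]) → (ZMod ℓ)[X] := fun x => x.1.1 * x.2
  have hdeg : ∀ x ∈ T, (μ x).Monic ∧ (μ x).natDegree = m + d := by
    intro x hx
    have h1 := hA x.1.1 x.1.2
    have h2 := hR _ _ (hT x hx)
    exact ⟨h1.1.mul h2.1, by rw [h1.1.natDegree_mul h2.1, h1.2.1, h2.2.1]⟩
  have hcard : T.card ≤ k * (T.image μ).card := by
    refine Finset.card_le_mul_card_image T k fun g hg => ?_
    obtain ⟨x₀, hx₀, rfl⟩ := Finset.mem_image.1 hg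
    have hinj : Set.InjOn (fun x : (Σ _ : A, (ZMod ℓ)[X]) => x.2)
        (T.filter fun x => μ x = μ x₀ : Finset (Σ _ : A, (ZMod ℓ)[X])) := by
      rintro ⟨s, r⟩ hx ⟨s', r'⟩ hx' (rfl : r = r')
      have hx := Finset.mem_filter.1 (Finset.mem_coe.1 hx)
      have hx' := Finset.mem_filter.1 (Finset.mem_coe.1 hx')
      have e : s.1 * r = s'.1 * r := hx.2.trans hx'.2.symm
      have hr0 : r ≠ 0 := (hR _ _ (hT _ hx.1)).1.ne_zero
      obtain rfl : s = s' := Subtype.ext (mul_right_cancel₀ hr0 e)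
      rfl
    rw [← Finset.card_image_of_injOn hinj]
    have := mul_card_irreducible_dvd_le (hdeg x₀ hx₀).1.ne_zero (d := d)
      (D := (T.filter fun x => μ x = μ x₀).image fun x => x.2) (by
        intro r hr
        obtain ⟨x, hx, rfl⟩ := Finset.mem_image.1 hr
        obtain ⟨hxT, hxe⟩ := Finset.mem_filter.1 hx
        have h2 := hR _ _ (hT x hxT)
        exact ⟨h2.1, h2.2.2.1, h2.2.1, hxe ▸ Dvd.intro_left _ rfl⟩)
    rw [(hdeg x₀ hx₀).2] at this
    by_contra! hlt
    have h3 := Nat.mul_le_mul_left d (Nat.succ_le_of_lt hlt)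
    rw [Nat.succ_eq_add_one, mul_comm] at h3
    omega
  refine ⟨T.image μ, fun g hg => ?_, ?_⟩
  · obtain ⟨x, hx, rfl⟩ := Finset.mem_image.1 hg
    have h1 := hA x.1.1 x.1.2
    have h2 := hR _ _ (hT x hx)
    have hc : HasClass η (μ x) := by
      have := (hθ x.1).mul h2.2.2.2
      rwa [hηθ] at this
    exact ⟨(hdeg x hx).1, (hdeg x hx).2, hc.eval_ne_zero.1, hc.eval_ne_zero.2, hc, x.1.1, x.2,
      θ x.1, h1.1, h1.2.1, h1.2.2.2.2, hθ x.1, h2.1, h2.2.1, h2.2.2.1, h2.2.2.2, rfl⟩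
  · have h1 : (T.card : ℝ) ≤ k * (T.image μ).card := by exact_mod_cast hcard
    have h2 : (A.card : ℝ) * ((1 / (4 * d) - (4 * d + 5) / ℓ) * (ℓ : ℝ) ^ d) ≤ T.card := by
      rw [Finset.card_sigma]
      push_cast
      have := Finset.sum_le_sum fun (s : A) (_ : s ∈ Finset.univ) => hRc (η * θ s)
      simpa using this
    have hA1 : (w - C / ℓ) ≤ A.card / (ℓ : ℝ) ^ m := by
      rwa [le_div_iff₀ (by positivity)]
    have h3 : A.card / (ℓ : ℝ) ^ m * max 0 (1 / (4 * d) - (4 * d + 5) / ℓ : ℝ) ≤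
        T.card / (ℓ : ℝ) ^ (m + d) := by
      rcases le_total 0 (1 / (4 * d) - (4 * d + 5) / ℓ : ℝ) with h | h
      · rw [max_eq_right h, le_div_iff₀ (by positivity), pow_add]
        refine le_trans (le_of_eq ?_) h2
        field_simp
      · rw [max_eq_left h, mul_zero]
        positivity
    have h4 := sub_le_mul_of_le hw (div_nonneg hC hℓ0.le)
      (show (0 : ℝ) ≤ 1 / (4 * d) by positivity)
      (show (0 : ℝ) ≤ (4 * d + 5) / ℓ by positivity)
      (show (0 : ℝ) ≤ A.card / (ℓ : ℝ) ^ m by positivity) (le_max_left 0 _) hA1 (le_max_right 0 _)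
    have h5 := h4.trans h3
    rw [le_div_iff₀ (by positivity)] at h5
    have h6 := h5.trans h1
    rw [← div_le_iff₀' hk0] at h6
    refine le_trans (le_of_eq ?_) h6
    field_simp

/-- The strict inequality leaves room for the losses of order 1/ℓ in the family and in the number of
units. -/
theorem Abundant.eventually {n : ℕ} (h : Abundant n w P) {a t : ℝ} (ha : 0 ≤ a) (ht : t < a * w) :
    ∃ ℓ₀ : ℕ, ∀ (ℓ : ℕ) [Fact ℓ.Prime], ℓ₀ ≤ ℓ → ℓ ≠ 2 → ∃ A : Finset (ZMod ℓ)[X],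
      (∀ h ∈ A, h.Monic ∧ h.natDegree = n ∧ h.eval 2 ≠ 0 ∧ h.eval (-2) ≠ 0 ∧ P ℓ h) ∧
        t ≤ a * (A.card / (ℓ : ℝ) ^ n) * (1 - n / ℓ) := by
  obtain ⟨C, hC, H⟩ := h
  have hlim : Filter.Tendsto (fun ℓ : ℕ => a * (w - C / (ℓ : ℝ)) * (1 - n / (ℓ : ℝ)))
      Filter.atTop (nhds (a * (w - 0) * (1 - 0))) :=
    ((tendsto_const_nhds.sub (tendsto_const_div_atTop_nhds_zero_nat C)).const_mul a).mul
      (tendsto_const_nhds.sub (tendsto_const_div_atTop_nhds_zero_nat (n : ℝ)))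
  rw [sub_zero, sub_zero, mul_one] at hlim
  obtain ⟨ℓ₀, hℓ₀⟩ := Filter.eventually_atTop.1
    ((hlim.eventually (lt_mem_nhds ht)).and (Filter.eventually_ge_atTop n))
  refine ⟨ℓ₀, fun ℓ _ hℓ hℓ2 => ?_⟩
  have hℓ0 : (0 : ℝ) < ℓ := by exact_mod_cast (Fact.out : ℓ.Prime).pos
  obtain ⟨A, hA, hc⟩ := H ℓ hℓ2
  refine ⟨A, hA, (hℓ₀ ℓ hℓ).1.le.trans ?_⟩
  have hn : (n : ℝ) / ℓ ≤ 1 := by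
    rw [div_le_one hℓ0]; exact_mod_cast (hℓ₀ ℓ hℓ).2
  have : w - C / ℓ ≤ A.card / (ℓ : ℝ) ^ n := by rwa [le_div_iff₀ (by positivity)]
  have h1 : 0 ≤ 1 - (n : ℝ) / ℓ := sub_nonneg.2 hn
  gcongr

end Abundant

/-! ### Two primes between `n` and `2 n` -/

section Primes

theorem succ_pow_six_le_two_pow {s : ℕ} (hs : 33 ≤ s) : (s + 1) ^ 6 ≤ 2 ^ (s - 2) := by
  induction s, hs using Nat.le_induction with
  | base => norm_num
  | succ s hs ih =>
    have h1 : 34 * (s + 1 + 1) ≤ 35 * (s + 1) := by omega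
    have h2 := Nat.pow_le_pow_left h1 6
    rw [mul_pow, mul_pow] at h2
    have h3 : (s + 1 + 1) ^ 6 ≤ 2 * (s + 1) ^ 6 := by
      generalize (s + 1 + 1) ^ 6 = a at *
      generalize (s + 1) ^ 6 = b at *
      norm_num at h2
      omega
    rw [show s + 1 - 2 = s - 2 + 1 by omega, pow_succ 2, mul_comm]
    exact h3.trans (Nat.mul_le_mul_left 2 ih)

/-- With s the integer square root of 2m, one has 2m ≤ (s + 1)². After cubing, it remains to compare
(s + 1)^(6(s + 2)) with 2^((s - 2)(s + 2)) ≤ 4^m. The threshold 545 is the least m with 33² ≤ 2m. -/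
theorem mul_pow_sqrt_le_four_pow {m : ℕ} (hm : 545 ≤ m) :
    m * (2 * m * ((2 * m) ^ Nat.sqrt (2 * m) * 4 ^ (2 * m / 3))) ≤ 4 ^ m := by
  set s := Nat.sqrt (2 * m) with hs
  have hs33 : 33 ≤ s := by rw [hs, Nat.le_sqrt]; omega
  have hs1 : 2 * m ≤ (s + 1) ^ 2 := by
    rw [sq]; exact (Nat.lt_succ_sqrt (2 * m)).le
  have hs2 : s * s ≤ 2 * m := Nat.sqrt_le _
  have h1 : m * (2 * m * ((2 * m) ^ s * 4 ^ (2 * m / 3))) ≤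
      ((s + 1) ^ 2) ^ (s + 2) * 4 ^ (2 * m / 3) := by
    calc m * (2 * m * ((2 * m) ^ s * 4 ^ (2 * m / 3)))
        ≤ 2 * m * (2 * m * ((2 * m) ^ s * 4 ^ (2 * m / 3))) := by gcongr; omega
      _ = (2 * m) ^ (s + 2) * 4 ^ (2 * m / 3) := by ring
      _ ≤ _ := by gcongr
  refine h1.trans ((Nat.pow_le_pow_iff_left (n := 3) (by norm_num)).1 ?_)
  have h2 : (((s + 1) ^ 2) ^ (s + 2)) ^ 3 ≤ 4 ^ m := by
    calc (((s + 1) ^ 2) ^ (s + 2)) ^ 3 = ((s + 1) ^ 6) ^ (s + 2) := by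
          rw [← pow_mul, ← pow_mul, ← pow_mul]; ring_nf
      _ ≤ (2 ^ (s - 2)) ^ (s + 2) := Nat.pow_le_pow_left (succ_pow_six_le_two_pow hs33) _
      _ = 2 ^ ((s - 2) * (s + 2)) := (pow_mul _ _ _).symm
      _ ≤ 2 ^ (2 * m) := by
          refine Nat.pow_le_pow_right two_pos (le_trans ?_ hs2)
          obtain ⟨k, hk⟩ : ∃ k, s = k + 2 := ⟨s - 2, by omega⟩
          rw [hk, Nat.add_sub_cancel]
          nlinarith
      _ = 4 ^ m := by rw [pow_mul]; norm_num
  have h3 : (4 ^ (2 * m / 3)) ^ 3 ≤ 4 ^ (2 * m) := by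
    rw [← pow_mul]
    exact Nat.pow_le_pow_right (by norm_num) (Nat.div_mul_le_self _ _)
  calc (((s + 1) ^ 2) ^ (s + 2) * 4 ^ (2 * m / 3)) ^ 3
      = (((s + 1) ^ 2) ^ (s + 2)) ^ 3 * (4 ^ (2 * m / 3)) ^ 3 := mul_pow _ _ _
    _ ≤ 4 ^ m * 4 ^ (2 * m) := Nat.mul_le_mul h2 h3
    _ = (4 ^ m) ^ 3 := by rw [← pow_add, ← pow_mul]; ring_nf

/-- An upper bound for the central binomial coefficient if there is at most one prime between `m`
and `2 m`. -/
theorem centralBinom_le_of_unique_prime {m q : ℕ} (hm : 2 < m) (hq : m < q)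
    (h : ∀ p : ℕ, p.Prime → m < p → p ≤ 2 * m → p = q) :
    m.centralBinom ≤ 2 * m * ((2 * m) ^ Nat.sqrt (2 * m) * 4 ^ (2 * m / 3)) := by
  have n2_pos : 1 ≤ 2 * m := by omega
  set f : ℕ → ℕ := fun x => x ^ m.centralBinom.factorization x with hf
  have hf1 : ∀ p, ¬ p.Prime → f p = 1 := fun p hp => by
    rw [hf]; dsimp only; rw [Nat.factorization_eq_zero_of_not_prime _ hp, pow_zero]
  have hf2 : ∀ p, f p ≤ 2 * m := fun p => Nat.pow_factorization_choose_le (by omega)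
  set S := (Finset.range (2 * m / 3 + 1)).filter Nat.Prime with hS
  have hqS : q ∉ S := by
    rw [hS, Finset.mem_filter, Finset.mem_range]
    omega
  -- Primes in (2m/3, m] do not divide the binomial coefficient, and q is the only prime that may
  -- occur above m. In S, primes up to the square root of 2m contribute at most 2m each; the others
  -- occur at most once and are bounded by the primorial.
  have hprod : m.centralBinom ≤ f q * ∏ p ∈ S, f p := by
    rw [← Finset.prod_insert hqS]
    conv_lhs => rw [← m.prod_pow_factorization_centralBinom]
    refine le_of_eq_of_le (Finset.prod_subset (s₁ := (Finset.range (2 * m + 1)) ∩ insert q S)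
      Finset.inter_subset_left fun p hp hpS => ?_).symm
      (Finset.prod_le_prod_of_subset_of_one_le' Finset.inter_subset_right fun p hp _ => ?_)
    · by_cases hpp : p.Prime
      · have hpS' : p ∉ insert q S := fun h => hpS (Finset.mem_inter.2 ⟨hp, h⟩)
        rw [Finset.mem_insert, not_or, hS, Finset.mem_filter, Finset.mem_range] at hpS'
        have hpq := hpS'.1
        have hp3 : ¬ p < 2 * m / 3 + 1 := fun h => hpS'.2 ⟨h, hpp⟩
        rw [Finset.mem_range] at hp
        have hpm : p ≤ m := by
          by_contra! hlt
          exact hpq (h p hpp hlt (by omega))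
        rw [Nat.factorization_centralBinom_of_two_mul_self_lt_three_mul hm hpm (by omega), pow_zero]
      · exact hf1 p hpp
    · rcases Nat.eq_zero_or_pos p with rfl | hp0
      · exact (hf1 0 Nat.not_prime_zero).ge
      · exact Nat.one_le_pow _ _ hp0
  refine hprod.trans (Nat.mul_le_mul (hf2 q) ?_)
  rw [← Finset.prod_filter_mul_prod_filter_not S (· ≤ Nat.sqrt (2 * m))]
  refine Nat.mul_le_mul ?_ ?_
  · refine (Finset.prod_le_prod' fun p _ => hf2 p).trans ?_
    have : (Finset.Icc 1 (Nat.sqrt (2 * m))).card = Nat.sqrt (2 * m) := by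
      rw [Nat.card_Icc, Nat.add_sub_cancel]
    rw [Finset.prod_const]
    refine pow_right_mono₀ n2_pos ((Finset.card_le_card fun x hx => ?_).trans this.le)
    obtain ⟨h1, h2⟩ := Finset.mem_filter.1 hx
    exact Finset.mem_Icc.mpr ⟨(Finset.mem_filter.1 h1).2.one_lt.le, h2⟩
  · refine le_trans ?_ (primorial_le_four_pow (2 * m / 3))
    refine (Finset.prod_le_prod' fun p hp => (?_ : f p ≤ p)).trans ?_
    · obtain ⟨h1, h2⟩ := Finset.mem_filter.1 hp
      refine (pow_right_mono₀ (Finset.mem_filter.1 h1).2.one_lt.le ?_).trans (pow_one p).le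
      exact Nat.factorization_choose_le_one (Nat.sqrt_lt'.mp <| not_le.1 h2)
    refine Finset.prod_le_prod_of_subset_of_one_le' (Finset.filter_subset _ _) ?_
    exact fun p hp _ => (Finset.mem_filter.1 hp).2.one_lt.le

/-- Erdős' proof of Bertrand's postulate tolerates one exceptional prime: it costs a single factor
2m, still incompatible with 4^m < m · C(2m, m) once m ≥ 545. For smaller m, each listed pair p < q
serves all m with q/2 ≤ m < p. -/
theorem exists_two_primes {m : ℕ} (hm : 6 ≤ m) :
    ∃ p q : ℕ, p.Prime ∧ q.Prime ∧ p ≠ q ∧ m < p ∧ m < q ∧ p ≤ 2 * m ∧ q ≤ 2 * m := by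
  rcases lt_or_ge m 545 with hlt | hge
  · have key : ∀ p q : ℕ, p.Prime → q.Prime → p < q → m < p → q ≤ 2 * m →
        ∃ p q : ℕ, p.Prime ∧ q.Prime ∧ p ≠ q ∧ m < p ∧ m < q ∧ p ≤ 2 * m ∧ q ≤ 2 * m :=
      fun p q hp hq hpq h1 h2 => ⟨p, q, hp, hq, hpq.ne, h1, h1.trans hpq, hpq.le.trans h2, h2⟩
    rcases lt_or_ge m 7 with h | h
    · exact key 7 11 (by norm_num) (by norm_num) (by norm_num) h (by omega)
    rcases lt_or_ge m 11 with h | h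
    · exact key 11 13 (by norm_num) (by norm_num) (by norm_num) h (by omega)
    rcases lt_or_ge m 17 with h | h
    · exact key 17 19 (by norm_num) (by norm_num) (by norm_num) h (by omega)
    rcases lt_or_ge m 29 with h | h
    · exact key 29 31 (by norm_num) (by norm_num) (by norm_num) h (by omega)
    rcases lt_or_ge m 47 with h | h
    · exact key 47 53 (by norm_num) (by norm_num) (by norm_num) h (by omega)
    rcases lt_or_ge m 83 with h | h
    · exact key 83 89 (by norm_num) (by norm_num) (by norm_num) h (by omega)
    rcases lt_or_ge m 157 with h | h
    · exact key 157 163 (by norm_num) (by norm_num) (by norm_num) h (by omega)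
    rcases lt_or_ge m 311 with h | h
    · exact key 311 313 (by norm_num) (by norm_num) (by norm_num) h (by omega)
    · exact key 617 619 (by norm_num) (by norm_num) (by norm_num) (by omega) (by omega)
  · obtain ⟨q, hq, hmq, hq2⟩ := Nat.exists_prime_lt_and_le_two_mul m (by omega)
    by_contra! hcon
    have := centralBinom_le_of_unique_prime (by omega) hmq fun p hp hmp hp2 => by
      by_contra hne
      exact absurd (hcon p q hp hq hne hmp hmq hp2) (not_lt.2 hq2)
    have h1 := Nat.four_pow_lt_mul_centralBinom m (by omega)
    have h2 := (Nat.mul_le_mul_left m this).trans (mul_pow_sqrt_le_four_pow hge)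
    omega

/-- Two primes in (n/2, n] give a sum of at least 2/n. Below 12 a single prime p < 6n/7 suffices,
except for n = 3, where 2 and 3 are used. -/
theorem exists_primes_sum_gt {n : ℕ} (hn : 3 ≤ n) : ∃ T : Finset ℕ,
    (∀ p ∈ T, p.Prime ∧ n < 2 * p ∧ p ≤ n) ∧ (7 / (6 * n) : ℝ) < ∑ p ∈ T, (1 / p : ℝ) := by
  have hn0 : (0 : ℝ) < n := by exact_mod_cast (by omega : 0 < n)
  have two : ∀ p q : ℕ, p.Prime → q.Prime → p ≠ q → n < 2 * p → n < 2 * q → p ≤ n → q ≤ n →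
      ∃ T : Finset ℕ, (∀ p ∈ T, p.Prime ∧ n < 2 * p ∧ p ≤ n) ∧
        (7 / (6 * n) : ℝ) < ∑ p ∈ T, (1 / p : ℝ) := by
    intro p q hp hq hpq h1 h2 h3 h4
    refine ⟨{p, q}, ?_, ?_⟩
    · intro r hr
      rcases Finset.mem_insert.1 hr with rfl | hr
      · exact ⟨hp, h1, h3⟩
      · rw [Finset.mem_singleton.1 hr]; exact ⟨hq, h2, h4⟩
    · rw [Finset.sum_pair hpq]
      have hp0 : (0 : ℝ) < p := by exact_mod_cast hp.pos
      have hq0 : (0 : ℝ) < q := by exact_mod_cast hq.pos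
      have e1 : (1 / n : ℝ) ≤ 1 / p := one_div_le_one_div_of_le hp0 (by exact_mod_cast h3)
      have e2 : (1 / n : ℝ) ≤ 1 / q := one_div_le_one_div_of_le hq0 (by exact_mod_cast h4)
      have e3 : (7 / (6 * n) : ℝ) = 7 / 6 * (1 / n) := by field_simp
      have e4 : (0 : ℝ) < 1 / n := by positivity
      rw [e3]
      linarith
  have one : ∀ p : ℕ, p.Prime → n < 2 * p → 7 * p < 6 * n →
      ∃ T : Finset ℕ, (∀ p ∈ T, p.Prime ∧ n < 2 * p ∧ p ≤ n) ∧
        (7 / (6 * n) : ℝ) < ∑ p ∈ T, (1 / p : ℝ) := by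
    intro p hp h1 h2
    refine ⟨{p}, ?_, ?_⟩
    · intro r hr
      rw [Finset.mem_singleton.1 hr]; exact ⟨hp, h1, by omega⟩
    · rw [Finset.sum_singleton]
      have hp0 : (0 : ℝ) < p := by exact_mod_cast hp.pos
      rw [div_lt_div_iff₀ (by positivity) hp0]
      have : (7 * p : ℝ) < 6 * n := by exact_mod_cast h2
      linarith
  rcases lt_or_ge n 12 with hlt | hge
  · interval_cases n
    · exact two 2 3 (by norm_num) (by norm_num) (by norm_num) (by norm_num) (by norm_num)
        (by norm_num) (by norm_num)
    · exact one 3 (by norm_num) (by norm_num) (by norm_num)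
    · exact one 3 (by norm_num) (by norm_num) (by norm_num)
    · exact one 5 (by norm_num) (by norm_num) (by norm_num)
    · exact one 5 (by norm_num) (by norm_num) (by norm_num)
    · exact one 5 (by norm_num) (by norm_num) (by norm_num)
    · exact one 7 (by norm_num) (by norm_num) (by norm_num)
    · exact one 7 (by norm_num) (by norm_num) (by norm_num)
    · exact one 7 (by norm_num) (by norm_num) (by norm_num)
  · obtain ⟨p, q, hp, hq, hpq, h1, h2, h3, h4⟩ := exists_two_primes (m := n / 2) (by omega)
    exact two p q hp hq hpq (by omega) (by omega) (by omega) (by omega)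

end Primes

/-! ### The polynomials associated with the four families -/

section Families

variable {m : ℕ} {w : ℝ}

theorem Abundant.classes {S : Finset (ℤˣ × ℤˣ)}
    {P : ℤˣ × ℤˣ → ∀ (ℓ : ℕ) [Fact ℓ.Prime], (ZMod ℓ)[X] → Prop}
    (h : ∀ η ∈ S, Abundant m w (fun ℓ _ h => HasClass η h ∧ P η ℓ h)) :
    Abundant m (S.card * w) (fun ℓ _ h => ∃ η ∈ S, HasClass η h ∧ P η ℓ h) := by
  rw [← nsmul_eq_mul, ← Finset.sum_const]
  exact Abundant.exists_mem S (P := fun η ℓ _ h => HasClass η h ∧ P η ℓ h) h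
    fun η _ θ _ hne ℓ _ h _ _ hη hθ => hne (hη.1.unique hθ.1)

theorem abundant_irreducible {d : ℕ} (hd : 0 < d) (η : ℤˣ × ℤˣ) :
    Abundant d (1 / (4 * d)) (fun _ _ h => HasClass η h ∧ Irreducible h) := by
  refine ⟨4 * d + 5, by positivity, fun ℓ _ hℓ => ?_⟩
  obtain ⟨R, hR, hc⟩ := exists_irreducible_hasClass' hℓ hd η
  refine ⟨R, fun r hr => ?_, hc⟩
  obtain ⟨h1, h2, h3, h4⟩ := hR r hr
  exact ⟨h1, h2, h4.eval_ne_zero.1, h4.eval_ne_zero.2, h4, h3⟩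

theorem card_classes_mul_eq (u : ℤˣ) :
    (Finset.univ.filter fun η : ℤˣ × ℤˣ => η.1 * η.2 = u).card = 2 := by
  revert u
  decide

theorem abundant_linear (u : ℤˣ) :
    Abundant 1 (1 / 2) (fun _ _ h => ∃ η : ℤˣ × ℤˣ, η.1 * η.2 = u ∧ HasClass η h) := by
  have := Abundant.classes (S := Finset.univ.filter fun η : ℤˣ × ℤˣ => η.1 * η.2 = u)
    fun η _ => abundant_irreducible one_pos η
  rw [card_classes_mul_eq] at this
  refine this.mono (by norm_num) ?_
  rintro ℓ _ h - - - - - ⟨η, hη, hc, -⟩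
  exact ⟨η, (Finset.mem_filter.1 hη).2, hc⟩

theorem abundant_irreducible_quadratic :
    Abundant 2 (1 / 2) (fun _ _ h => Irreducible h) := by
  have := Abundant.classes (S := (Finset.univ : Finset (ℤˣ × ℤˣ)))
    fun η _ => abundant_irreducible two_pos η
  refine this.mono ?_ ?_
  · rw [show (Finset.univ : Finset (ℤˣ × ℤˣ)).card = 4 from by decide]
    norm_num
  · rintro ℓ _ h - - - - - ⟨η, -, -, hi⟩
    exact hi

/-- Serves the split case with ℓ ≡ 3 mod 4: both factors have class product -1, so both transforms
are irreducible, while the whole has class product 1. The fibre bound 2 is needed for n = 2, where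
both factors are linear. -/
theorem abundant_mul_of_neg {n : ℕ} (hn : 2 ≤ n) {η : ℤˣ × ℤˣ} (hη : η.1 * η.2 = 1) :
    Abundant n (1 / (16 * (n - 1))) (fun ℓ _ h => HasClass η h ∧
      ∃ (s r : (ZMod ℓ)[X]) (θ θ' : ℤˣ × ℤˣ), s.Monic ∧ s.natDegree = 1 ∧ HasClass θ s ∧
        θ.1 * θ.2 = -1 ∧ r.Monic ∧ r.natDegree = n - 1 ∧ Irreducible r ∧ HasClass θ' r ∧
        θ'.1 * θ'.2 = -1 ∧ h = s * r) := by
  obtain ⟨d, rfl⟩ : ∃ d, n = 1 + d := ⟨n - 1, by omega⟩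
  have hd : 0 < d := by omega
  have := (abundant_linear (-1)).mul_irreducible (by norm_num) (d := d) (k := 2) hd two_pos
    (by omega) η
  refine this.mono (le_of_eq ?_) ?_
  · have : (d : ℝ) ≠ 0 := by exact_mod_cast hd.ne'
    push_cast
    rw [add_sub_cancel_left]
    field_simp
    norm_num
  · rintro ℓ _ h - - - - - ⟨hc, s, r, θ, hs, hsd, ⟨θ', hD, hθ'⟩, hθ, hr, hrd, hri, hrc, rfl⟩
    obtain rfl := hθ.unique hθ'
    refine ⟨hc, s, r, θ, _, hs, hsd, hθ, hD, hr, by omega, hri, hrc, ?_, rfl⟩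
    rw [Prod.fst_mul, Prod.snd_mul, mul_mul_mul_comm, hη, hD, one_mul]

/-- All irreducible factors of the self-reciprocal polynomial associated with `k` have odd
degree. -/
def OddSplit {ℓ : ℕ} [Fact ℓ.Prime] (k : (ZMod ℓ)[X]) : Prop :=
  ∀ p : (ZMod ℓ)[X], Irreducible p → p ∣ recip k.natDegree k → Odd p.natDegree

theorem oddSplit_of_irreducible {ℓ : ℕ} [Fact ℓ.Prime] (hℓ : ℓ ≠ 2) {k : (ZMod ℓ)[X]}
    (hm : k.Monic) (hi : Irreducible k) (hk : Odd k.natDegree) {η : ℤˣ × ℤˣ} (hη : HasClass η k)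
    (hD : η.1 * η.2 = 1) : OddSplit k := fun p hp hpk => by
  rwa [(natDegree_of_irreducible_dvd_recip hℓ hm rfl hi hη hp hpk).1 hD]

theorem OddSplit.mul {ℓ : ℕ} [Fact ℓ.Prime] {k k' : (ZMod ℓ)[X]} (hm : k.Monic) (hm' : k'.Monic)
    (hk : OddSplit k) (hk' : OddSplit k') : OddSplit (k * k') := by
  intro p hp hpk
  rw [hm.natDegree_mul hm', recip_mul le_rfl le_rfl] at hpk
  rcases hp.prime.dvd_or_dvd hpk with h | h
  exacts [hk p hp h, hk' p hp h]

/-- The transform of the linear s is the quadratic factor. The class product of s is chosen equal to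
that of η, which leaves class product 1 for k, so irreducible factors of k with this class product
have transforms that split into two factors of the same degree. For n even, k is irreducible of
degree n - 1; for n odd, it is a linear polynomial times an irreducible one of degree n - 2. -/
theorem exists_abundant_oddSplit {n : ℕ} (hn : 2 ≤ n) (η : ℤˣ × ℤˣ) :
    ∃ w : ℝ, 1 / (10 * n) < 4 * w ∧ Abundant n w (fun ℓ _ h => HasClass η h ∧
      ∃ s k : (ZMod ℓ)[X], s.Monic ∧ s.natDegree = 1 ∧ k.Monic ∧ OddSplit k ∧ h = s * k) := by
  have hD : ∀ θ : ℤˣ × ℤˣ, θ.1 * θ.2 = η.1 * η.2 → (η * θ).1 * (η * θ).2 = 1 := fun θ h => by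
    rw [Prod.fst_mul, Prod.snd_mul, mul_mul_mul_comm, h, Int.units_mul_self]
  rcases Nat.even_or_odd n with he | ho
  · obtain ⟨d, rfl⟩ : ∃ d, n = 1 + d := ⟨n - 1, by omega⟩
    have hd : 0 < d := by omega
    have hodd : Odd d := by
      rw [Nat.even_add] at he
      exact Nat.not_even_iff_odd.1 fun h => Nat.not_even_one (he.2 h)
    refine ⟨_, ?_, ((abundant_linear (η.1 * η.2)).mul_irreducible (by norm_num) (d := d) (k := 2)
      hd two_pos (by omega) η).mono le_rfl ?_⟩
    · have : (0 : ℝ) < d := by exact_mod_cast hd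
      have e : (4 : ℝ) * (1 / 2 / (4 * d * (2 : ℕ))) = 1 / (4 * d) := by
        push_cast; field_simp; norm_num
      rw [e]
      refine one_div_lt_one_div_of_lt (by positivity) ?_
      push_cast
      linarith
    · rintro ℓ _ h hℓ - - - - ⟨hc, s, r, θ, hs, hsd, ⟨θ', hD', hθ'⟩, hθ, hr, hrd, hri, hrc, rfl⟩
      obtain rfl := hθ.unique hθ'
      exact ⟨hc, s, r, hs, hsd, hr, oddSplit_of_irreducible hℓ hr hri (hrd ▸ hodd) hrc
        (hD θ hD'), rfl⟩
  · obtain ⟨d, rfl⟩ : ∃ d, n = 2 + d := ⟨n - 2, by omega⟩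
    have hodd : Odd d := by
      rw [add_comm, Nat.odd_add] at ho
      exact ho.2 even_two
    have hd : 0 < d := hodd.pos
    have h2 : Abundant 2 (1 / 8) (fun ℓ _ h => ∃ θ ∈ Finset.univ.filter
        (fun θ : ℤˣ × ℤˣ => θ.1 * θ.2 = η.1 * η.2), HasClass θ h ∧ ∃ s k : (ZMod ℓ)[X],
          s.Monic ∧ s.natDegree = 1 ∧ k.Monic ∧ OddSplit k ∧ h = s * k) := by
      have := Abundant.classes (S := Finset.univ.filter
        fun θ : ℤˣ × ℤˣ => θ.1 * θ.2 = η.1 * η.2) (m := 2) (w := 1 / 16)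
        (P := fun θ ℓ _ h => ∃ s k : (ZMod ℓ)[X],
          s.Monic ∧ s.natDegree = 1 ∧ k.Monic ∧ OddSplit k ∧ h = s * k) (fun θ hθ => ?_)
      · rw [card_classes_mul_eq] at this
        exact this.mono (by norm_num) fun _ _ _ _ _ _ _ _ h => h
      · refine ((abundant_linear (η.1 * η.2)).mul_irreducible (by norm_num) (d := 1) (k := 2)
          one_pos two_pos (by norm_num) θ).mono (by norm_num) ?_
        rintro ℓ _ h hℓ - - - - ⟨hc, s, r, θ₁, hs, hsd, ⟨θ', hD', hθ'⟩, hθ₁, hr, hrd, hri, hrc, rfl⟩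
        obtain rfl := hθ₁.unique hθ'
        refine ⟨hc, s, r, hs, hsd, hr, oddSplit_of_irreducible hℓ hr hri (hrd ▸ odd_one) hrc ?_, rfl⟩
        rw [Prod.fst_mul, Prod.snd_mul, mul_mul_mul_comm, hD', (Finset.mem_filter.1 hθ).2,
          Int.units_mul_self]
    have main : ∀ k : ℕ, 0 < k → 2 + d < (k + 1) * d → (8 * k * d : ℝ) < 10 * (2 + d) →
        ∃ w : ℝ, 1 / (10 * ((2 + d : ℕ) : ℝ)) < 4 * w ∧ Abundant (2 + d) w (fun ℓ _ h =>
          HasClass η h ∧ ∃ s k : (ZMod ℓ)[X], s.Monic ∧ s.natDegree = 1 ∧ k.Monic ∧ OddSplit k ∧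
            h = s * k) := by
      intro k hk0 hk hlt
      refine ⟨_, ?_, (h2.mul_irreducible (by norm_num) (d := d) (k := k) hd hk0 hk η).mono le_rfl ?_⟩
      · have hd0 : (0 : ℝ) < d := by exact_mod_cast hd
        have hk0' : (0 : ℝ) < k := by exact_mod_cast hk0
        have e : (4 : ℝ) * (1 / 8 / (4 * d * k)) = 1 / (8 * k * d) := by
          field_simp
        rw [e]
        refine one_div_lt_one_div_of_lt (by positivity) ?_
        push_cast
        exact hlt
      · rintro ℓ _ h hℓ - - - - ⟨hc, _, r, θ, -, -, ⟨θ', hD', hθ', s, k, hs, hsd, hk, hko, rfl⟩, hθ,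
          hr, hrd, hri, hrc, rfl⟩
        obtain rfl := hθ.unique hθ'
        refine ⟨hc, s, k * r, hs, hsd, hk.mul hr, hko.mul hk hr (oddSplit_of_irreducible hℓ hr hri
          (hrd ▸ hodd) hrc (hD θ (Finset.mem_filter.1 hD').2)), mul_assoc _ _ _⟩
    -- For n = 3 all three factors are linear and a product may arise three times; for larger n the
    -- factor of degree d is unique.
    rcases eq_or_ne d 1 with rfl | h1
    · exact main 3 (by norm_num) (by norm_num) (by norm_num)
    · have h3 : 3 ≤ d := by
        obtain ⟨c, hc⟩ := hodd
        omega
      exact main 1 one_pos (by omega) (by push_cast; linarith [(Nat.cast_nonneg d : (0 : ℝ) ≤ d)])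

/-- The polynomials with an irreducible factor of large prime degree. -/
theorem exists_abundant_prime {n N : ℕ} (hn : 2 ≤ n) (hN : 2 * n ≤ N) (h5 : 5 ≤ N)
    (η : ℤˣ × ℤˣ) : ∃ w : ℝ, 7 / (3 * N) < 4 * w ∧ Abundant n w (fun ℓ _ h => HasClass η h ∧
      ∃ r : (ZMod ℓ)[X], Irreducible r ∧ r ∣ h ∧ r.natDegree.Prime ∧ n < 2 * r.natDegree) := by
  obtain ⟨T, hT, hsum⟩ : ∃ T : Finset ℕ, (∀ p ∈ T, p.Prime ∧ n < 2 * p ∧ p ≤ n) ∧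
      (7 / (3 * N) : ℝ) < ∑ p ∈ T, (1 / p : ℝ) := by
    rcases eq_or_lt_of_le hn with rfl | h3
    · refine ⟨{2}, by norm_num, ?_⟩
      rw [Finset.sum_singleton]
      have : (5 : ℝ) ≤ N := by exact_mod_cast h5
      rw [div_lt_div_iff₀ (by positivity) (by norm_num)]
      push_cast
      linarith
    · obtain ⟨T, hT, hs⟩ := exists_primes_sum_gt h3
      refine ⟨T, hT, lt_of_le_of_lt ?_ hs⟩
      have h1 : (2 * n : ℝ) ≤ N := by exact_mod_cast hN
      have h2 : (0 : ℝ) < n := by exact_mod_cast (by omega : 0 < n)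
      exact div_le_div_of_nonneg_left (by norm_num) (by positivity) (by linarith)
  refine ⟨∑ p ∈ T, 1 / (4 * p : ℝ), ?_, ?_⟩
  · rw [Finset.mul_sum]
    refine hsum.trans_le (Finset.sum_le_sum fun p hp => le_of_eq ?_)
    have : (p : ℝ) ≠ 0 := by exact_mod_cast (hT p hp).1.ne_zero
    field_simp
  -- An arbitrary cofactor of degree n - p is allowed. As p > n/2, each product arises once, and two
  -- different primes cannot both be degrees of irreducible factors, so the families are disjoint.
  · refine (Abundant.exists_mem T (w := fun p => 1 / (4 * p : ℝ)) (P := fun p ℓ _ h => HasClass η h ∧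
      ∃ r : (ZMod ℓ)[X], Irreducible r ∧ r ∣ h ∧ r.natDegree = p) (fun p hp => ?_) ?_).mono
      le_rfl ?_
    · obtain ⟨hpp, hp1, hp2⟩ := hT p hp
      have := (abundant_true (n - p)).mul_irreducible zero_le_one (d := p) (k := 1) hpp.pos one_pos
        (by omega) η
      rw [Nat.sub_add_cancel hp2] at this
      refine this.mono (by simp) ?_
      rintro ℓ _ h - - - - - ⟨hc, s, r, θ, -, -, -, -, -, hrd, hri, -, rfl⟩
      exact ⟨hc, r, hri, dvd_mul_left _ _, hrd⟩
    · rintro p hp q hq hpq ℓ _ h hm hd ⟨-, r, hr, hrh, hrd⟩ ⟨-, s, hs, hsh, hsd⟩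
      have hcop : IsCoprime r s := hr.coprime_iff_not_dvd.2 fun hrs => by
        have := natDegree_eq_of_degree_eq (degree_eq_degree_of_associated
          (hr.associated_of_dvd hs hrs))
        exact hpq (by rw [← hrd, ← hsd, this])
      have := natDegree_le_of_dvd (hcop.mul_dvd hrh hsh) hm.ne_zero
      rw [natDegree_mul hr.ne_zero hs.ne_zero, hrd, hsd, hd] at this
      have := (hT p hp).2.1
      have := (hT q hq).2.1
      omega
    · rintro ℓ _ h - - - - - ⟨p, hp, hc, r, hri, hrh, rfl⟩
      exact ⟨hc, r, hri, hrh, (hT _ hp).1, (hT _ hp).2.1⟩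

/-- All irreducible factors of `k` have odd degree. -/
def OddFactors {ℓ : ℕ} [Fact ℓ.Prime] (k : (ZMod ℓ)[X]) : Prop :=
  ∀ p : (ZMod ℓ)[X], Irreducible p → p ∣ k → Odd p.natDegree

theorem oddFactors_of_irreducible {ℓ : ℕ} [Fact ℓ.Prime] {k : (ZMod ℓ)[X]} (hi : Irreducible k)
    (hk : Odd k.natDegree) : OddFactors k := fun p hp hpk => by
  rwa [natDegree_eq_of_degree_eq (degree_eq_degree_of_associated (hp.associated_of_dvd hi hpk))]

theorem OddFactors.mul {ℓ : ℕ} [Fact ℓ.Prime] {k k' : (ZMod ℓ)[X]} (hk : OddFactors k)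
    (hk' : OddFactors k') : OddFactors (k * k') := fun p hp hpk =>
  (hp.prime.dvd_or_dvd hpk).elim (hk p hp) (hk' p hp)

theorem abundant_quadratic_mul_linear :
    Abundant 3 (1 / 6) (fun ℓ _ h => ∃ q k : (ZMod ℓ)[X],
      q.Monic ∧ Irreducible q ∧ q.natDegree = 2 ∧ OddFactors k ∧ h = q * k) := by
  have := Abundant.classes (S := (Finset.univ : Finset (ℤˣ × ℤˣ))) (m := 3) (w := 1 / 24)
    (P := fun θ ℓ _ h => ∃ q k : (ZMod ℓ)[X],
      q.Monic ∧ Irreducible q ∧ q.natDegree = 2 ∧ OddFactors k ∧ h = q * k) (fun θ _ => ?_)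
  · refine this.mono ?_ ?_
    · rw [show (Finset.univ : Finset (ℤˣ × ℤˣ)).card = 4 from by decide]
      norm_num
    · rintro ℓ _ h - - - - - ⟨η, -, -, hi⟩
      exact hi
  · refine (abundant_irreducible_quadratic.mul_irreducible (by norm_num) (d := 1) (k := 3)
      one_pos (by norm_num) (by norm_num) θ).mono (by norm_num) ?_
    rintro ℓ _ h - - - - - ⟨hc, s, r, θ₁, hs, hsd, hsi, -, hr, hrd, hri, -, rfl⟩
    exact ⟨hc, s, r, hs, hsi, hsd, oddFactors_of_irreducible hri (hrd ▸ odd_one), rfl⟩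

/-- The polynomials with exactly one irreducible factor of even degree, which is quadratic. -/
theorem exists_abundant_quadratic {n j N : ℕ} (hn : 2 ≤ n) (hj : j ≤ 2) (hN : N = 2 * n + j)
    (h5 : 5 ≤ N) (η : ℤˣ × ℤˣ) : ∃ w : ℝ,
      (5 ≤ n → 1 / (9 * (N : ℝ) * (N - 6)) < 4 / 2 ^ j * w) ∧
      (n < 5 → 1 / (N : ℝ) ^ 2 < 4 / 2 ^ j * w) ∧
      Abundant n w (fun ℓ _ h => HasClass η h ∧ ∃ q k : (ZMod ℓ)[X],
        q.Monic ∧ Irreducible q ∧ q.natDegree = 2 ∧ OddFactors k ∧ h = q * k) := by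
  have ha : (1 : ℝ) ≤ 4 / 2 ^ j := by interval_cases j <;> norm_num
  have hbig : ∀ x : ℝ, 0 < x → x < 36 * n * (n - 3) → 5 ≤ n →
      1 / (9 * (N : ℝ) * (N - 6)) < 4 / 2 ^ j * (1 / x) := by
    intro x hx0 hx h5n
    have h1 : (5 : ℝ) ≤ n := by exact_mod_cast h5n
    have h2 : (2 * n : ℝ) ≤ N := by rw [hN]; push_cast; linarith [(Nat.cast_nonneg j : (0 : ℝ) ≤ j)]
    have h3 : x < 9 * (N : ℝ) * (N - 6) := by nlinarith
    calc 1 / (9 * (N : ℝ) * (N - 6)) < 1 / x := one_div_lt_one_div_of_lt hx0 h3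
      _ ≤ _ := le_mul_of_one_le_left (by positivity) ha
  rcases eq_or_lt_of_le hn with rfl | hn3
  · refine ⟨1 / 8, by norm_num, fun _ => ?_, (abundant_irreducible two_pos η).mono (by norm_num) ?_⟩
    · have h5' : (5 : ℝ) ≤ N := by exact_mod_cast h5
      calc 1 / (N : ℝ) ^ 2 < 1 / 8 := one_div_lt_one_div_of_lt (by norm_num) (by nlinarith)
        _ ≤ _ := le_mul_of_one_le_left (by positivity) ha
    · rintro ℓ _ h - hm hd - - ⟨hc, hi⟩
      exact ⟨hc, h, 1, hm, hi, hd, fun p hp hp1 => absurd (isUnit_of_dvd_one hp1) hp.not_isUnit,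
        (mul_one h).symm⟩
  -- The last factor must have odd degree: n - 2 for n odd, and n - 3 for n even, where a linear
  -- factor is inserted. The fibre bounds 3 and 4 are those needed when this degree is 1.
  rcases Nat.even_or_odd n with he | ho
  · obtain ⟨d, rfl⟩ : ∃ d, n = 3 + d := ⟨n - 3, by omega⟩
    have hodd : Odd d := by
      rw [Nat.even_add] at he
      exact Nat.not_even_iff_odd.1 fun h => by
        have := he.2 h
        revert this
        decide
    have hd := hodd.pos
    have hd0 : (1 : ℝ) ≤ d := by exact_mod_cast hd
    refine ⟨1 / (96 * d), hbig _ (by positivity) ?_, fun hn5 => ?_,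
      (abundant_quadratic_mul_linear.mul_irreducible (by norm_num) (d := d) (k := 4) hd (by norm_num)
        (by omega) η).mono (le_of_eq ?_) ?_⟩
    · push_cast; nlinarith
    -- Here n = 4; the tightest case is j = 2 and N = 10, where the inequality is 1/100 < 1/96.
    · obtain rfl : d = 1 := by omega
      subst hN
      interval_cases j <;> norm_num
    · push_cast; field_simp; norm_num
    · rintro ℓ _ h - - - - - ⟨hc, _, r, θ, -, -, ⟨q, k, hq, hqi, hqd, hk, rfl⟩, -, hr, hrd, hri, -, rfl⟩
      exact ⟨hc, q, k * r, hq, hqi, hqd, hk.mul (oddFactors_of_irreducible hri (hrd ▸ hodd)),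
        mul_assoc _ _ _⟩
  · obtain ⟨d, rfl⟩ : ∃ d, n = 2 + d := ⟨n - 2, by omega⟩
    have hodd : Odd d := by
      rw [add_comm, Nat.odd_add] at ho
      exact ho.2 even_two
    have hd := hodd.pos
    have hd0 : (1 : ℝ) ≤ d := by exact_mod_cast hd
    refine ⟨1 / (24 * d), fun h => hbig _ (by positivity) ?_ h, fun hn5 => ?_,
      (abundant_irreducible_quadratic.mul_irreducible (by norm_num) (d := d) (k := 3) hd
        (by norm_num) (by omega) η).mono (le_of_eq ?_) ?_⟩
    · have : (3 : ℝ) ≤ d := by exact_mod_cast (by omega : 3 ≤ d)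
      push_cast; nlinarith
    · obtain rfl : d = 1 := by
        obtain ⟨c, hc⟩ := hodd
        omega
      have h6 : (6 : ℝ) ≤ N := by rw [hN]; push_cast; linarith [(Nat.cast_nonneg j : (0 : ℝ) ≤ j)]
      calc 1 / (N : ℝ) ^ 2 < 1 / (24 * (1 : ℕ)) :=
            one_div_lt_one_div_of_lt (by norm_num) (by push_cast; nlinarith)
        _ ≤ _ := le_mul_of_one_le_left (by positivity) ha
    · push_cast; field_simp; norm_num
    · rintro ℓ _ h - - - - - ⟨hc, q, r, θ, hq, hqd, hqi, -, hr, hrd, hri, -, rfl⟩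
      exact ⟨hc, q, r, hq, hqi, hqd, oddFactors_of_irreducible hri (hrd ▸ hodd), rfl⟩

end Families

/-! ### The densities of the four families -/

section Membership

variable {ℓ : ℕ} [Fact ℓ.Prime]

/-- Squarefreeness of k makes its transform separable, so the normalized irreducible factors of that
transform are distinct and form S. -/
theorem exists_prod_of_oddSplit {n : ℕ} (hn : 2 ≤ n) {s k : (ZMod ℓ)[X]} (hs : s.Monic)
    (hsd : s.natDegree = 1) (hk : k.Monic) (hko : OddSplit k) (hd : (s * k).natDegree = n)
    (hsq : Squarefree (s * k)) (h1 : (s * k).eval 2 ≠ 0) (h3 : (s * k).eval (-2) ≠ 0) :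
    ∃ (p : (ZMod ℓ)[X]) (S : Finset (ZMod ℓ)[X]), p.Monic ∧ p.natDegree = 2 ∧
      (∀ r ∈ S, r.Monic ∧ Irreducible r ∧ Odd r.natDegree) ∧ recip n (s * k) = p * ∏ r ∈ S, r := by
  classical
  have hkd : n = 1 + k.natDegree := by rw [← hd, hs.natDegree_mul hk, hsd]
  have hkm := (recip_monic hk rfl).1
  rw [eval_mul] at h1 h3
  have hksep : k.Separable :=
    PerfectField.separable_iff_squarefree.2 (hsq.squarefree_of_dvd (dvd_mul_left _ _))
  have hsep := separable_recip hk rfl (by omega) hksep (right_ne_zero_of_mul h1)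
    (right_ne_zero_of_mul h3)
  have hnd := (UniqueFactorizationMonoid.squarefree_iff_nodup_normalizedFactors hkm.ne_zero).1
    hsep.squarefree
  have hmem : ∀ r ∈ UniqueFactorizationMonoid.normalizedFactors (recip k.natDegree k),
      r.Monic ∧ Irreducible r ∧ Odd r.natDegree := by
    intro r hr
    have hi := UniqueFactorizationMonoid.irreducible_of_normalized_factor r hr
    refine ⟨?_, hi, hko r hi (UniqueFactorizationMonoid.dvd_of_mem_normalizedFactors hr)⟩
    rw [← UniqueFactorizationMonoid.normalize_normalized_factor r hr]
    exact monic_normalize hi.ne_zero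
  refine ⟨recip 1 s, (UniqueFactorizationMonoid.normalizedFactors (recip k.natDegree k)).toFinset,
    (recip_monic hs hsd).1, (recip_monic hs hsd).2, fun r hr => hmem r (Multiset.mem_toFinset.1 hr),
    ?_⟩
  rw [hkd, recip_mul hsd.le le_rfl]
  congr 1
  rw [Finset.prod, Multiset.toFinset_val, Multiset.dedup_eq_self.2 hnd, Multiset.map_id']
  refine (eq_of_monic_of_associated ?_ hkm
    (UniqueFactorizationMonoid.prod_normalizedFactors hkm.ne_zero)).symm
  have := monic_multiset_prod_of_monic _ (fun r : (ZMod ℓ)[X] => r) fun r hr => (hmem r hr).1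
  rwa [Multiset.map_id'] at this

variable {V : Type*} [AddCommGroup V] [Module (ZMod ℓ) V] [FiniteDimensional (ZMod ℓ) V]
  {Q : QuadraticForm (ZMod ℓ) V}

theorem valueDisc_recip {n : ℕ} (hn : 0 < n) {ε₂ : ℤˣ} {h : (ZMod ℓ)[X]} (hm : h.Monic)
    (hd : h.natDegree = n) (hsq : Squarefree h) {η : ℤˣ × ℤˣ} (hη : HasClass η h)
    (hQ : ((η.1 * η.2 : ℤˣ) : ℤ) = quadraticChar (ZMod ℓ) (quadDisc Q))
    (hv : quadraticChar (ZMod ℓ) ((recip n h).eval (-1)) = (ε₂ : ℤ)) :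
    ValueDisc Q ε₂ (recip n h) := by
  refine ⟨hv, ?_⟩
  rw [discr_recip hm hd hn, map_mul, map_mul, quadraticChar_sq_one', mul_one, hη.1, hη.2, ← hQ,
    Units.val_mul]
  exact resultant_derivative_ne_zero hm hd (PerfectField.separable_iff_squarefree.2 hsq)

theorem isSplit_iff (hℓ : ℓ ≠ 2) (hQ : (QuadraticMap.polarBilin Q).Nondegenerate)
    (hN : Even (Module.finrank (ZMod ℓ) V)) {u : ℤˣ}
    (hu : (u : ℤ) = quadraticChar (ZMod ℓ) (quadDisc Q)) : IsSplit Q ↔ u = 1 := by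
  obtain ⟨n, hn⟩ := hN
  constructor
  · intro hs
    rw [quadraticChar_quadDisc_of_isSplit hQ hs] at hu
    exact Units.ext hu
  · rintro rfl
    exact isSplit_of_quadraticChar_quadDisc hℓ hQ (n := n) (by omega) hu.symm

end Membership

/-! ### Assembly of the four bounds -/

section Bounds

theorem two_mul_Nred_half (N : ℕ) (ε₁ : ℤˣ) : 2 * (Nred N ε₁ / 2) = Nred N ε₁ := by
  rw [Nred]
  rcases Nat.even_or_odd N with ⟨k, hk⟩ | ⟨k, hk⟩
  · rw [if_neg (Nat.not_odd_iff_even.2 ⟨k, hk⟩)]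
    split_ifs <;> omega
  · rw [if_pos ⟨k, hk⟩]
    omega

theorem Nred_le (N : ℕ) (ε₁ : ℤˣ) : Nred N ε₁ ≤ N ∧ N ≤ Nred N ε₁ + 2 := by
  rw [Nred]
  split_ifs <;> omega

theorem four_div_two_pow_le {j : ℕ} (hj : j ≤ 2) : (1 : ℝ) ≤ 4 / 2 ^ j := by
  interval_cases j <;> norm_num

theorem two_le_Nred_half {N : ℕ} (h5 : 5 ≤ N) (ε₁ : ℤˣ) : 2 ≤ Nred N ε₁ / 2 := by
  rw [Nred]
  rcases Nat.even_or_odd N with ⟨k, hk⟩ | ⟨k, hk⟩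
  · rw [if_neg (Nat.not_odd_iff_even.2 ⟨k, hk⟩)]
    split_ifs <;> omega
  · rw [if_pos ⟨k, hk⟩]
    omega

variable {N : ℕ}

/-- One class suffices. In even dimension and determinant 1 its product is the discriminant class of
Q: for Q nonsplit it is -1 and irreducible h have irreducible transforms; for Q split it is 1 and
they split into two halves, or `abundant_mul_of_neg` is used when ℓ ≡ 3 mod 4. In the remaining
cases a class of product -1 is available. -/
theorem le_density_theta1 (h5 : 5 ≤ N) (ε₁ : ℤˣ) : ∃ ℓ₀ : ℕ, ∀ (ℓ : ℕ) [Fact ℓ.Prime], ℓ₀ ≤ ℓ →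
    ∀ (V : Type*) [AddCommGroup V] [Module (ZMod ℓ) V] [FiniteDimensional (ZMod ℓ) V]
      (Q : QuadraticForm (ZMod ℓ) V), Module.finrank (ZMod ℓ) V = N →
      (QuadraticMap.polarBilin Q).Nondegenerate → ∀ ε₂ : ℤˣ,
      1 / (4 * (N : ℝ) ^ 2) ≤ density Q (sievingSet Q ε₁ ε₂ (thetaPoly1 Q ε₁ ε₂)) := by
  set n := Nred N ε₁ / 2 with hn
  have hn2 : 2 ≤ n := two_le_Nred_half h5 ε₁
  have hNr : 2 * n = Nred N ε₁ := two_mul_Nred_half N ε₁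
  obtain ⟨hle, hle'⟩ := Nred_le N ε₁
  have ha := four_div_two_pow_le (j := N - Nred N ε₁) (by omega)
  have ha0 : (0 : ℝ) ≤ 4 / 2 ^ (N - Nred N ε₁) := by linarith
  have hn2' : (2 : ℝ) ≤ n := by exact_mod_cast hn2
  have hnN : (2 * n : ℝ) ≤ N := by exact_mod_cast hNr.le.trans hle
  have ht : ∀ x : ℝ, 0 < x → x < 4 * (N : ℝ) ^ 2 →
      1 / (4 * (N : ℝ) ^ 2) < 4 / 2 ^ (N - Nred N ε₁) * (1 / x) := fun x h0 hx =>
    (one_div_lt_one_div_of_lt h0 hx).trans_le (le_mul_of_one_le_left (by positivity) ha)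
  have H1 := fun η => (abundant_irreducible (d := n) (by omega) η).eventually ha0
    (ht _ (by positivity) (by nlinarith))
  have H2 := fun η : {η : ℤˣ × ℤˣ // η.1 * η.2 = 1} =>
    (abundant_mul_of_neg hn2 η.2).eventually ha0 (ht _ (by nlinarith) (by nlinarith))
  choose ℓ₁ hℓ₁ using H1
  choose ℓ₂ hℓ₂ using H2
  refine ⟨max 3 (max (Finset.univ.sup ℓ₁) (Finset.univ.sup ℓ₂)), fun ℓ _ hℓ V _ _ _ Q hV hQ ε₂ => ?_⟩
  have hℓ2 : ℓ ≠ 2 := by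
    have := (le_max_left _ _).trans hℓ
    omega
  have hl1 : ∀ η, ℓ₁ η ≤ ℓ := fun η => (Finset.le_sup (Finset.mem_univ η)).trans
    ((le_max_left _ _).trans ((le_max_right _ _).trans hℓ))
  have hl2 : ∀ η, ℓ₂ η ≤ ℓ := fun η => (Finset.le_sup (Finset.mem_univ η)).trans
    ((le_max_right _ _).trans ((le_max_right _ _).trans hℓ))
  obtain ⟨G, hGc, hGn, hGe, hGd⟩ := exists_goodClasses hℓ2 hQ hV h5 ε₁ ε₂
  rw [← hn] at hGe hGd
  by_cases hc : Even N ∧ ε₁ = 1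
  · obtain ⟨η, hηG⟩ : G.Nonempty := Finset.card_pos.1 (by rw [hGc]; positivity)
    obtain ⟨hdisc, hval⟩ := hGe hc η hηG
    have hsplit := isSplit_iff hℓ2 hQ (hV ▸ hc.1) hdisc
    have hodd : ¬ (Odd N ∨ ε₁ = -1) := by
      rintro (h | h)
      · exact (Nat.not_odd_iff_even.2 hc.1) h
      · rw [hc.2] at h
        exact absurd h (by decide)
    by_cases hs : IsSplit Q
    · have hD := hsplit.1 hs
      have hℓ4 : ℓ % 4 = 1 ∨ ℓ % 4 = 3 := by
        have := (Fact.out : ℓ.Prime).eq_two_or_odd.resolve_left hℓ2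
        omega
      rcases hℓ4 with h4 | h4
      · obtain ⟨A, hA, hAc⟩ := hℓ₁ η ℓ (hl1 η) hℓ2
        refine hAc.trans (hGd _ A fun h hh => ?_)
        obtain ⟨hm, hd, -, -, hcl, hi⟩ := hA h hh
        refine ⟨hm, hd, ?_, η, hηG, hcl⟩
        rw [thetaPoly1, Set.mem_ofPred_eq, hV, ← hNr]
        refine ⟨recip_mem_selfRecip hm hd, fun h => absurd h hodd, fun _ => ⟨fun h => absurd hs h,
          fun _ _ => ?_, fun _ h => by omega⟩⟩
        obtain ⟨p, q, hp, hpi, hq, hqi, hpq, hpd, hqd, e⟩ := exists_factors_recip hℓ2 hm hd hi hcl hD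
        exact ⟨p, q, hp, hpi, hq, hqi, hpq, by rw [hpd], by rw [hqd], e⟩
      · obtain ⟨A, hA, hAc⟩ := hℓ₂ ⟨η, hD⟩ ℓ (hl2 _) hℓ2
        refine hAc.trans (hGd _ A fun h hh => ?_)
        obtain ⟨hm, hd, -, -, hcl, s, r, θ, θ', hsm, hsd, hθ, hθD, hr, hrd, hri, hθ', hθD', e⟩ :=
          hA h hh
        refine ⟨hm, hd, ?_, η, hηG, hcl⟩
        rw [thetaPoly1, Set.mem_ofPred_eq, hV, ← hNr]
        refine ⟨recip_mem_selfRecip hm hd, fun h => absurd h hodd, fun _ => ⟨fun h => absurd hs h,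
          fun _ h => by omega, fun _ _ => ?_⟩⟩
        have hsi : Irreducible s := irreducible_of_degree_eq_one
          ((degree_eq_iff_natDegree_eq_of_pos one_pos).2 hsd)
        refine ⟨recip 1 s, recip (n - 1) r, (recip_monic hsm hsd).1,
          irreducible_recip hℓ2 hsm hsd hsi hθ hθD, (recip_monic hsm hsd).2,
          irreducible_recip hℓ2 hr hrd hri hθ' hθD', ?_, ?_⟩
        · rw [(recip_monic hr hrd).2]
          omega
        · rw [e, ← recip_mul hsd.le hrd.le, Nat.add_sub_cancel' (by omega)]
    · have hD : η.1 * η.2 = -1 := (Int.units_eq_one_or _).resolve_left fun h => hs (hsplit.2 h)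
      obtain ⟨A, hA, hAc⟩ := hℓ₁ η ℓ (hl1 η) hℓ2
      refine hAc.trans (hGd _ A fun h hh => ?_)
      obtain ⟨hm, hd, -, -, hcl, hi⟩ := hA h hh
      refine ⟨hm, hd, ?_, η, hηG, hcl⟩
      rw [thetaPoly1, Set.mem_ofPred_eq, hV, ← hNr]
      exact ⟨recip_mem_selfRecip hm hd, fun h => absurd h hodd, fun _ =>
        ⟨fun _ => ⟨irreducible_recip hℓ2 hm hd hi hcl hD, valueDisc_recip (by omega) hm hd
          hi.squarefree hcl hdisc (hval h hd hcl)⟩, fun h => absurd h hs, fun h => absurd h hs⟩⟩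
  · obtain ⟨η, hηG, hD⟩ := hGn hc
    obtain ⟨A, hA, hAc⟩ := hℓ₁ η ℓ (hl1 η) hℓ2
    refine hAc.trans (hGd _ A fun h hh => ?_)
    obtain ⟨hm, hd, -, -, hcl, hi⟩ := hA h hh
    refine ⟨hm, hd, ?_, η, hηG, hcl⟩
    rw [thetaPoly1, Set.mem_ofPred_eq, hV, ← hNr]
    exact ⟨recip_mem_selfRecip hm hd, fun _ => irreducible_recip hℓ2 hm hd hi hcl hD,
      fun h => absurd h hc⟩

theorem compatible_recip {ℓ : ℕ} [Fact ℓ.Prime] {V : Type*} [AddCommGroup V] [Module (ZMod ℓ) V]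
    [FiniteDimensional (ZMod ℓ) V] {Q : QuadraticForm (ZMod ℓ) V} (h5 : 5 ≤ N)
    (hV : Module.finrank (ZMod ℓ) V = N) {ε₁ ε₂ : ℤˣ} {η : ℤˣ × ℤˣ}
    (hG : Even N ∧ ε₁ = 1 → ((η.1 * η.2 : ℤˣ) : ℤ) = quadraticChar (ZMod ℓ) (quadDisc Q) ∧
        ∀ h : (ZMod ℓ)[X], h.natDegree = Nred N ε₁ / 2 → HasClass η h →
          quadraticChar (ZMod ℓ) ((recip (Nred N ε₁ / 2) h).eval (-1)) = (ε₂ : ℤ))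
    {h : (ZMod ℓ)[X]} (hm : h.Monic) (hd : h.natDegree = Nred N ε₁ / 2) (hη : HasClass η h)
    (hsq : Squarefree h) : Compatible Q ε₁ ε₂ (recip (Nred N ε₁ / 2) h) := by
  intro he h1
  rw [hV] at he
  obtain ⟨hdisc, hval⟩ := hG ⟨he, h1⟩
  have := two_le_Nred_half h5 ε₁
  exact valueDisc_recip (by omega) hm hd hsq hη hdisc (hval h hd hη)

/-- Families which are available for all classes. -/
theorem le_density_of_forall_class (h5 : 5 ≤ N) (ε₁ : ℤˣ)
    {P : ∀ (ℓ : ℕ) [Fact ℓ.Prime], (ZMod ℓ)[X] → Prop} {w : ℤˣ × ℤˣ → ℝ} {T : ℝ}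
    (hT : ∀ η, T < 4 * w η)
    (hw : ∀ η, Abundant (Nred N ε₁ / 2) (w η) (fun ℓ _ h => HasClass η h ∧ P ℓ h)) :
    ∃ ℓ₀ : ℕ, ∀ (ℓ : ℕ) [Fact ℓ.Prime], ℓ₀ ≤ ℓ →
    ∀ (V : Type*) [AddCommGroup V] [Module (ZMod ℓ) V] [FiniteDimensional (ZMod ℓ) V]
      (Q : QuadraticForm (ZMod ℓ) V), Module.finrank (ZMod ℓ) V = N →
      (QuadraticMap.polarBilin Q).Nondegenerate → ∀ (ε₂ : ℤˣ) (Θ : Set (ZMod ℓ)[X]),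
      (∀ h : (ZMod ℓ)[X], h.Monic → h.natDegree = Nred N ε₁ / 2 → h.eval 2 ≠ 0 → h.eval (-2) ≠ 0 →
        P ℓ h → Squarefree h → Compatible Q ε₁ ε₂ (recip (Nred N ε₁ / 2) h) →
          recip (Nred N ε₁ / 2) h ∈ Θ) →
      T ≤ density Q (sievingSet Q ε₁ ε₂ Θ) := by
  -- The set of good classes depends on ℓ and Q, but only finitely many sets are possible, so a
  -- threshold is chosen for each of them beforehand.
  have H : ∀ G : Finset (ℤˣ × ℤˣ), ∃ ℓ₀ : ℕ, G.card = 2 ^ (N - Nred N ε₁) →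
      ∀ (ℓ : ℕ) [Fact ℓ.Prime], ℓ₀ ≤ ℓ → ℓ ≠ 2 → ∃ A : Finset (ZMod ℓ)[X],
        (∀ h ∈ A, h.Monic ∧ h.natDegree = Nred N ε₁ / 2 ∧ h.eval 2 ≠ 0 ∧ h.eval (-2) ≠ 0 ∧
          (∃ η ∈ G, HasClass η h ∧ P ℓ h) ∧ Squarefree h) ∧
          T ≤ 4 / 2 ^ (N - Nred N ε₁) * (A.card / (ℓ : ℝ) ^ (Nred N ε₁ / 2)) *
            (1 - ((Nred N ε₁ / 2 : ℕ) : ℝ) / ℓ) := by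
    intro G
    by_cases hG : G.card = 2 ^ (N - Nred N ε₁)
    · have h0 : (0 : ℝ) < 2 ^ (N - Nred N ε₁) := by positivity
      have := (Abundant.exists_mem G (fun η _ => hw η)
        fun η _ θ _ hne ℓ _ h _ _ hη hθ => hne (hη.1.unique hθ.1)).squarefree.eventually
        (a := 4 / 2 ^ (N - Nred N ε₁)) (t := T) (by positivity) (by
          have hne : G.Nonempty := Finset.card_pos.1 (by rw [hG]; positivity)
          -- The number of classes in G cancels the denominator of 4/2^j.
          have := Finset.sum_lt_sum_of_nonempty hne fun η _ => hT η
          rw [Finset.sum_const, nsmul_eq_mul, hG, ← Finset.mul_sum] at this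
          push_cast at this
          rw [div_mul_eq_mul_div, lt_div_iff₀ h0, mul_comm]
          exact this)
      obtain ⟨ℓ₀, h⟩ := this
      exact ⟨ℓ₀, fun _ => h⟩
    · exact ⟨0, fun h => absurd h hG⟩
  choose ℓ₁ hℓ₁ using H
  refine ⟨max 3 (Finset.univ.sup ℓ₁), fun ℓ _ hℓ V _ _ _ Q hV hQ ε₂ Θ hΘ => ?_⟩
  have hℓ2 : ℓ ≠ 2 := by
    have := (le_max_left _ _).trans hℓ
    omega
  obtain ⟨G, hGc, -, hGe, hGd⟩ := exists_goodClasses hℓ2 hQ hV h5 ε₁ ε₂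
  obtain ⟨A, hA, hAc⟩ := hℓ₁ G hGc ℓ
    ((Finset.le_sup (Finset.mem_univ G)).trans ((le_max_right _ _).trans hℓ)) hℓ2
  refine hAc.trans (hGd _ A fun h hh => ?_)
  obtain ⟨hm, hd, h1, h3, ⟨η, hηG, hcl, hP⟩, hsq⟩ := hA h hh
  exact ⟨hm, hd, hΘ h hm hd h1 h3 hP hsq
    (compatible_recip h5 hV (fun hc => hGe hc η hηG) hm hd hcl hsq), η, hηG, hcl⟩

/-- Families for which a single class suffices. -/
theorem le_density_of_exists_class (h5 : 5 ≤ N) (ε₁ : ℤˣ)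
    {P : ∀ (ℓ : ℕ) [Fact ℓ.Prime], (ZMod ℓ)[X] → Prop} {w : ℤˣ × ℤˣ → ℝ} {T : ℝ}
    (hT : ∀ η, T < 4 / 2 ^ (N - Nred N ε₁) * w η)
    (hw : ∀ η, Abundant (Nred N ε₁ / 2) (w η) (fun ℓ _ h => HasClass η h ∧ P ℓ h)) :
    ∃ ℓ₀ : ℕ, ∀ (ℓ : ℕ) [Fact ℓ.Prime], ℓ₀ ≤ ℓ →
    ∀ (V : Type*) [AddCommGroup V] [Module (ZMod ℓ) V] [FiniteDimensional (ZMod ℓ) V]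
      (Q : QuadraticForm (ZMod ℓ) V), Module.finrank (ZMod ℓ) V = N →
      (QuadraticMap.polarBilin Q).Nondegenerate → ∀ (ε₂ : ℤˣ) (Θ : Set (ZMod ℓ)[X]),
      (∀ h : (ZMod ℓ)[X], h.Monic → h.natDegree = Nred N ε₁ / 2 → h.eval 2 ≠ 0 → h.eval (-2) ≠ 0 →
        P ℓ h → Squarefree h → Compatible Q ε₁ ε₂ (recip (Nred N ε₁ / 2) h) →
          recip (Nred N ε₁ / 2) h ∈ Θ) →
      T ≤ density Q (sievingSet Q ε₁ ε₂ Θ) := by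
  have H := fun η => (hw η).squarefree.eventually (by positivity) (hT η)
  choose ℓ₁ hℓ₁ using H
  refine ⟨max 3 (Finset.univ.sup ℓ₁), fun ℓ _ hℓ V _ _ _ Q hV hQ ε₂ Θ hΘ => ?_⟩
  have hℓ2 : ℓ ≠ 2 := by
    have := (le_max_left _ _).trans hℓ
    omega
  obtain ⟨G, hGc, -, hGe, hGd⟩ := exists_goodClasses hℓ2 hQ hV h5 ε₁ ε₂
  obtain ⟨η, hηG⟩ : G.Nonempty := Finset.card_pos.1 (by rw [hGc]; positivity)
  obtain ⟨A, hA, hAc⟩ := hℓ₁ η ℓ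
    ((Finset.le_sup (Finset.mem_univ η)).trans ((le_max_right _ _).trans hℓ)) hℓ2
  refine hAc.trans (hGd _ A fun h hh => ?_)
  obtain ⟨hm, hd, h1, h3, ⟨hcl, hP⟩, hsq⟩ := hA h hh
  exact ⟨hm, hd, hΘ h hm hd h1 h3 hP hsq
    (compatible_recip h5 hV (fun hc => hGe hc η hηG) hm hd hcl hsq), η, hηG, hcl⟩

section ThetaMembership

variable {ℓ : ℕ} [Fact ℓ.Prime] {V : Type*} [AddCommGroup V] [Module (ZMod ℓ) V]
  [FiniteDimensional (ZMod ℓ) V] {Q : QuadraticForm (ZMod ℓ) V} {ε₁ ε₂ : ℤˣ}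

theorem recip_mem_thetaPoly2 (h5 : 5 ≤ N) (hV : Module.finrank (ZMod ℓ) V = N)
    {h : (ZMod ℓ)[X]} (hm : h.Monic) (hd : h.natDegree = Nred N ε₁ / 2) (h1 : h.eval 2 ≠ 0)
    (h3 : h.eval (-2) ≠ 0) (hsq : Squarefree h)
    (hcomp : Compatible Q ε₁ ε₂ (recip (Nred N ε₁ / 2) h))
    (hP : ∃ s k : (ZMod ℓ)[X], s.Monic ∧ s.natDegree = 1 ∧ k.Monic ∧ OddSplit k ∧ h = s * k) :
    recip (Nred N ε₁ / 2) h ∈ thetaPoly2 Q ε₁ ε₂ := by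
  have hmem : recip (Nred N ε₁ / 2) h ∈ selfRecip (ZMod ℓ) (Nred N ε₁) := by
    have := recip_mem_selfRecip hm hd
    rwa [two_mul_Nred_half] at this
  rw [thetaPoly2, Set.mem_ofPred_eq, hV]
  refine ⟨hmem, hcomp, ?_⟩
  obtain ⟨s, k, hs, hsd, hk, hko, e⟩ := hP
  rw [e] at hd hsq h1 h3 ⊢
  exact exists_prod_of_oddSplit (two_le_Nred_half h5 ε₁) hs hsd hk hko hd hsq h1 h3

theorem recip_mem_thetaPoly3 (hV : Module.finrank (ZMod ℓ) V = N)
    {h : (ZMod ℓ)[X]} (hm : h.Monic) (hd : h.natDegree = Nred N ε₁ / 2) (hsq : Squarefree h)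
    (hcomp : Compatible Q ε₁ ε₂ (recip (Nred N ε₁ / 2) h)) {r : (ZMod ℓ)[X]} (hr : Irreducible r)
    (hrh : r ∣ h) (hrp : r.natDegree.Prime) (hrn : Nred N ε₁ < 4 * r.natDegree) :
    recip (Nred N ε₁ / 2) h ∈ thetaPoly3 Q ε₁ ε₂ := by
  have hmem : recip (Nred N ε₁ / 2) h ∈ selfRecip (ZMod ℓ) (Nred N ε₁) := by
    have := recip_mem_selfRecip hm hd
    rwa [two_mul_Nred_half] at this
  rw [thetaPoly3, Set.mem_ofPred_eq, hV]
  exact ⟨hmem, hcomp, h, isTraceOf_recip hd.le,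
    PerfectField.separable_iff_squarefree.2 hsq, r, hr, hrh, hrp, hrn⟩

theorem recip_mem_thetaPoly4 (hV : Module.finrank (ZMod ℓ) V = N)
    {h : (ZMod ℓ)[X]} (hm : h.Monic) (hd : h.natDegree = Nred N ε₁ / 2) (hsq : Squarefree h)
    (hcomp : Compatible Q ε₁ ε₂ (recip (Nred N ε₁ / 2) h)) {q k : (ZMod ℓ)[X]} (hq : q.Monic)
    (hqi : Irreducible q) (hqd : q.natDegree = 2) (hk : OddFactors k) (e : h = q * k) :
    recip (Nred N ε₁ / 2) h ∈ thetaPoly4 Q ε₁ ε₂ := by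
  have hmem : recip (Nred N ε₁ / 2) h ∈ selfRecip (ZMod ℓ) (Nred N ε₁) := by
    have := recip_mem_selfRecip hm hd
    rwa [two_mul_Nred_half] at this
  have huniq : ∀ s : (ZMod ℓ)[X], s.Monic → Irreducible s → s ∣ h → Even s.natDegree → s = q := by
    intro s hs hsi hsh hse
    rw [e] at hsh
    rcases hsi.prime.dvd_or_dvd hsh with hd | hd
    · exact eq_of_monic_of_associated hs hq (hsi.associated_of_dvd hqi hd)
    · exact absurd (hk s hsi hd) (Nat.not_odd_iff_even.2 hse)
  rw [thetaPoly4, Set.mem_ofPred_eq, hV]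
  exact ⟨hmem, hcomp, h, isTraceOf_recip hd.le,
    PerfectField.separable_iff_squarefree.2 hsq, q, hq, hqi, ⟨k, e⟩, hqd, huniq⟩

end ThetaMembership

theorem le_density_theta2 (h5 : 5 ≤ N) (ε₁ : ℤˣ) : ∃ ℓ₀ : ℕ, ∀ (ℓ : ℕ) [Fact ℓ.Prime], ℓ₀ ≤ ℓ →
    ∀ (V : Type*) [AddCommGroup V] [Module (ZMod ℓ) V] [FiniteDimensional (ZMod ℓ) V]
      (Q : QuadraticForm (ZMod ℓ) V), Module.finrank (ZMod ℓ) V = N →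
      (QuadraticMap.polarBilin Q).Nondegenerate → ∀ ε₂ : ℤˣ,
      1 / (5 * (N : ℝ)) ≤ density Q (sievingSet Q ε₁ ε₂ (thetaPoly2 Q ε₁ ε₂)) := by
  have hn2 : 2 ≤ Nred N ε₁ / 2 := two_le_Nred_half h5 ε₁
  have hNr := two_mul_Nred_half N ε₁
  have hle := (Nred_le N ε₁).1
  choose w hw hA using fun η => exists_abundant_oddSplit hn2 η
  obtain ⟨ℓ₀, h⟩ := le_density_of_forall_class h5 ε₁ (T := 1 / (5 * (N : ℝ))) (fun η => by
    refine lt_of_le_of_lt (one_div_le_one_div_of_le ?_ ?_) (hw η)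
    · have : (0 : ℝ) < (Nred N ε₁ / 2 : ℕ) := by exact_mod_cast (by omega)
      positivity
    · have : (2 * (Nred N ε₁ / 2 : ℕ) : ℝ) ≤ N := by exact_mod_cast hNr.le.trans hle
      linarith) hA
  refine ⟨ℓ₀, fun ℓ _ hℓ V _ _ _ Q hV hQ ε₂ => h ℓ hℓ V Q hV hQ ε₂ _ ?_⟩
  exact fun h hm hd h1 h3 hP hsq hcomp =>
    recip_mem_thetaPoly2 h5 hV hm hd h1 h3 hsq hcomp hP

theorem le_density_theta3 (h5 : 5 ≤ N) (ε₁ : ℤˣ) : ∃ ℓ₀ : ℕ, ∀ (ℓ : ℕ) [Fact ℓ.Prime], ℓ₀ ≤ ℓ →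
    ∀ (V : Type*) [AddCommGroup V] [Module (ZMod ℓ) V] [FiniteDimensional (ZMod ℓ) V]
      (Q : QuadraticForm (ZMod ℓ) V), Module.finrank (ZMod ℓ) V = N →
      (QuadraticMap.polarBilin Q).Nondegenerate → ∀ ε₂ : ℤˣ,
      7 / (3 * (N : ℝ)) ≤ density Q (sievingSet Q ε₁ ε₂ (thetaPoly3 Q ε₁ ε₂)) := by
  have hn2 : 2 ≤ Nred N ε₁ / 2 := two_le_Nred_half h5 ε₁
  have hNr := two_mul_Nred_half N ε₁
  have hle := (Nred_le N ε₁).1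
  choose w hw hA using fun η => exists_abundant_prime hn2 (hNr.le.trans hle) h5 η
  obtain ⟨ℓ₀, h⟩ := le_density_of_forall_class h5 ε₁ hw hA
  refine ⟨ℓ₀, fun ℓ _ hℓ V _ _ _ Q hV hQ ε₂ => h ℓ hℓ V Q hV hQ ε₂ _ ?_⟩
  rintro h hm hd - - ⟨r, hr, hrh, hrp, hrn⟩ hsq hcomp
  exact recip_mem_thetaPoly3 hV hm hd hsq hcomp hr hrh hrp (by omega)

theorem le_density_theta4 (h5 : 5 ≤ N) (ε₁ : ℤˣ) : ∃ ℓ₀ : ℕ, ∀ (ℓ : ℕ) [Fact ℓ.Prime], ℓ₀ ≤ ℓ →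
    ∀ (V : Type*) [AddCommGroup V] [Module (ZMod ℓ) V] [FiniteDimensional (ZMod ℓ) V]
      (Q : QuadraticForm (ZMod ℓ) V), Module.finrank (ZMod ℓ) V = N →
      (QuadraticMap.polarBilin Q).Nondegenerate → ∀ ε₂ : ℤˣ,
      (10 ≤ Nred N ε₁ → 1 / (9 * (N : ℝ) * ((N : ℝ) - 6)) ≤
        density Q (sievingSet Q ε₁ ε₂ (thetaPoly4 Q ε₁ ε₂))) ∧
      (Nred N ε₁ < 10 → 1 / (N : ℝ) ^ 2 ≤
        density Q (sievingSet Q ε₁ ε₂ (thetaPoly4 Q ε₁ ε₂))) := by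
  have hn2 : 2 ≤ Nred N ε₁ / 2 := two_le_Nred_half h5 ε₁
  have hNr := two_mul_Nred_half N ε₁
  obtain ⟨hle, hle'⟩ := Nred_le N ε₁
  choose w hw1 hw2 hA using fun η => exists_abundant_quadratic (j := N - Nred N ε₁) hn2 (by omega)
    (by omega) h5 η
  obtain ⟨ℓ₀, h⟩ := le_density_of_exists_class h5 ε₁ (T := if 10 ≤ Nred N ε₁ then
    1 / (9 * (N : ℝ) * ((N : ℝ) - 6)) else 1 / (N : ℝ) ^ 2) (fun η => by
      split_ifs with h10
      · exact hw1 η (by omega)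
      · exact hw2 η (by omega)) hA
  refine ⟨ℓ₀, fun ℓ _ hℓ V _ _ _ Q hV hQ ε₂ => ?_⟩
  have key := h ℓ hℓ V Q hV hQ ε₂ (thetaPoly4 Q ε₁ ε₂) ?_
  · exact ⟨fun h10 => by rwa [if_pos h10] at key, fun h10 => by rwa [if_neg (by omega)] at key⟩
  · rintro h hm hd - - ⟨q, k, hq, hqi, hqd, hk, e⟩ hsq hcomp
    exact recip_mem_thetaPoly4 hV hm hd hsq hcomp hq hqi hqd hk e

end Bounds

end

end OrthSieve

theorem mainTheorem6 (N : ℕ) (hN : 5 ≤ N) :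
    ∃ ℓ₀ : ℕ, ∀ (ℓ : ℕ) [Fact ℓ.Prime], ℓ₀ ≤ ℓ →
      ∀ (V : Type*) [AddCommGroup V] [Module (ZMod ℓ) V] [FiniteDimensional (ZMod ℓ) V]
        (Q : QuadraticForm (ZMod ℓ) V), Module.finrank (ZMod ℓ) V = N → (QuadraticMap.polarBilin Q).Nondegenerate →
      ∀ ε₁ ε₂ : ℤˣ,
        1 / (4 * (N : ℝ) ^ 2) ≤
          OrthSieve.density Q (OrthSieve.sievingSet Q ε₁ ε₂ (OrthSieve.thetaPoly1 Q ε₁ ε₂)) ∧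
        1 / (5 * (N : ℝ)) ≤
          OrthSieve.density Q (OrthSieve.sievingSet Q ε₁ ε₂ (OrthSieve.thetaPoly2 Q ε₁ ε₂)) ∧
        7 / (3 * (N : ℝ)) ≤
          OrthSieve.density Q (OrthSieve.sievingSet Q ε₁ ε₂ (OrthSieve.thetaPoly3 Q ε₁ ε₂)) ∧
        (10 ≤ OrthSieve.Nred N ε₁ → 1 / (9 * (N : ℝ) * ((N : ℝ) - 6)) ≤
          OrthSieve.density Q (OrthSieve.sievingSet Q ε₁ ε₂ (OrthSieve.thetaPoly4 Q ε₁ ε₂))) ∧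
        (OrthSieve.Nred N ε₁ < 10 → 1 / (N : ℝ) ^ 2 ≤
          OrthSieve.density Q (OrthSieve.sievingSet Q ε₁ ε₂ (OrthSieve.thetaPoly4 Q ε₁ ε₂))) := by
  choose ℓ₁ h₁ using fun ε₁ => OrthSieve.le_density_theta1 hN ε₁
  choose ℓ₂ h₂ using fun ε₁ => OrthSieve.le_density_theta2 hN ε₁
  choose ℓ₃ h₃ using fun ε₁ => OrthSieve.le_density_theta3 hN ε₁
  choose ℓ₄ h₄ using fun ε₁ => OrthSieve.le_density_theta4 hN ε₁
  refine ⟨Finset.univ.sup fun ε₁ => max (max (ℓ₁ ε₁) (ℓ₂ ε₁)) (max (ℓ₃ ε₁) (ℓ₄ ε₁)),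
    fun ℓ _ hℓ V _ _ _ Q hV hQ ε₁ ε₂ => ?_⟩
  have hle := (Finset.le_sup (f := fun ε₁ => max (max (ℓ₁ ε₁) (ℓ₂ ε₁)) (max (ℓ₃ ε₁) (ℓ₄ ε₁)))
    (Finset.mem_univ ε₁)).trans hℓ
  simp only [max_le_iff] at hle
  exact ⟨h₁ ε₁ ℓ hle.1.1 V Q hV hQ ε₂, h₂ ε₁ ℓ hle.1.2 V Q hV hQ ε₂,
    h₃ ε₁ ℓ hle.2.1 V Q hV hQ ε₂, h₄ ε₁ ℓ hle.2.2 V Q hV hQ ε₂⟩
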